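/- Conventions. A \emph{topological category} $\mathcal A$ is a small category internal to topological spaces: $\mathrm{ob}(\mathcal A)$ and $\mathrm{mor}(\mathcal A)$ are spaces, and source, target, identity and composition are continuous. An \emph{internal functor} is a functor that is continuous on objects and on morphisms. A (left) \emph{$\mathcal A$-module} is a space $X$ with a continuous map $f_X:X\to\mathrm{ob}(\mathcal A)$ and a continuous, unital and associative action $\mathrm{mor}(\mathcal A)\times_{\mathrm{ob}(\mathcal A)}X\to X$; write $X(a)=f_X^{-1}(a)$. Let $B(*,\mathcal A,X)_\bullet$ be the simplicial space with $$B(*,\mathcal A,X)_n=\{(a_0\to a_1\to\cdots\to a_n,\;x)\;:\;x\in X(a_0)\},$$ topologized as the iterated fibre product $\mathrm{mor}(\mathcal A)\times_{\mathrm{ob}(\mathcal A)}\cdots\times_{\mathrm{ob}(\mathcal A)}\mathrm{mor}(\mathcal A)\times_{\mathrm{ob}(\mathcal A)}X$, in which an order-preserving map $\theta:[m]\to[n]$ acts by $(a_0\to\cdots\to a_n,x)\mapsto(a_{\theta(0)}\to\cdots\to a_{\theta(m)},X(\alpha)(x))$ with $\alpha:a_0\to a_{\theta(0)}$ the composite.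 Define $\operatorname{hocolim}_{\mathcal A}X$ to be its geometric realization $|B(*,\mathcal A,X)_\bullet|$. A small category is regarded as a topological category with discrete spaces of objects and morphisms; a functor $F$ from it to topological spaces is regarded as the module $\coprod_d F(d)$. For a small category $\mathcal C$, let $\Delta^\bullet\downarrow\mathcal C$ be the category whose objects are the pairs $([k],\sigma:[k]\to\mathcal C)$ and whose morphisms $([k_0],\sigma_0)\to([k_1],\sigma_1)$ are the order-preserving maps $\theta:[k_1]\to[k_0]$ with $\sigma_1=\sigma_0\theta$. Given a topological category $\mathcal A$, an $\mathcal A$-module $X$ and an internal functor $\rho:\mathcal A\to\mathcal C$ to a discrete category, let $\rho_*X:\Delta^\bullet\downarrow\mathcal C\to\mathrm{Top}$ be the functor whose value at $\sigma:[k]\to\mathcal C$ is the subspace of $B(*,\mathcal A,X)_k$ of those $(a_0\to\cdots\to a_k,x)$ whose chain is sent by $\rho$ to $\sigma$, and which sends $\theta$ to the restriction of the simplicial operator of $\theta$. Theorem. Let $\mathcal C$ be a discrete category, let $\mathcal A$ be a topological category, $X$ an $\mathcal A$-module and $\rho:\mathcal A\to\mathcal C$ an internal functor. There is a map $$\operatorname{hocolim}_{\Delta^\bullet\downarrow\mathcal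 C}\rho_*X\longrightarrow\operatorname{hocolim}_{\mathcal A}X,$$ natural in $(\mathcal A,X,\mathcal C,\rho)$, which is a homotopy equivalence whenever the identity map $\mathrm{ob}(\mathcal A)\to\mathrm{mor}(\mathcal A)$ is a closed cofibration over $\mathrm{ob}(\mathcal A)\times\mathrm{ob}(\mathcal A)$ (with respect to the diagonal and the source-target map), i.e. has closed image and the homotopy extension property for maps and homotopies over $\mathrm{ob}(\mathcal A)\times\mathrm{ob}(\mathcal A)$. Here a morphism $(\mathcal A,X,\mathcal C,\rho)\to(\mathcal A',X',\mathcal C',\rho')$ consists of an internal functor $F:\mathcal A\to\mathcal A'$, a functor $G:\mathcal C\to\mathcal C'$ with $G\rho=\rho'F$, and a continuous map $X\to X'$ over $F$ that respects the actions. -/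

import Mathlib

open CategoryTheory Opposite

set_option linter.checkUnivs false

universe v u

/-- The set of all morphisms of a category. -/
@[ext]
structure Mor (C : Type u) [Category.{v} C] : Type (max u v) where
  {source target : C}
  hom : source ⟶ target

/-- A topological category, i.e. a category internal to topological spaces: a (small) category
with topologies on the set of objects and on the set of all morphisms for which source, target,
identity and composition (on the space `mor ×_ob mor` of composable pairs) are continuous. -/
structure TopologicalCategory where
  ob : Type u
  [cat : Category.{v} ob]
  [topOb : TopologicalSpace ob]
  [topMor : TopologicalSpace (Mor ob)]
  continuous_source : Continuous fun f : Mor ob => f.source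
  continuous_target : Continuous fun f : Mor ob => f.target
  continuous_id : Continuous fun a : ob => Mor.mk (𝟙 a)
  continuous_comp : Continuous fun p : {p : Mor ob × Mor ob // p.1.target = p.2.source} =>
    Mor.mk (p.1.1.hom ≫ eqToHom p.2 ≫ p.1.2.hom)

attribute [instance] TopologicalCategory.cat TopologicalCategory.topOb TopologicalCategory.topMor

namespace TopologicalCategory

/-- The space of morphisms. -/
abbrev mor (A : TopologicalCategory.{v, u}) : Type (max u v) := Mor A.ob

/-- A small category with the discrete topology on objects and on morphisms. -/
@[reducible]
def discrete (C : Type u) [Category.{v} C] : TopologicalCategory.{v, u} where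
  ob := C
  topOb := ⊥
  topMor := ⊥
  continuous_source := continuous_bot
  continuous_target := continuous_bot
  continuous_id := continuous_bot
  continuous_comp :=
    letI : TopologicalSpace (Mor C) := ⊥
    haveI : DiscreteTopology (Mor C) := ⟨rfl⟩
    continuous_of_discreteTopology

end TopologicalCategory

/-- `i : E → Y` is a closed cofibration over `B`, where `p : Y → B` is the structure map of `Y`
(and `p ∘ i` that of `E`): its image is closed and it has the homotopy extension property for
fibrewise maps and fibrewise homotopies into arbitrary spaces `Z` over `B`. -/
structure IsClosedCofibrationOver {B E Y : Type u} [TopologicalSpace B] [TopologicalSpace E]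
    [TopologicalSpace Y] (i : E → Y) (p : Y → B) : Prop where
  continuous : Continuous i
  continuous_proj : Continuous p
  isClosed_range : IsClosed (Set.range i)
  extension : ∀ (Z : Type u) [TopologicalSpace Z] (q : C(Z, B)) (f : C(Y, Z))
    (h : C(E × unitInterval, Z)), (∀ y, q (f y) = p y) → (∀ e t, q (h (e, t)) = p (i e)) →
    (∀ e, h (e, 0) = f (i e)) →
    ∃ H : C(Y × unitInterval, Z), (∀ y t, q (H (y, t)) = p y) ∧ (∀ y, H (y, 0) = f y) ∧
      ∀ e t, H (i e, t) = h (e, t)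

/-- The condition on a topological category that the identity map `ob → mor` is a closed
cofibration over `ob × ob`, with respect to the diagonal and the source-target map. -/
def TopologicalCategory.IdentityIsCofibration (A : TopologicalCategory.{u, u}) : Prop :=
  IsClosedCofibrationOver (fun a : A.ob => Mor.mk (𝟙 a)) fun f : A.mor => (f.source, f.target)

/-- The map on morphisms given by a functor. -/
def CategoryTheory.Functor.mapMor {C D : Type u} [Category.{v} C] [Category.{v} D] (F : C ⥤ D)
    (f : Mor C) : Mor D :=
  ⟨F.map f.hom⟩

/-- An internal functor between topological categories: a functor that is continuous on objects
and on morphisms. -/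
@[ext]
structure InternalFunctor (A B : TopologicalCategory.{v, u}) where
  functor : A.ob ⥤ B.ob
  continuous_obj : Continuous functor.obj
  continuous_map : Continuous functor.mapMor

namespace InternalFunctor

def id (A : TopologicalCategory.{v, u}) : InternalFunctor A A :=
  ⟨𝟭 _, continuous_id, continuous_id⟩

def comp {A B C : TopologicalCategory.{v, u}} (F : InternalFunctor A B)
    (G : InternalFunctor B C) : InternalFunctor A C :=
  ⟨F.functor ⋙ G.functor, G.continuous_obj.comp F.continuous_obj,
    G.continuous_map.comp F.continuous_map⟩

end InternalFunctor

/-- A left module over a topological category: a space `X` with a map `proj : X → ob` and an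
action `mor ×_ob X → X` which is continuous, unital and associative. -/
structure LeftModule (A : TopologicalCategory.{v, u}) where
  space : Type u
  [top : TopologicalSpace space]
  proj : space → A.ob
  continuous_proj : Continuous proj
  act : ∀ (f : A.mor) (x : space), f.source = proj x → space
  proj_act : ∀ f x h, proj (act f x h) = f.target
  continuous_act : Continuous fun z : {z : A.mor × space // z.1.source = proj z.2} =>
    act z.1.1 z.1.2 z.2
  act_id : ∀ x, act ⟨𝟙 (proj x)⟩ x rfl = x
  act_comp : ∀ {a b c : A.ob} (f : a ⟶ b) (g : b ⟶ c) (x : space) (h : a = proj x),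
    act ⟨f ≫ g⟩ x h = act ⟨g⟩ (act ⟨f⟩ x h) (proj_act ⟨f⟩ x h).symm

attribute [instance] LeftModule.top

namespace LeftModule

variable {D : Type u} [Category.{v} D] (F : D ⥤ TopCat.{u})

theorem continuous_fst_discrete :
    @Continuous (Σ d : D, F.obj d) D _ ⊥ Sigma.fst := by
  let _ : TopologicalSpace D := ⊥
  exact continuous_sigma fun d => continuous_const

theorem continuous_act_discrete :
    let _ : TopologicalSpace (Mor D) := ⊥
    Continuous fun z : {z : Mor D × Σ d : D, F.obj d // z.1.source = z.2.1} =>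
      (⟨z.1.1.target, F.map (eqToHom z.2.symm ≫ z.1.1.hom) z.1.2.2⟩ : Σ d : D, F.obj d) := by
  intro _
  have : DiscreteTopology (Mor D) := ⟨rfl⟩
  classical
  let g : Mor D × (Σ d : D, F.obj d) → Σ d : D, F.obj d := fun z =>
    if h : z.1.source = z.2.1 then ⟨z.1.target, F.map (eqToHom h.symm ≫ z.1.hom) z.2.2⟩ else z.2
  have hg : Continuous g := by
    rw [continuous_prod_of_discrete_left]
    refine fun f => continuous_sigma fun d => ?_
    by_cases h : f.source = d
    · simp only [g, h, dite_true]
      exact (continuous_sigmaMk (σ := fun d => F.obj d)).comp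
        (F.map (eqToHom h.symm ≫ f.hom)).hom.continuous
    · simp only [g, h, dite_false]
      exact continuous_sigmaMk (σ := fun d => F.obj d)
  refine (hg.comp continuous_subtype_val).congr fun z => ?_
  simp only [g, Function.comp_apply, z.2, dite_true]

end LeftModule

/-- A functor from a small category to topological spaces, as a left module over the discrete
topological category: the total space is the disjoint union of the values. -/
@[reducible]
def LeftModule.ofFunctor {D : Type u} [Category.{v} D] (F : D ⥤ TopCat.{u}) :
    LeftModule (TopologicalCategory.discrete D) where
  space := Σ d : D, F.obj d
  proj := Sigma.fst
  continuous_proj := continuous_fst_discrete F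
  act f x h := ⟨f.target, F.map (eqToHom h.symm ≫ f.hom) x.2⟩
  proj_act _ _ _ := rfl
  continuous_act := continuous_act_discrete F
  act_id := by
    rintro ⟨d, x⟩
    simp
  act_comp := by
    rintro a b c f g ⟨d, x⟩ h
    simp

/-- A topological category together with a left module over it. -/
structure CatWithModule where
  A : TopologicalCategory.{v, u}
  X : LeftModule A

namespace CatWithModule

/-- Morphisms `(A, X) → (A', X')`: an internal functor `A → A'` and a continuous map `X → X'`
over it that respects the actions. -/
@[ext]
structure Hom (P Q : CatWithModule.{v, u}) where
  functor : InternalFunctor P.A Q.A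
  map : C(P.X.space, Q.X.space)
  proj_map : ∀ x, Q.X.proj (map x) = functor.functor.obj (P.X.proj x)
  map_act : ∀ (f : P.A.mor) (x : P.X.space) (h : f.source = P.X.proj x),
    map (P.X.act f x h) = Q.X.act (functor.functor.mapMor f) (map x)
      ((congrArg functor.functor.obj h).trans (proj_map x).symm)

instance : Category CatWithModule.{v, u} where
  Hom := Hom
  id P := ⟨.id _, .id _, fun _ => rfl, fun _ _ _ => rfl⟩
  comp f g := ⟨f.functor.comp g.functor, g.map.comp f.map,
    fun x => (g.proj_map _).trans (congrArg g.functor.functor.obj (f.proj_map x)),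
    fun a x h => (congrArg g.map (f.map_act a x h)).trans (g.map_act _ _ _)⟩

/-- The `n`-simplices of `B(*, A, X)`: a chain `a₀ → a₁ → ⋯ → aₙ` in `A` and a point of `X`
over `a₀`. -/
structure BarSimplex (P : CatWithModule.{v, u}) (n : ℕ) where
  chain : ComposableArrows P.A.ob n
  pt : P.X.space
  eq : chain.obj 0 = P.X.proj pt

namespace BarSimplex

variable {P Q : CatWithModule.{v, u}} {n : ℕ}

theorem ext' {z w : BarSimplex P n} (h₁ : z.chain = w.chain) (h₂ : z.pt = w.pt) : z = w := by
  cases z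
  cases w
  cases h₁
  cases h₂
  rfl

/-- The arrow `aᵢ → aⱼ` of the chain. -/
def arrow (z : BarSimplex P n) (i j : Fin (n + 1)) (h : i ≤ j) : P.A.mor :=
  ⟨z.chain.map (homOfLE h)⟩

/-- The inclusion of the `n`-simplices in `mor × ⋯ × mor × X`. -/
def toProd (z : BarSimplex P n) : (Fin n → P.A.mor) × P.X.space :=
  (fun i => z.arrow i.castSucc i.succ i.castSucc_le_succ, z.pt)

/-- The topology of the iterated fibre product `mor ×_ob ⋯ ×_ob mor ×_ob X`. -/
instance : TopologicalSpace (BarSimplex P n) := TopologicalSpace.induced toProd inferInstance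

theorem continuous_toProd : Continuous (toProd : BarSimplex P n → _) :=
  continuous_induced_dom

theorem continuous_pt : Continuous fun z : BarSimplex P n => z.pt :=
  (continuous_snd.comp continuous_toProd).congr fun _ => rfl

theorem continuous_spine (i : Fin n) :
    Continuous fun z : BarSimplex P n => z.arrow i.castSucc i.succ i.castSucc_le_succ :=
  ((continuous_apply i).comp (continuous_fst.comp continuous_toProd)).congr fun _ => rfl

theorem continuous_obj (i : Fin (n + 1)) :
    Continuous fun z : BarSimplex P n => z.chain.obj i := by
  induction i using Fin.cases with
  | zero => exact (P.X.continuous_proj.comp continuous_pt).congr fun z => z.eq.symm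
  | succ i => exact (P.A.continuous_target.comp (continuous_spine i)).congr fun _ => rfl

theorem continuous_arrow_self (i : Fin (n + 1)) :
    Continuous fun z : BarSimplex P n => z.arrow i i le_rfl :=
  (P.A.continuous_id.comp (continuous_obj i)).congr fun z =>
    congrArg Mor.mk (z.chain.map_id i).symm

theorem continuous_arrow (i j : Fin (n + 1)) (h : i ≤ j) :
    Continuous fun z : BarSimplex P n => z.arrow i j h := by
  induction j using Fin.induction with
  | zero =>
    obtain rfl : i = 0 := le_antisymm h (Fin.zero_le _)
    exact continuous_arrow_self 0
  | succ j ih =>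
    rcases h.eq_or_lt with rfl | hlt
    · exact continuous_arrow_self _
    · have hij : i ≤ j.castSucc := Fin.le_castSucc_iff.mpr hlt
      have key : Continuous fun z : BarSimplex P n =>
          (⟨(z.arrow i j.castSucc hij, z.arrow j.castSucc j.succ j.castSucc_le_succ), rfl⟩ :
            {p : P.A.mor × P.A.mor // p.1.target = p.2.source}) :=
        ((ih hij).prodMk (continuous_spine j)).subtype_mk _
      refine (P.A.continuous_comp.comp key).congr fun z => ?_
      refine congrArg Mor.mk ?_
      change z.chain.map _ ≫ 𝟙 _ ≫ z.chain.map _ = z.chain.map _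
      rw [Category.id_comp, ← Functor.map_comp]
      rfl

/-- The simplicial operator of an order-preserving map `θ : [m] → [n]`: it sends
`(a₀ → ⋯ → aₙ, x)` to `(a_{θ(0)} → ⋯ → a_{θ(m)}, α x)`, where `α : a₀ → a_{θ(0)}`. -/
def pull {m n : ℕ} (θ : Fin (m + 1) →o Fin (n + 1)) (z : BarSimplex P n) : BarSimplex P m where
  chain := θ.monotone.functor ⋙ z.chain
  pt := P.X.act (z.arrow 0 (θ 0) (Fin.zero_le _)) z.pt z.eq
  eq := (P.X.proj_act (z.arrow 0 (θ 0) (Fin.zero_le _)) z.pt z.eq).symm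

theorem continuous_pull {m n : ℕ} (θ : Fin (m + 1) →o Fin (n + 1)) :
    Continuous (pull (P := P) θ) := by
  refine continuous_induced_rng.2 (Continuous.prodMk (continuous_pi fun i => ?_) ?_)
  · exact (continuous_arrow (P := P) _ _ (θ.monotone i.castSucc_le_succ)).congr fun _ => rfl
  · have key : Continuous fun z : BarSimplex P n =>
        (⟨(z.arrow 0 (θ 0) (Fin.zero_le _), z.pt), z.eq⟩ :
          {w : P.A.mor × P.X.space // w.1.source = P.X.proj w.2}) :=
      ((continuous_arrow _ _ _).prodMk continuous_pt).subtype_mk _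
    exact (P.X.continuous_act.comp key).congr fun _ => rfl

theorem act_map_self (z : BarSimplex P n) (i : Fin (n + 1)) (hi : i = 0) (f : (0 : Fin (n + 1)) ⟶ i) :
    P.X.act ⟨z.chain.map f⟩ z.pt z.eq = z.pt := by
  subst hi
  obtain rfl : f = 𝟙 _ := Subsingleton.elim _ _
  obtain ⟨c, x, h⟩ := z
  have : ∀ (a : P.A.ob) (h : a = P.X.proj x), P.X.act ⟨𝟙 a⟩ x h = x := by
    rintro _ rfl
    exact P.X.act_id x
  simpa using this _ h

theorem pull_id (z : BarSimplex P n) : pull OrderHom.id z = z :=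
  ext' rfl (act_map_self z _ rfl _)

theorem pull_comp {k m n : ℕ} (η : Fin (k + 1) →o Fin (m + 1)) (θ : Fin (m + 1) →o Fin (n + 1))
    (z : BarSimplex P n) : pull (θ.comp η) z = pull η (pull θ z) := by
  refine ext' rfl ?_
  refine Eq.trans ?_ (P.X.act_comp (z.chain.map (homOfLE (Fin.zero_le (θ 0))))
    (z.chain.map (homOfLE (θ.monotone (Fin.zero_le (η 0))))) z.pt z.eq)
  simp only [pull, arrow, ← Functor.map_comp, homOfLE_comp]
  rfl

/-- The map on `n`-simplices induced by a morphism `(A, X) → (A', X')`. -/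
def push (F : P ⟶ Q) (z : BarSimplex P n) : BarSimplex Q n where
  chain := z.chain ⋙ F.functor.functor
  pt := F.map z.pt
  eq := (congrArg F.functor.functor.obj z.eq).trans (F.proj_map _).symm

theorem continuous_push (F : P ⟶ Q) : Continuous (push (n := n) F) :=
  continuous_induced_rng.2 ((continuous_pi fun i =>
    (F.functor.continuous_map.comp (continuous_spine i)).congr fun _ => rfl).prodMk
      (F.map.continuous.comp continuous_pt))

theorem push_pull (F : P ⟶ Q) {m n : ℕ} (θ : Fin (m + 1) →o Fin (n + 1)) (z : BarSimplex P n) :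
    push F (pull θ z) = pull θ (push F z) :=
  ext' rfl (F.map_act (z.arrow 0 (θ 0) (Fin.zero_le _)) z.pt z.eq)

end BarSimplex

/-- The bar construction, as a functor `(A, X) ↦ B(*, A, X)_•` to simplicial spaces. -/
def bar : CatWithModule.{v, u} ⥤ SimplicialObject TopCat.{max u v} where
  obj P :=
    { obj n := TopCat.of (BarSimplex P n.unop.len)
      map θ := TopCat.ofHom ⟨BarSimplex.pull θ.unop.toOrderHom, BarSimplex.continuous_pull _⟩
      map_id n := by
        ext z
        exact BarSimplex.pull_id z
      map_comp f g := by
        ext z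
        exact BarSimplex.pull_comp _ _ z }
  map F :=
    { app n := TopCat.ofHom ⟨BarSimplex.push F, BarSimplex.continuous_push F⟩
      naturality m n θ := by
        ext z
        exact BarSimplex.push_pull F θ.unop.toOrderHom z }

end CatWithModule

namespace SimplicialSpace

/-- The disjoint union of the spaces `Yₙ × Δⁿ`. -/
abbrev Pre (Y : SimplicialObject TopCat.{u}) : Type u :=
  Σ n : SimplexCategory, Y.obj (op n) × stdSimplex ℝ (Fin (n.len + 1))

/-- The relation `(θ^* y, t) ∼ (y, θ_* t)`, for `θ : [m] → [n]`, `y ∈ Yₙ` and `t ∈ Δᵐ`. -/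
inductive Rel (Y : SimplicialObject TopCat.{u}) : Pre Y → Pre Y → Prop
  | intro {m n : SimplexCategory} (θ : m ⟶ n) (y : Y.obj (op n))
      (t : stdSimplex ℝ (Fin (m.len + 1))) :
      Rel Y ⟨m, Y.map θ.op y, t⟩ ⟨n, y, stdSimplex.map θ.toOrderHom t⟩

/-- The map on the disjoint unions induced by a map of simplicial spaces. -/
def preMap {Y Z : SimplicialObject TopCat.{u}} (f : Y ⟶ Z) (w : Pre Y) : Pre Z :=
  ⟨w.1, f.app _ w.2.1, w.2.2⟩

theorem continuous_preMap {Y Z : SimplicialObject TopCat.{u}} (f : Y ⟶ Z) :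
    Continuous (preMap f) :=
  continuous_sigma fun n => continuous_sigmaMk.comp
    (((f.app (op n)).hom.continuous.comp continuous_fst).prodMk continuous_snd)

theorem preMap_rel {Y Z : SimplicialObject TopCat.{u}} (f : Y ⟶ Z) {a b : Pre Y}
    (h : Rel Y a b) : Rel Z (preMap f a) (preMap f b) := by
  obtain ⟨θ, y, t⟩ := h
  have : f.app _ (Y.map θ.op y) = Z.map θ.op (f.app _ y) := by
    rw [← ConcreteCategory.comp_apply, ← ConcreteCategory.comp_apply, f.naturality]
  simp only [preMap, this]
  exact Rel.intro θ _ t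

/-- The geometric realization of simplicial spaces, with the quotient topology (`Quot` divides by
the equivalence relation generated by `Rel`). -/
def realization : SimplicialObject TopCat.{u} ⥤ TopCat.{u} where
  obj Y := TopCat.of (Quot (Rel Y))
  map f := TopCat.ofHom ⟨Quot.map (preMap f) fun _ _ => preMap_rel f,
    continuous_quot_lift _ (continuous_quot_mk.comp (continuous_preMap f))⟩
  map_id Y := by
    ext ⟨w⟩
    rfl
  map_comp f g := by
    ext ⟨w⟩
    rfl

end SimplicialSpace

/-- The homotopy colimit `hocolim_A X = B(*, A, X)` of a module over a topological category,
functorially in `(A, X)`. -/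
def hocolim : CatWithModule.{v, u} ⥤ TopCat.{max u v} :=
  CatWithModule.bar ⋙ SimplicialSpace.realization

/-- A topological category `A` with a left module `X` and an internal functor `ρ : A → C` to a
small category `C`, considered as a discrete topological category. -/
structure ModuleOverDiscrete extends CatWithModule.{u, u} where
  C : Type u
  [catC : SmallCategory C]
  ρ : InternalFunctor A (TopologicalCategory.discrete C)

attribute [instance] ModuleOverDiscrete.catC

namespace ModuleOverDiscrete

/-- Morphisms `(A, X, C, ρ) → (A', X', C', ρ')`: a morphism `(A, X) → (A', X')` and a functor
`C → C'` which strictly commute with `ρ` and `ρ'`. -/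
structure Hom (D E : ModuleOverDiscrete.{u}) where
  hom : D.toCatWithModule ⟶ E.toCatWithModule
  base : D.C ⥤ E.C
  comm : D.ρ.functor ⋙ base = hom.functor.functor ⋙ E.ρ.functor

instance : Category ModuleOverDiscrete.{u} where
  Hom := Hom
  id D := ⟨𝟙 _, 𝟭 _, rfl⟩
  comp {D E G} f g := ⟨f.hom ≫ g.hom, f.base ⋙ g.base,
    (congrArg (· ⋙ g.base) f.comm).trans (congrArg (f.hom.functor.functor ⋙ ·) g.comm)⟩

/-- The forgetful functor `(A, X, C, ρ) ↦ (A, X)`. -/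
def forget : ModuleOverDiscrete.{u} ⥤ CatWithModule.{u, u} where
  obj D := D.toCatWithModule
  map f := f.hom

end ModuleOverDiscrete

/-- The category `Δ^• ↓ C`: objects are pairs `([k], σ : [k] → C)`, and morphisms
`([k₀], σ₀) → ([k₁], σ₁)` are order-preserving maps `θ : [k₁] → [k₀]` with `σ₁ = σ₀ θ`. -/
abbrev SimplexOver (C : Type u) [SmallCategory C] : Type u := (nerve C).Elements

namespace ModuleOverDiscrete

open CatWithModule

/-- The value of `ρ_* X` at `σ : [k] → C`: the preimage of `σ` under
`B(*, A, X)_k → B(*, A, *)_k → B(*, C, *)_k`, with the subspace topology. -/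
abbrev Fibre (D : ModuleOverDiscrete.{u}) (σ : SimplexOver D.C) : Type u :=
  {z : BarSimplex D.toCatWithModule σ.1.unop.len // z.chain ⋙ D.ρ.functor = σ.2}

/-- The functor `ρ_* X : Δ^• ↓ C → Top`. -/
def pushforward (D : ModuleOverDiscrete.{u}) : SimplexOver D.C ⥤ TopCat.{u} where
  obj σ := TopCat.of (D.Fibre σ)
  map {σ τ} θ := TopCat.ofHom
    ⟨fun z => ⟨BarSimplex.pull θ.1.unop.toOrderHom z.1,
      (congrArg (fun c => (nerve D.C).map θ.1 c) z.2).trans θ.2⟩,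
    ((BarSimplex.continuous_pull _).comp continuous_subtype_val).subtype_mk _⟩
  map_id σ := by
    ext z
    exact BarSimplex.pull_id z.1
  map_comp f g := by
    ext z
    exact BarSimplex.pull_comp _ _ z.1

/-- The functor `Δ^• ↓ C → Δ^• ↓ C'` given by composition with the functor `C → C'`. -/
def mapSimplexOver {D E : ModuleOverDiscrete.{u}} (f : D ⟶ E) :
    InternalFunctor (TopologicalCategory.discrete (SimplexOver D.C))
      (TopologicalCategory.discrete (SimplexOver E.C)) where
  functor :=
    { obj σ := ⟨σ.1, σ.2 ⋙ f.base⟩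
      map θ := ⟨θ.1, congrArg (· ⋙ f.base) θ.2⟩ }
  continuous_obj := continuous_bot
  continuous_map := continuous_bot

/-- The map `ρ_* X (σ) → ρ'_* X' (σ')` induced by a morphism, where `σ'` is the image of `σ`. -/
def mapFibre {D E : ModuleOverDiscrete.{u}} (f : D ⟶ E) (σ : SimplexOver D.C) (z : D.Fibre σ) :
    E.Fibre ((mapSimplexOver f).functor.obj σ) :=
  ⟨BarSimplex.push f.hom z.1,
    (congrArg (z.1.chain ⋙ ·) f.comm).symm.trans (congrArg (· ⋙ f.base) z.2)⟩

theorem continuous_mapFibre {D E : ModuleOverDiscrete.{u}} (f : D ⟶ E) (σ : SimplexOver D.C) :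
    Continuous (mapFibre f σ) :=
  ((BarSimplex.continuous_push f.hom).comp continuous_subtype_val).subtype_mk _

theorem mapFibre_pushforward {D E : ModuleOverDiscrete.{u}} (f : D ⟶ E) {σ τ : SimplexOver D.C}
    (θ : σ ⟶ τ) (z : D.Fibre σ) :
    mapFibre f τ (D.pushforward.map θ z) =
      E.pushforward.map ((mapSimplexOver f).functor.map θ) (mapFibre f σ z) :=
  Subtype.ext (BarSimplex.push_pull f.hom θ.1.unop.toOrderHom z.1)

theorem mapFibre_act {D E : ModuleOverDiscrete.{u}} (f : D ⟶ E) {σ σ' τ : SimplexOver D.C}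
    (θ : σ' ⟶ τ) (z : D.Fibre σ) (h : σ' = σ)
    (h' : (mapSimplexOver f).functor.obj σ' = (mapSimplexOver f).functor.obj σ) :
    mapFibre f τ (D.pushforward.map (eqToHom h.symm ≫ θ) z) =
      E.pushforward.map (eqToHom h'.symm ≫ (mapSimplexOver f).functor.map θ) (mapFibre f σ z) := by
  subst h
  rw [eqToHom_refl, eqToHom_refl, Category.id_comp, Category.id_comp]
  exact mapFibre_pushforward f θ z

/-- The discrete category `Δ^• ↓ C` with the module `ρ_* X`, functorially in `(A, X, C, ρ)`. -/
def simplexModule : ModuleOverDiscrete.{u} ⥤ CatWithModule.{0, u} where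
  obj D := ⟨TopologicalCategory.discrete (SimplexOver D.C), LeftModule.ofFunctor D.pushforward⟩
  map {D E} f :=
    { functor := mapSimplexOver f
      map :=
        { toFun := fun w => ⟨(mapSimplexOver f).functor.obj w.1, mapFibre f w.1 w.2⟩
          continuous_toFun := continuous_sigma fun σ =>
            continuous_sigmaMk.comp (continuous_mapFibre f σ) }
      proj_map := fun _ => rfl
      map_act := fun θ w h => Sigma.ext rfl (heq_of_eq (mapFibre_act f θ.hom w.2 h (congrArg _ h))) }
  map_id D := rfl
  map_comp f g := rfl

end ModuleOverDiscrete

/-! Write `Y` for the simplicial space `B(*, A, X)` and `Sing X Z` for the simplicial set whose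
`n`-simplices are the continuous maps `X × Δⁿ → Z`. A map `|Y| → Z` is a family of simplicial maps
`Δ[k] → Sing Y_k Z`, natural in `[k]`. The other side has the same form. A chain `σ₀ → ⋯ → σₙ` in
`Δ^• ↓ C` consists of `σ₀ : [k] → C` and a chain of maps into `[k]` beginning with the identity.
Since `ρ` is continuous into a discrete category, the chain in `C` below a point of `Y_k` is locally
constant. Hence a map out of the homotopy colimit of `ρ_* X` is a natural family `N(FaceCat [k]) →
Sing Y_k Z`, where `FaceCat [k]` is the category of maps into `[k]`. The comparison map comes from
sending a map into `[k]` to its first vertex.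

The two cosimplicial simplicial sets are joined by a cylinder. `Coll k` is the collage of the first
vertex functor `FaceCat [k] → [k]`, and the cylinder is the part of its nerve in which each vertex
occurring as a point lies in every face of the chain. One end is the nerve of faces (`base`), the
other is `Δ[k]` (`pts`). Let `bd` be the simplices whose vertices do not exhaust `[k]`, i.e. those
coming from smaller `k`. The combinatorial core is that both `base ∪ bd` and `pts ∪ bd` include
anodynely in the cylinder (`Coll.anodyneExtensions_base_sup_bd`,
`Coll.anodyneExtensions_pts_sup_bd`).

The topological core is that the degenerate simplices form an NDR in `Y_k`. The cofibration
hypothesis deforms morphisms towards identities without changing source or target, so the arrows of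
a chain can be deformed independently and the point of `X` stays put. An NDR pair `(X, L)` makes
`Sing X Z → Sing L Z` a Kan fibration (`NDR.fibration`).

Together these allow induction on `k` (`exists_extension`): a natural family on one end extends to
the cylinder, because the smaller degrees prescribe it on `bd` and over the degenerate simplices,
and what remains is a lifting problem of an anodyne map against a fibration. The same statement for
`Y × I`, relative to `Y × {0, 1}`, shows that two families on the cylinder which agree on one end
are homotopic (`exists_homotopy`).

Finally, extend the family of the identity of the homotopy colimit from `base` to the cylinder and
restrict it to `pts`. This gives the homotopy inverse, and uniqueness up to homotopy, relative to
`pts` and to `base` respectively, gives the two homotopies. -/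

set_option autoImplicit false

section
open Simplicial

/-! ### Gluing along finite closed covers, retractions onto subsets of `Fin (n + 1)` -/

/-- Maps on the members of a finite closed cover which agree on overlaps glue. -/
theorem exists_continuousMap_of_isClosed_cover {ι T Z : Type*} [Finite ι] [TopologicalSpace T]
    [TopologicalSpace Z] (s : ι → Set T) (hs : ∀ i, IsClosed (s i)) (hc : ∀ x, ∃ i, x ∈ s i)
    (g : ∀ i, C(s i, Z))
    (hg : ∀ i j x (hi : x ∈ s i) (hj : x ∈ s j), g i ⟨x, hi⟩ = g j ⟨x, hj⟩) :
    ∃ G : C(T, Z), ∀ i x (hx : x ∈ s i), G x = g i ⟨x, hx⟩ := by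
  choose k hk using hc
  have key : ∀ i x (hx : x ∈ s i), g (k x) ⟨x, hk x⟩ = g i ⟨x, hx⟩ := fun i x hx => hg _ _ _ _ _
  refine ⟨⟨fun x => g (k x) ⟨x, hk x⟩, ?_⟩, key⟩
  refine (locallyFinite_of_finite s).continuous (Set.eq_univ_of_forall fun x =>
    Set.mem_iUnion.2 ⟨k x, hk x⟩) hs fun i => ?_
  rw [continuousOn_iff_continuous_domRestrict]
  exact (g i).continuous.congr fun x => (key i x x.2).symm

/-- Every nonempty subset of a finite linear order is a retract of it. -/
theorem exists_orderHom_retraction {n : ℕ} (S : Set (Fin (n + 1))) (hS : S.Nonempty) :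
    ∃ r : Fin (n + 1) →o Fin (n + 1), (∀ l, r l ∈ S) ∧ ∀ l ∈ S, r l = l := by
  classical
  let T : Finset (Fin (n + 1)) := S.toFinset
  have hT : T.Nonempty := by simpa [T] using hS
  -- The retraction sends `l` to the largest element of `S` below it, and to the least element of
  -- `S` if there is none.
  let f : Fin (n + 1) → Fin (n + 1) := fun l =>
    if h : (T.filter (· ≤ l)).Nonempty then (T.filter (· ≤ l)).max' h else T.min' hT
  refine ⟨⟨f, fun a b hab => ?_⟩, fun l => ?_, fun l hl => ?_⟩
  · by_cases ha : (T.filter (· ≤ a)).Nonempty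
    · have hb : (T.filter (· ≤ b)).Nonempty := ha.mono fun x => by
        simp only [Finset.mem_filter]; exact fun h => ⟨h.1, h.2.trans hab⟩
      simp only [f, ha, hb, dite_true]
      refine Finset.max'_subset _ fun x => ?_
      simp only [Finset.mem_filter]; exact fun h => ⟨h.1, h.2.trans hab⟩
    · simp only [f, ha, dite_false]
      split_ifs with hb
      · refine Finset.min'_le _ _ ?_
        exact (Finset.mem_filter.1 ((T.filter (· ≤ b)).max'_mem hb)).1
      · exact le_rfl
  · change f l ∈ S
    have : f l ∈ T := by
      by_cases h : (T.filter (· ≤ l)).Nonempty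
      · simp only [f, h, dite_true]
        exact (Finset.mem_filter.1 ((T.filter (· ≤ l)).max'_mem h)).1
      · simp only [f, h, dite_false]
        exact T.min'_mem hT
    simpa [T] using this
  · have hl' : l ∈ T.filter (· ≤ l) := by simpa [T] using hl
    have h : (T.filter (· ≤ l)).Nonempty := ⟨l, hl'⟩
    change f l = l
    simp only [f, h, dite_true]
    exact le_antisymm (Finset.mem_filter.1 ((T.filter (· ≤ l)).max'_mem h)).2
      (Finset.le_max' _ _ hl')

theorem stdSimplex.map_apply_of_support {m n : ℕ} (f g : Fin (m + 1) → Fin (n + 1))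
    (t : stdSimplex ℝ (Fin (m + 1))) (h : ∀ l, t l ≠ 0 → f l = g l) :
    stdSimplex.map f t = stdSimplex.map g t := by
  ext k
  simp only [stdSimplex.map_coe, FunOnFinite.linearMap_apply_apply]
  rw [Finset.sum_filter, Finset.sum_filter]
  refine Finset.sum_congr rfl fun l _ => ?_
  by_cases hl : t l = 0
  · simp [hl]
  · rw [h l hl]

theorem stdSimplex.map_apply_eq_zero {m n : ℕ} (f : Fin (m + 1) → Fin (n + 1))
    (t : stdSimplex ℝ (Fin (m + 1))) (k : Fin (n + 1)) (hk : ∀ l, f l ≠ k) :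
    stdSimplex.map f t k = 0 := by
  simp only [stdSimplex.map_coe, FunOnFinite.linearMap_apply_apply]
  refine Finset.sum_eq_zero fun l hl => ?_
  exact absurd (by simpa using hl) (hk l)

theorem stdSimplex.map_apply_ne_zero {m n : ℕ} (f : Fin (m + 1) → Fin (n + 1))
    (t : stdSimplex ℝ (Fin (m + 1))) (l : Fin (m + 1)) (hl : t l ≠ 0) :
    stdSimplex.map f t (f l) ≠ 0 := by
  simp only [stdSimplex.map_coe, FunOnFinite.linearMap_apply_apply]
  refine (lt_of_lt_of_le ((stdSimplex.zero_le t l).lt_of_ne hl.symm) ?_).ne'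
  exact Finset.single_le_sum (f := fun l => t l) (fun j _ => stdSimplex.zero_le t j) (by simp)

theorem stdSimplex.exists_apply_ne_zero {m : ℕ} (t : stdSimplex ℝ (Fin (m + 1))) :
    ∃ l, t l ≠ 0 := by
  by_contra! h
  have := stdSimplex.sum_eq_one t
  simp [h] at this

/-! ### Relative singular sets -/

/-- The affine map `Δᵐ → Δⁿ` given by an order-preserving map. -/
noncomputable def affineMap {m n : SimplexCategory} (θ : m ⟶ n) :
    C(stdSimplex ℝ (Fin (m.len + 1)), stdSimplex ℝ (Fin (n.len + 1))) :=
  ⟨stdSimplex.map θ.toOrderHom, stdSimplex.continuous_map _⟩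

@[simp] theorem affineMap_id (n : SimplexCategory) : affineMap (𝟙 n) = .id _ :=
  ContinuousMap.ext fun t => stdSimplex.map_id_apply t

@[simp] theorem affineMap_comp {m n k : SimplexCategory} (θ : m ⟶ n) (η : n ⟶ k) :
    affineMap (θ ≫ η) = (affineMap η).comp (affineMap θ) :=
  ContinuousMap.ext fun t => by
    change stdSimplex.map (η.toOrderHom ∘ θ.toOrderHom) t = stdSimplex.map _ (stdSimplex.map _ t)
    rw [stdSimplex.map_comp_apply]

/-- The simplicial set of maps from `X × Δⁿ` to `Z`. -/
noncomputable def Sing (X Z : Type u) [TopologicalSpace X] [TopologicalSpace Z] : SSet.{u} where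
  obj n := C(X × stdSimplex ℝ (Fin (n.unop.len + 1)), Z)
  map θ := ↾fun f => f.comp ((ContinuousMap.id X).prodMap (affineMap θ.unop))
  map_id n := by
    simp only [unop_id, affineMap_id]
    rfl
  map_comp {m n k} θ η := by
    simp only [unop_comp, affineMap_comp]
    rfl

namespace Sing

variable {X X' X'' Z Z' : Type u} [TopologicalSpace X] [TopologicalSpace X'] [TopologicalSpace X'']
  [TopologicalSpace Z'] [TopologicalSpace Z]

/-- The simplices of `Sing X Z` are maps. -/
def val {n : SimplexCategoryᵒᵖ} (s : (Sing X Z).obj n) :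
    C(X × stdSimplex ℝ (Fin (n.unop.len + 1)), Z) := s

/-- The simplex given by a map. -/
def mk {n : SimplexCategoryᵒᵖ} (s : C(X × stdSimplex ℝ (Fin (n.unop.len + 1)), Z)) :
    (Sing X Z).obj n := s

theorem ext {n : SimplexCategoryᵒᵖ} {s s' : (Sing X Z).obj n}
    (h : ∀ x t, val s (x, t) = val s' (x, t)) : s = s' :=
  ContinuousMap.ext fun p => h p.1 p.2

@[simp] theorem val_map {n m : SimplexCategoryᵒᵖ} (θ : n ⟶ m) (s : (Sing X Z).obj n) (x : X)
    (t : stdSimplex ℝ (Fin (m.unop.len + 1))) :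
    val ((Sing X Z).map θ s) (x, t) = val s (x, affineMap θ.unop t) := rfl

theorem val_app_map {K : SSet.{u}} (f : K ⟶ Sing X Z) {n m : SimplexCategoryᵒᵖ} (θ : n ⟶ m)
    (s : K.obj n) (x : X) (t : stdSimplex ℝ (Fin (m.unop.len + 1))) :
    val (f.app m (K.map θ s)) (x, t) = val (f.app n s) (x, affineMap θ.unop t) := by
  rw [NatTrans.naturality_apply, val_map]

/-- Restriction along a continuous map. -/
noncomputable def restr (Z : Type u) [TopologicalSpace Z] (g : C(X', X)) : Sing X Z ⟶ Sing X' Z where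
  app _ := ↾fun f => mk ((val f).comp (g.prodMap (.id _)))
  naturality _ _ _ := rfl

@[simp] theorem val_restr (g : C(X', X)) {n : SimplexCategoryᵒᵖ} (s : (Sing X Z).obj n) (x : X')
    (t : stdSimplex ℝ (Fin (n.unop.len + 1))) :
    val ((restr Z g).app n s) (x, t) = val s (g x, t) := rfl

/-- Composition with a continuous map. -/
noncomputable def postcomp (X : Type u) [TopologicalSpace X] (g : C(Z, Z')) :
    Sing X Z ⟶ Sing X Z' where
  app _ := ↾fun f => mk (g.comp (val f))
  naturality _ _ _ := rfl

end Sing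

/-! ### NDR pairs -/

/-- `L ⊆ X` is a neighbourhood deformation retract: `u` vanishes precisely on `L`, and the
deformation `h` of `X`, fixed on `L`, moves the points with `u < 1` into `L` at time `u`. -/
structure NDR (X : Type u) [TopologicalSpace X] (L : Set X) where
  u : C(X, ℝ)
  h : C(X × ℝ, X)
  u_nonneg : ∀ x, 0 ≤ u x
  mem_iff : ∀ x, x ∈ L ↔ u x = 0
  h_zero : ∀ x, h (x, 0) = x
  h_of_mem : ∀ x ∈ L, ∀ s, h (x, s) = x
  h_mem : ∀ x s, u x < 1 → u x ≤ s → h (x, s) ∈ L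

theorem NDR.isClosed {X : Type u} [TopologicalSpace X] {L : Set X} (N : NDR X L) : IsClosed L := by
  have : L = N.u ⁻¹' {0} := Set.ext fun x => N.mem_iff x
  rw [this]
  exact isClosed_singleton.preimage N.u.continuous

/-- The point of the simplex obtained by moving weight `a` from every vertex `j ≠ i` to `i`. -/
theorem stdSimplex.shift_mem {n : ℕ} (i : Fin (n + 1)) (t : stdSimplex ℝ (Fin (n + 1))) (a : ℝ)
    (ha : 0 ≤ a) (h : ∀ j, j ≠ i → a ≤ t j) :
    (fun j => if j = i then t i + n * a else t j - a) ∈ stdSimplex ℝ (Fin (n + 1)) := by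
  refine ⟨fun j => ?_, ?_⟩
  · dsimp only
    split_ifs with hj
    · have := stdSimplex.zero_le t i
      positivity
    · linarith [h j hj]
  · rw [← stdSimplex.sum_eq_one t, ← Finset.add_sum_erase _ _ (Finset.mem_univ i),
      ← Finset.add_sum_erase Finset.univ (fun j => t j) (Finset.mem_univ i)]
    have h1 : ∑ j ∈ Finset.univ.erase i, (if j = i then t i + n * a else t j - a) =
        ∑ j ∈ Finset.univ.erase i, (t j - a) :=
      Finset.sum_congr rfl fun j hj => if_neg (Finset.ne_of_mem_erase hj)
    rw [h1, Finset.sum_sub_distrib, Finset.sum_const, Finset.card_erase_of_mem (Finset.mem_univ i)]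
    simp

section

variable {n : ℕ} (i : Fin (n + 2))

theorem nonempty_univ_erase : (Finset.univ.erase i).Nonempty := by
  obtain ⟨j, hj⟩ := exists_ne i
  exact ⟨j, by simpa using hj⟩

/-- The smallest barycentric coordinate opposite to the vertices `j ≠ i`. -/
noncomputable def minCoord (t : stdSimplex ℝ (Fin (n + 2))) : ℝ :=
  (Finset.univ.erase i).inf' (nonempty_univ_erase i) fun j => t j

theorem continuous_minCoord : Continuous (minCoord i) :=
  Continuous.finset_inf'_apply _ fun j _ =>
    (continuous_apply j).comp continuous_subtype_val

theorem minCoord_le (t : stdSimplex ℝ (Fin (n + 2))) (j : Fin (n + 2)) (hj : j ≠ i) :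
    minCoord i t ≤ t j :=
  Finset.inf'_le _ (by simpa using hj)

theorem minCoord_nonneg (t : stdSimplex ℝ (Fin (n + 2))) : 0 ≤ minCoord i t :=
  Finset.le_inf' _ _ fun j _ => stdSimplex.zero_le t j

theorem exists_eq_minCoord (t : stdSimplex ℝ (Fin (n + 2))) :
    ∃ j, j ≠ i ∧ t j = minCoord i t := by
  obtain ⟨j, hj, h⟩ := Finset.exists_mem_eq_inf' (nonempty_univ_erase i) fun j => t j
  exact ⟨j, by simpa using hj, h.symm⟩

theorem minCoord_eq_zero (t : stdSimplex ℝ (Fin (n + 2))) (j : Fin (n + 2)) (hj : j ≠ i)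
    (h : t j = 0) : minCoord i t = 0 :=
  le_antisymm (h ▸ minCoord_le i t j hj) (minCoord_nonneg i t)

/-- For an NDR pair, `X × Δⁿ⁺¹` retracts onto `X × Λⁿ⁺¹ᵢ ∪ L × Δⁿ⁺¹`. -/
theorem NDR.exists_retraction {X : Type u} [TopologicalSpace X] {L : Set X} (N : NDR X L) :
    ∃ r : C(X × stdSimplex ℝ (Fin (n + 2)), X × stdSimplex ℝ (Fin (n + 2))),
      (∀ p, (r p).1 ∈ L ∨ ∃ j, j ≠ i ∧ (r p).2 j = 0) ∧
      ∀ p, (p.1 ∈ L ∨ ∃ j, j ≠ i ∧ p.2 j = 0) → r p = p := by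
  -- With `m` the least coordinate opposite to `i`, the retraction deforms `x` for time `m` and
  -- moves weight `min (u x) m` from every other vertex to `i`. If `m ≤ u x`, a coordinate becomes
  -- zero; if `u x < m`, the point of `X` reaches `L`. Nothing moves when `m = 0` or `x ∈ L`.
  let a : X × stdSimplex ℝ (Fin (n + 2)) → ℝ := fun p => min (N.u p.1) (minCoord i p.2)
  have hac : Continuous a := (N.u.continuous.comp continuous_fst).min
    ((continuous_minCoord i).comp continuous_snd)
  have ha0 : ∀ p, 0 ≤ a p := fun p => le_min (N.u_nonneg _) (minCoord_nonneg _ _)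
  have ham : ∀ p j, j ≠ i → a p ≤ p.2 j := fun p j hj =>
    (min_le_right _ _).trans (minCoord_le i p.2 j hj)
  have hshift : ∀ p : X × stdSimplex ℝ (Fin (n + 2)), a p = 0 →
      (⟨_, stdSimplex.shift_mem i p.2 (a p) (ha0 p) (ham p)⟩ : stdSimplex ℝ (Fin (n + 2)))
        = p.2 := by
    intro p hp
    ext j
    change (if j = i then p.2 i + _ * a p else p.2 j - a p) = p.2 j
    rw [hp]
    split_ifs with h
    · simp [h]
    · simp
  refine ⟨⟨fun p => (N.h (p.1, minCoord i p.2),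
    ⟨_, stdSimplex.shift_mem i p.2 (a p) (ha0 p) (ham p)⟩), ?_⟩, fun p => ?_, fun p hp => ?_⟩
  · refine (N.h.continuous.comp (continuous_fst.prodMk
      ((continuous_minCoord i).comp continuous_snd))).prodMk
      (Continuous.subtype_mk (continuous_pi fun j => ?_) _)
    have hj : ∀ j : Fin (n + 2), Continuous fun p : X × stdSimplex ℝ (Fin (n + 2)) => p.2 j :=
      fun j => (continuous_apply j).comp (continuous_subtype_val.comp continuous_snd)
    by_cases h : j = i
    · simp only [h, if_true]
      exact (hj i).add (continuous_const.mul hac)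
    · simp only [h, if_false]
      exact (hj j).sub hac
  · by_cases h : minCoord i p.2 ≤ N.u p.1
    · right
      obtain ⟨j, hj, hjm⟩ := exists_eq_minCoord i p.2
      refine ⟨j, hj, ?_⟩
      change (if j = i then _ else p.2 j - a p) = 0
      rw [if_neg hj, hjm, show a p = minCoord i p.2 from min_eq_right h, sub_self]
    · left
      push Not at h
      refine N.h_mem _ _ (h.trans_le ?_) h.le
      obtain ⟨j, hj, hjm⟩ := exists_eq_minCoord i p.2
      exact hjm ▸ stdSimplex.le_one p.2 j
  · rcases hp with hp | ⟨j, hj, hp⟩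
    · have ha : a p = 0 := by
        simp only [a, (N.mem_iff _).1 hp, minCoord_nonneg, min_eq_left]
      exact Prod.ext (N.h_of_mem _ hp _) (hshift p ha)
    · have hm := minCoord_eq_zero i p.2 j hj hp
      have ha : a p = 0 := by
        simp only [a, hm, N.u_nonneg, min_eq_right]
      exact Prod.ext (by simpa only [ContinuousMap.coe_mk, hm] using N.h_zero _) (hshift p ha)

end

/-! ### Lifting against horn inclusions. -/

open HomotopicalAlgebra SSet.modelCategoryQuillen

theorem mem_horn_iff_exists {n : ℕ} (i : Fin (n + 1)) {m : SimplexCategoryᵒᵖ}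
    (s : (Δ[n] : SSet.{u}).obj m) :
    s ∈ (Λ[n, i] : (Δ[n] : SSet.{u}).Subcomplex).obj m ↔
      ∃ j, j ≠ i ∧ ∀ l, (SSet.stdSimplex.objEquiv s).toOrderHom l ≠ j := by
  rw [SSet.mem_horn_iff, Ne, Set.eq_univ_iff_forall, not_forall]
  refine exists_congr fun j => ?_
  rw [Set.mem_union, not_or, and_comm, Set.mem_singleton_iff, Set.mem_range, not_exists]
  rfl

section

variable {X Z : Type u} [TopologicalSpace X] [TopologicalSpace Z] {n : ℕ} {i : Fin (n + 1)}

/-- A simplicial map from a horn to `Sing X Z` takes the same value on all representatives of a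
point of the realization of the horn. -/
theorem Sing.val_app_horn_eq (f : (Λ[n, i] : SSet.{u}) ⟶ Sing X Z)
    {m : SimplexCategoryᵒᵖ} (s : Λ[n, i].obj m) (t : stdSimplex ℝ (Fin (m.unop.len + 1)))
    (p : stdSimplex ℝ (Fin (n + 1))) (hp : affineMap (SSet.stdSimplex.objEquiv s.1) t = p)
    (e : ⦋n⦌ ⟶ ⦋n⦌)
    (he : ∀ l, p l ≠ 0 → e.toOrderHom l = l)
    (hem : SSet.stdSimplex.objEquiv.symm e ∈ (Λ[n, i] : (Δ[n] : SSet.{u}).Subcomplex).obj (op ⦋n⦌))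
    (x : X) :
    val (f.app m s) (x, t) = val (f.app (op ⦋n⦌) ⟨SSet.stdSimplex.objEquiv.symm e, hem⟩) (x, p) := by
  -- Retracting the vertices onto the support of `t` does not change the point, and afterwards all
  -- vertices are sent by `s` into the support of `p`, which `e` fixes.
  obtain ⟨r, hr, hr'⟩ := exists_orderHom_retraction {l | t l ≠ 0} (stdSimplex.exists_apply_ne_zero t)
  let r' : m.unop ⟶ m.unop := SimplexCategory.Hom.mk r
  have hrt : affineMap r' t = t := by
    refine (stdSimplex.map_apply_of_support _ id t fun l hl => hr' l hl).trans
      (stdSimplex.map_id_apply t)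
  have h1 : val (f.app m s) (x, t) = val (f.app m ((Λ[n, i] : SSet.{u}).map r'.op s)) (x, t) := by
    exact ((val_app_map f r'.op s x t).trans (by rw [Quiver.Hom.unop_op, hrt])).symm
  have h2 : (Λ[n, i] : SSet.{u}).map r'.op s =
      (Λ[n, i] : SSet.{u}).map (r' ≫ SSet.stdSimplex.objEquiv s.1).op
        ⟨SSet.stdSimplex.objEquiv.symm e, hem⟩ := by
    refine Subtype.ext (SSet.stdSimplex.objEquiv.injective ?_)
    change r' ≫ SSet.stdSimplex.objEquiv s.1 = (r' ≫ SSet.stdSimplex.objEquiv s.1) ≫ e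
    ext l : 3
    refine (he _ ?_).symm
    rw [← hp]
    exact stdSimplex.map_apply_ne_zero _ t _ (hr l)
  rw [h1, h2]
  refine (val_app_map f _ _ x t).trans ?_
  rw [Quiver.Hom.unop_op, affineMap_comp, ContinuousMap.comp_apply, hrt, hp]

/-- A map on a horn and a map on `L × Δⁿ` which agree on the intersection glue. -/
theorem Sing.exists_glue_horn {L : Set X}
    (hL : IsClosed L) (f : (Λ[n, i] : SSet.{u}) ⟶ Sing X Z)
    (b : (Sing L Z).obj (op ⦋n⦌))
    (hfb : ∀ (m : SimplexCategoryᵒᵖ) (s : Λ[n, i].obj m) (x : L)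
      (t : stdSimplex ℝ (Fin (m.unop.len + 1))),
      val (f.app m s) (x.1, t) = val b (x, affineMap (SSet.stdSimplex.objEquiv s.1) t)) :
    ∃ G : C({p : X × stdSimplex ℝ (Fin (n + 1)) // p.1 ∈ L ∨ ∃ j, j ≠ i ∧ p.2 j = 0}, Z),
      (∀ p (hp : p.1.1 ∈ L), G p = val b (⟨p.1.1, hp⟩, p.1.2)) ∧
      ∀ (m : SimplexCategoryᵒᵖ) (s : Λ[n, i].obj m) (x : X)
        (t : stdSimplex ℝ (Fin (m.unop.len + 1))) h,
        G ⟨(x, affineMap (SSet.stdSimplex.objEquiv s.1) t), h⟩ = val (f.app m s) (x, t) := by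
  -- The face `t_j = 0` is handled by a retraction of `[n]` onto the complement of `j`. It is a
  -- simplex of the horn and restricts to the identity on that face, so the value of `f` there comes
  -- from one continuous map on all of `X × Δⁿ`.
  have he : ∀ j : {j // j ≠ i}, ∃ e : ⦋n⦌ ⟶ ⦋n⦌, (∀ l, e.toOrderHom l ≠ j.1) ∧
      ∀ l, l ≠ j.1 → e.toOrderHom l = l := by
    intro j
    obtain ⟨r, hr, hr'⟩ := exists_orderHom_retraction {l | l ≠ j.1} ⟨i, j.2.symm⟩
    exact ⟨SimplexCategory.Hom.mk r, hr, hr'⟩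
  choose e he he' using he
  have hem : ∀ j, SSet.stdSimplex.objEquiv.symm (e j) ∈
      (Λ[n, i] : (Δ[n] : SSet.{u}).Subcomplex).obj (op ⦋n⦌) := fun j =>
    (mem_horn_iff_exists _ _).2 ⟨j.1, j.2, he j⟩
  have hz : ∀ j (p : stdSimplex ℝ (Fin (n + 1))), p j.1 = 0 → ∀ l, p l ≠ 0 →
      (e j).toOrderHom l = l := fun j p hp l hl => he' j l fun h => hl (h ▸ hp)
  have hzp : ∀ j (p : stdSimplex ℝ (Fin (n + 1))), p j.1 = 0 → affineMap (e j) p = p :=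
    fun j p hp => (stdSimplex.map_apply_of_support _ id p (hz j p hp)).trans
      (stdSimplex.map_id_apply p)
  have h1 : ∀ j (x : L) (p : stdSimplex ℝ (Fin (n + 1))), p j.1 = 0 →
      val (f.app (op ⦋n⦌) ⟨_, hem j⟩) (x.1, p) = val b (x, p) := by
    intro j x p hp
    rw [hfb]
    exact congrArg (fun q => val b (x, q)) (hzp j p hp)
  let c : Option {j // j ≠ i} → Set {p : X × stdSimplex ℝ (Fin (n + 1)) //
      p.1 ∈ L ∨ ∃ j, j ≠ i ∧ p.2 j = 0} := fun o =>
    o.elim {p | p.1.1 ∈ L} fun j => {p | p.1.2 j.1 = 0}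
  have hc : ∀ o, IsClosed (c o) := by
    rintro (_ | j)
    · exact hL.preimage (continuous_fst.comp continuous_subtype_val)
    · exact isClosed_singleton.preimage ((continuous_apply j.1).comp
        (continuous_subtype_val.comp (continuous_snd.comp continuous_subtype_val)))
  have hcov : ∀ p, ∃ o, p ∈ c o := by
    rintro ⟨p, hp | ⟨j, hj, hp⟩⟩
    · exact ⟨none, hp⟩
    · exact ⟨some ⟨j, hj⟩, hp⟩
  let g : ∀ o, C(c o, Z) := fun o => match o with
    | none => ⟨fun p => val b (⟨p.1.1.1, p.2⟩, p.1.1.2), (val b).continuous.comp (by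
        refine Continuous.prodMk (Continuous.subtype_mk ?_ _) ?_ <;> fun_prop)⟩
    | some j => ⟨fun p => val (f.app (op ⦋n⦌) ⟨_, hem j⟩) p.1.1,
        (val (f.app (op ⦋n⦌) ⟨_, hem j⟩)).continuous.comp (by fun_prop)⟩
  obtain ⟨G, hG⟩ := exists_continuousMap_of_isClosed_cover c hc hcov g (by
    rintro (_ | j) (_ | k) ⟨⟨x, p⟩, hp⟩ h h'
    · rfl
    · exact (h1 k ⟨x, h⟩ p h').symm
    · exact h1 j ⟨x, h'⟩ p h
    · exact val_app_horn_eq f ⟨_, hem j⟩ p p (hzp j p h) (e k) (hz k p h') (hem k) x)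
  refine ⟨G, fun p hp => hG none p hp, fun m s x t h => ?_⟩
  obtain ⟨j, hj, hj'⟩ := (mem_horn_iff_exists _ _).1 s.2
  have h0 : affineMap (SSet.stdSimplex.objEquiv s.1) t j = 0 :=
    stdSimplex.map_apply_eq_zero _ t j hj'
  rw [hG (some ⟨j, hj⟩) _ h0]
  exact (val_app_horn_eq f s t _ rfl (e ⟨j, hj⟩) (hz ⟨j, hj⟩ _ h0) (hem _) x).symm

end

/-- A lifting problem for a horn is a map on `X × Λ ∪ L × Δ`; precomposition with the retraction of
`X × Δ` onto this subset fills it. -/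
theorem NDR.fibration {X : Type u} [TopologicalSpace X] {L : Set X} (N : NDR X L) (Z : Type u)
    [TopologicalSpace Z] :
    Fibration (Sing.restr Z (⟨Subtype.val, continuous_subtype_val⟩ : C(L, X))) := by
  rw [SSet.modelCategoryQuillen.fibration_iff]
  intro A B g hg
  simp only [J, MorphismProperty.iSup_iff] at hg
  obtain ⟨n, ⟨i⟩⟩ := hg
  refine ⟨fun {f b} sq => ?_⟩
  obtain ⟨b, rfl⟩ := SSet.yonedaEquiv.symm.surjective b
  obtain ⟨G, hGL, hGf⟩ := Sing.exists_glue_horn N.isClosed f b fun m s x t =>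
    congrArg (fun g => Sing.val (g.app m s) (x, t)) sq.w
  obtain ⟨r, hr, hr'⟩ := N.exists_retraction i
  let R : C(_, {p : _ × stdSimplex ℝ (Fin (n + 2)) // p.1 ∈ L ∨ ∃ j, j ≠ i ∧ p.2 j = 0}) :=
    ⟨fun p => ⟨r p, hr p⟩, r.continuous.subtype_mk _⟩
  have hR : ∀ p (hp : p.1 ∈ L ∨ ∃ j, j ≠ i ∧ p.2 j = 0), R p = ⟨p, hp⟩ :=
    fun p hp => Subtype.ext (hr' p hp)
  refine ⟨⟨⟨SSet.yonedaEquiv.symm (Sing.mk (G.comp R)), ?_, ?_⟩⟩⟩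
  · refine NatTrans.ext (funext fun m => ConcreteCategory.hom_ext _ _ fun s => Sing.ext fun x t => ?_)
    obtain ⟨j, hj, hj'⟩ := (mem_horn_iff_exists _ _).1 s.2
    have h0 : affineMap (SSet.stdSimplex.objEquiv s.1) t j = 0 :=
      stdSimplex.map_apply_eq_zero _ t j hj'
    refine Eq.trans ?_ (hGf m s x t (Or.inr ⟨j, hj, h0⟩))
    exact congrArg G (hR _ (Or.inr ⟨j, hj, h0⟩))
  · apply SSet.yonedaEquiv.injective
    rw [SSet.yonedaEquiv_symm_comp, Equiv.apply_symm_apply, Equiv.apply_symm_apply]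
    refine Sing.ext fun x t => ?_
    refine Eq.trans (congrArg G (hR (x.1, t) (Or.inl x.2))) (hGL _ x.2)

end

/-! ### Gluing of simplicial maps, and anodyne inclusions obtained by deformation. -/

section
open Simplicial HomotopicalAlgebra SSet.modelCategoryQuillen

namespace SSet

/-- A morphism of simplicial sets from its values. -/
def homMk {V W : SSet.{u}} (f : ∀ n, V.obj n → W.obj n)
    (hf : ∀ {m n : SimplexCategoryᵒᵖ} (θ : m ⟶ n) (x : V.obj m), f n (V.map θ x) = W.map θ (f m x)) :
    V ⟶ W where
  app n := ↾(f n)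
  naturality _ _ θ := ConcreteCategory.hom_ext _ _ fun x => hf θ x

theorem hom_ext_apply {V W : SSet.{u}} {f g : V ⟶ W} (h : ∀ n (x : V.obj n), f.app n x = g.app n x) :
    f = g :=
  NatTrans.ext (funext fun n => ConcreteCategory.hom_ext _ _ (h n))

theorem app_map {V W : SSet.{u}} (f : V ⟶ W) {m n : SimplexCategoryᵒᵖ} (θ : m ⟶ n) (x : V.obj m) :
    f.app n (V.map θ x) = W.map θ (f.app m x) :=
  NatTrans.naturality_apply f θ x

namespace Subcomplex

variable {X W : SSet.{u}}

/-- Morphisms on two subcomplexes which agree on the intersection glue to the union. -/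
theorem exists_glue (A B : X.Subcomplex) (f : A.toSSet ⟶ W) (g : B.toSSet ⟶ W)
    (h : ∀ n (x : X.obj n) (ha : x ∈ A.obj n) (hb : x ∈ B.obj n),
      f.app n ⟨x, ha⟩ = g.app n ⟨x, hb⟩) :
    ∃ k : (A ⊔ B).toSSet ⟶ W, (∀ n x (ha : x ∈ A.obj n), k.app n ⟨x, Or.inl ha⟩ = f.app n ⟨x, ha⟩) ∧
      ∀ n x (hb : x ∈ B.obj n), k.app n ⟨x, Or.inr hb⟩ = g.app n ⟨x, hb⟩ := by
  classical
  let k : ∀ n, (A ⊔ B).toSSet.obj n → W.obj n := fun n x =>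
    if ha : x.1 ∈ A.obj n then f.app n ⟨x.1, ha⟩ else g.app n ⟨x.1, x.2.resolve_left ha⟩
  have h1 : ∀ n x (hx : x ∈ (A ⊔ B).obj n) (ha : x ∈ A.obj n), k n ⟨x, hx⟩ = f.app n ⟨x, ha⟩ :=
    fun n x hx ha => dif_pos ha
  have h2 : ∀ n x (hx : x ∈ (A ⊔ B).obj n) (hb : x ∈ B.obj n), k n ⟨x, hx⟩ = g.app n ⟨x, hb⟩ := by
    intro n x hx hb
    by_cases ha : x ∈ A.obj n
    · rw [h1 n x hx ha, h]
    · exact dif_neg ha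
  refine ⟨homMk k ?_, fun n x ha => h1 n x _ ha, fun n x hb => h2 n x _ hb⟩
  rintro m n θ ⟨x, hx⟩
  rcases hx with ha | hb
  · rw [h1 m x (Or.inl ha) ha]
    exact (h1 n _ _ (A.map θ ha)).trans (app_map f θ ⟨x, ha⟩)
  · rw [h2 m x (Or.inr hb) hb]
    exact (h2 n _ _ (B.map θ hb)).trans (app_map g θ ⟨x, hb⟩)

end Subcomplex

open MonoidalCategory

theorem anodyneExtensions.exists_lift {A B E F : SSet.{u}} {i : A ⟶ B} (hi : anodyneExtensions i)
    (p : E ⟶ F) [hp : Fibration p] (f : A ⟶ E) (g : B ⟶ F) (w : f ≫ p = i ≫ g) :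
    ∃ l : B ⟶ E, i ≫ l = f ∧ l ≫ p = g := by
  have := hi p hp.mem
  have sq : CommSq f i p g := ⟨w⟩
  exact ⟨sq.lift, sq.fac_left, sq.fac_right⟩

theorem eq_const_of_mem_horn_one (e : Fin 2) {n : SimplexCategoryᵒᵖ} (s : (Δ[1] : SSet.{u}).obj n)
    (hs : s ∈ (Λ[1, e] : (Δ[1] : SSet.{u}).Subcomplex).obj n) : s = stdSimplex.const 1 e n := by
  obtain ⟨j, hj, h⟩ := (mem_horn_iff_exists _ _).1 hs
  apply stdSimplex.objEquiv.injective
  ext l : 3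
  have h1 := h l
  have key : ∀ q j e : Fin 2, j ≠ e → q ≠ j → q = e := by decide
  exact key _ j e hj h1

/-- If `V` is deformed, preserving `U`, through `V'`, and the inclusion of the preimage of `U` in
`V'` is anodyne, so is the inclusion of `U` in `V`. -/
theorem anodyneExtensions_of_deformation {V V' : SSet.{u}} (U : V.Subcomplex) (j : V' ⟶ V)
    (r : V ⟶ V') (e e' : Fin 2) (H : V ⊗ Δ[1] ⟶ V)
    (H₀ : ∀ n (x : V.obj n), H.app n (x, stdSimplex.const 1 e n) = j.app n (r.app n x))
    (H₁ : ∀ n (x : V.obj n), H.app n (x, stdSimplex.const 1 e' n) = x)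
    (HU : ∀ n (x : V.obj n) s, x ∈ U.obj n → H.app n (x, s) ∈ U.obj n)
    (hU : anodyneExtensions (U.preimage j).ι) : anodyneExtensions U.ι := by
  intro E F p hp
  have : Fibration p := ⟨hp⟩
  refine ⟨fun {f g} sq => ?_⟩
  have hw : ∀ n (x : U.toSSet.obj n), p.app n (f.app n x) = g.app n x.1 := fun n x =>
    congrArg (fun q => q.app n x) sq.w
  let f' : (U.preimage j).toSSet ⟶ E :=
    homMk (fun n x => f.app n ⟨j.app n x.1, x.2⟩) fun θ x => by
      refine Eq.trans ?_ (app_map f θ _)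
      exact congrArg _ (Subtype.ext (app_map j θ x.1))
  obtain ⟨l', heq₁, heq₂⟩ := hU.exists_lift p f' (j ≫ g) (hom_ext_apply fun n x => hw n _)
  have hlift₁ : ∀ n (x : V'.obj n) (hx : j.app n x ∈ U.obj n), l'.app n x = f.app n ⟨_, hx⟩ :=
    fun n x hx => congrArg (fun q => q.app n ⟨x, hx⟩) heq₁
  have hlift₂ : ∀ n (x : V'.obj n), p.app n (l'.app n x) = g.app n (j.app n x) :=
    fun n x => congrArg (fun q => q.app n x) heq₂
  -- The lift `l'` on `V'` gives a lift of `H ≫ g` on `V × {e}`, through `r`; on `U × Δ[1]` the map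
  -- `H` followed by `f` is one. They agree on `U × {e}` as `H` is `j ∘ r` there. Extending to `V ×
  -- Δ[1]` and restricting to `e'`, where `H` is the identity, solves the problem.
  let a : ((⊤ : V.Subcomplex).prod (Λ[1, e] : (Δ[1] : SSet.{u}).Subcomplex)).toSSet ⟶ E :=
    homMk (fun n x => l'.app n (r.app n x.1.1)) fun θ x => by
      rw [← app_map, ← app_map]; rfl
  let b : (U.prod (⊤ : (Δ[1] : SSet.{u}).Subcomplex)).toSSet ⟶ E :=
    homMk (fun n x => f.app n ⟨H.app n x.1, HU n x.1.1 x.1.2 x.2.1⟩) fun θ x => by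
      refine Eq.trans ?_ (app_map f θ _)
      exact congrArg _ (Subtype.ext (app_map H θ x.1))
  obtain ⟨k, hk1, hk2⟩ := Subcomplex.exists_glue _ _ a b (by
    rintro n ⟨x, s⟩ ha hb
    obtain rfl := eq_const_of_mem_horn_one e s ha.2
    have h := HU n x (stdSimplex.const 1 e n) hb.1
    change l'.app n (r.app n x) = f.app n ⟨H.app n (x, stdSimplex.const 1 e n), _⟩
    rw [hlift₁ n _ (H₀ n x ▸ h)]
    exact congrArg _ (Subtype.ext (H₀ n x).symm))
  have hT := anodyneExtensions_unionProd_ι U (Λ[1, e] : (Δ[1] : SSet.{u}).Subcomplex)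
    (anodyneExtensions.horn_ι e)
  obtain ⟨K, hK1, hK2⟩ := hT.exists_lift p k (H ≫ g) (hom_ext_apply (by
    rintro n ⟨⟨x, s⟩, hx | hx⟩
    · refine (congrArg (p.app n) (hk1 n _ hx)).trans ?_
      obtain rfl := eq_const_of_mem_horn_one e s hx.2
      exact (hlift₂ n _).trans (congrArg (g.app n) (H₀ n x).symm)
    · refine (congrArg (p.app n) (hk2 n _ hx)).trans ?_
      exact hw n _))
  refine ⟨⟨⟨homMk (fun n x => K.app n (x, stdSimplex.const 1 e' n)) fun θ x => ?_, ?_, ?_⟩⟩⟩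
  · exact app_map K θ (x, stdSimplex.const 1 e' _)
  · refine hom_ext_apply fun n x => ?_
    have h1 : (x.1, stdSimplex.const 1 e' n) ∈ (U.prod (⊤ : (Δ[1] : SSet.{u}).Subcomplex)).obj n :=
      ⟨x.2, trivial⟩
    refine (congrArg (fun q => q.app n ⟨_, Or.inr h1⟩) hK1).trans ((hk2 n _ h1).trans ?_)
    exact congrArg (f.app n) (Subtype.ext (H₁ n x.1))
  · refine hom_ext_apply fun n x => ?_
    refine (congrArg (fun q => q.app n (x, stdSimplex.const 1 e' n)) hK2).trans ?_
    exact congrArg (g.app n) (H₁ n x)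

end SSet

end

section
open Simplicial HomotopicalAlgebra SSet.modelCategoryQuillen

/-! ### Anodyne extensions of nerves of posets from involutions on chains -/

namespace NerveToggle

variable {X : Type u} [PartialOrder X] {V : (nerve X).Subcomplex}

/-- The set of vertices of a simplex. -/
def verts (s : V.toSSet.S) : Set X := Set.range s.simplex.1.obj

theorem strictMono (s : V.toSSet.N) : StrictMono s.simplex.1.obj :=
  (PartialOrder.mem_nerve_nonDegenerate_iff_strictMono _).1
    ((SSet.nonDegenerate_iff_of_mono V.ι _).2 s.nonDegenerate)

theorem ncard_verts (s : V.toSSet.N) : (verts s.toS).ncard = s.dim + 1 := by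
  rw [verts, Set.ncard_range_of_injective (strictMono s).injective]
  simp

/-- In the nerve of a poset, a nondegenerate simplex is a strictly increasing sequence, hence is
determined by its vertices. -/
theorem le_iff (s t : V.toSSet.N) : s ≤ t ↔ verts s.toS ⊆ verts t.toS := by
  constructor
  · intro h
    obtain ⟨f, hf⟩ := SSet.S.le_iff.1 h
    rintro _ ⟨i, rfl⟩
    refine ⟨f.toOrderHom i, ?_⟩
    exact congrArg (fun c => c.1.obj i) hf
  · intro h
    have h' : ∀ i, ∃ j, t.simplex.1.obj j = s.simplex.1.obj i := fun i => h ⟨i, rfl⟩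
    choose f hf using h'
    refine SSet.S.le_iff.2 ⟨SimplexCategory.Hom.mk ⟨f, fun i j hij => ?_⟩, ?_⟩
    · rw [← (strictMono t).le_iff_le, hf, hf]
      exact (strictMono s).monotone hij
    · exact Subtype.ext (nerve.ext_of_isThin (funext hf))

theorem verts_injective {s t : V.toSSet.N} (h : verts s.toS = verts t.toS) : s = t :=
  le_antisymm ((le_iff s t).2 h.le) ((le_iff t s).2 h.ge)

theorem isChain_verts (s : V.toSSet.N) : IsChain (· ≤ ·) (verts s.toS) := by
  rintro _ ⟨i, rfl⟩ _ ⟨j, rfl⟩ _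
  exact (le_total i j).imp (fun h => (strictMono s).monotone h) fun h => (strictMono s).monotone h

/-- A finite chain can be enumerated in increasing order; this produces the simplices that pair with
given ones in the involution. -/
theorem exists_verts_eq (T : Set X) (hf : T.Finite) (hT : T.Nonempty) (hc : IsChain (· ≤ ·) T)
    (hV : ∀ n (c : ComposableArrows X n), Set.range c.obj = T → c ∈ V.obj (op ⦋n⦌)) :
    ∃ s : V.toSSet.N, verts s.toS = T := by
  classical
  have := hf.fintype
  let _ : LinearOrder T := hc.linearOrder
  obtain ⟨n, hn⟩ : ∃ n, Fintype.card T = n + 1 :=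
    Nat.exists_eq_succ_of_ne_zero (@Fintype.card_pos T _ hT.to_subtype).ne'
  let o := Fintype.orderIsoFinOfCardEq T hn
  have hm : StrictMono fun i => (o i).1 := fun i j hij => o.strictMono hij
  let c : ComposableArrows X n := hm.monotone.functor
  have hr : Set.range c.obj = T := by
    have : c.obj = Subtype.val ∘ o := rfl
    rw [this, Set.range_comp, o.surjective.range_eq, Set.image_univ, Subtype.range_val]
  let x : V.toSSet _⦋n⦌ := ⟨c, hV n c hr⟩
  have hx : x ∈ V.toSSet.nonDegenerate n :=
    (SSet.nonDegenerate_iff_of_mono V.ι x).1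
      ((PartialOrder.mem_nerve_nonDegenerate_iff_strictMono c).2 hm)
  exact ⟨SSet.N.mk x hx, hr⟩

/-- An involution on the simplices of `V` outside of `U`, which adds or removes one vertex
`e`, gives an anodyne extension if the simplices are suitably ranked. -/
theorem anodyneExtensions_ι (U : V.toSSet.Subcomplex) (pV pU : Set X → Prop)
    (hV : ∀ n (c : ComposableArrows X n), c ∈ V.obj (op ⦋n⦌) ↔ pV (Set.range c.obj))
    (hU : ∀ n (x : V.toSSet _⦋n⦌), x ∈ U.obj (op ⦋n⦌) ↔ pU (Set.range x.1.obj))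
    (e : Set X → X) (rank : Set X → ℕ)
    (h_insert : ∀ s : Set X, s.Finite → IsChain (· ≤ ·) s → pV s → ¬ pU s → e s ∉ s →
      IsChain (· ≤ ·) (insert (e s) s) ∧ pV (insert (e s) s) ∧ ¬ pU (insert (e s) s) ∧
        e (insert (e s) s) = e s)
    (h_erase : ∀ s : Set X, s.Finite → IsChain (· ≤ ·) s → pV s → ¬ pU s → e s ∈ s →
      (s \ {e s}).Nonempty ∧ pV (s \ {e s}) ∧ ¬ pU (s \ {e s}) ∧ e (s \ {e s}) = e s)
    (h_rank : ∀ s t : Set X, s.Finite → t.Finite → IsChain (· ≤ ·) s → IsChain (· ≤ ·) t →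
      pV s → ¬ pU s → e s ∉ s → pV t → ¬ pU t → e t ∉ t → s ≠ t → s.ncard = t.ncard →
      s ⊆ insert (e t) t → rank s < rank t) :
    SSet.anodyneExtensions U.ι := by
  classical
  have hfin : ∀ s : U.N, (verts s.toS).Finite := fun s => Set.finite_range _
  have hpV : ∀ s : U.N, pV (verts s.toS) := fun s => (hV _ _).1 s.simplex.2
  have hpU : ∀ s : U.N, ¬ pU (verts s.toS) := fun s h => s.notMem ((hU _ _).2 h)
  have hinj : ∀ s t : U.N, verts s.toS = verts t.toS → s = t := fun s t h =>
    (SSet.Subcomplex.N.ext_iff _ _).2 (verts_injective h)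
  have hex : ∀ T : Set X, T.Finite → T.Nonempty → IsChain (· ≤ ·) T → pV T → ¬ pU T →
      ∃ s : U.N, verts s.toS = T := by
    intro T h1 h2 h3 h4 h5
    obtain ⟨s, hs⟩ := exists_verts_eq (V := V) T h1 h2 h3 fun n c hc => (hV n c).2 (hc ▸ h4)
    exact ⟨⟨s, fun h => h5 (hs ▸ (hU _ _).1 h)⟩, hs⟩
  have hins : ∀ s : U.N, e (verts s.toS) ∉ verts s.toS →
      ∃ t : U.N, verts t.toS = insert (e (verts s.toS)) (verts s.toS) := fun s hs => by
    obtain ⟨h1, h2, h3, -⟩ := h_insert _ (hfin s) (isChain_verts s.toN) (hpV s) (hpU s) hs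
    exact hex _ ((hfin s).insert _) (Set.insert_nonempty _ _) h1 h2 h3
  have hera : ∀ s : U.N, e (verts s.toS) ∈ verts s.toS →
      ∃ t : U.N, verts t.toS = verts s.toS \ {e (verts s.toS)} := fun s hs => by
    obtain ⟨h1, h2, h3, -⟩ := h_erase _ (hfin s) (isChain_verts s.toN) (hpV s) (hpU s) hs
    exact hex _ ((hfin s).subset Set.sdiff_subset) h1
      ((isChain_verts s.toN).mono Set.sdiff_subset) h2 h3
  choose a ha using hins
  choose b hb using hera
  have hea : ∀ s hs, e (verts (a s hs).toS) = e (verts s.toS) := fun s hs => by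
    rw [ha]
    exact (h_insert _ (hfin s) (isChain_verts s.toN) (hpV s) (hpU s) hs).2.2.2
  have heb : ∀ s hs, e (verts (b s hs).toS) = e (verts s.toS) := fun s hs => by
    rw [hb]
    exact (h_erase _ (hfin s) (isChain_verts s.toN) (hpV s) (hpU s) hs).2.2.2
  -- The pairing matches each simplex not containing its vertex `e` with the simplex in which `e` is
  -- inserted. Both have the same `e`, so insertion and removal are mutually inverse.
  let P : U.Pairing :=
    { I := {s | e (verts s.toS) ∈ verts s.toS}
      II := {s | e (verts s.toS) ∉ verts s.toS}
      inter := by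
        ext s
        simp only [Set.mem_inter_iff, Set.mem_ofPred_eq, Set.mem_empty_iff_false, iff_false]
        tauto
      union := by
        ext s
        simp only [Set.mem_union, Set.mem_ofPred_eq, Set.mem_univ, iff_true]
        tauto
      p :=
        { toFun s := ⟨a s.1 s.2, by
            change e (verts (a s.1 s.2).toS) ∈ verts (a s.1 s.2).toS
            rw [hea, ha]; exact Set.mem_insert _ _⟩
          invFun s := ⟨b s.1 s.2, by
            change e (verts (b s.1 s.2).toS) ∉ verts (b s.1 s.2).toS
            rw [heb, hb]; simp⟩
          left_inv s := Subtype.ext (hinj _ _ (by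
            rw [hb, hea, ha, Set.insert_sdiff_self_of_notMem s.2]))
          right_inv s := Subtype.ext (hinj _ _ (by
            rw [ha, heb, hb, Set.insert_sdiff_singleton]
            exact Set.insert_eq_of_mem (show e (verts s.1.toS) ∈ verts s.1.toS from s.2))) } }
  have hcard : ∀ s : U.N, (verts s.toS).ncard = s.dim + 1 := fun s => ncard_verts s.toN
  have hP : P.IsProper := ⟨fun s => by
    have h1 := hcard s.1
    have h2 := hcard (P.p s).1
    have h3 : verts (P.p s).1.toS = insert _ (verts s.1.toS) := ha s.1 s.2
    rw [h3, Set.ncard_insert_of_notMem s.2 (hfin s.1), h1] at h2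
    refine ⟨by omega, SSet.N.existsUnique_of_le ((le_iff _ _).2 ?_)⟩
    rw [h3]
    exact Set.subset_insert _ _⟩
  -- The rank excludes infinite descent among the horns to be filled. It need only decrease between
  -- simplices of equal dimension.
  have hR : P.IsRegular := SSet.Subcomplex.Pairing.WeakRankFunction.isRegular (α := ℕ)
    { rank := fun s => rank (verts s.1.toS)
      lt := fun {s t} h hd => by
        refine h_rank _ _ (hfin _) (hfin _) (isChain_verts s.1.toN) (isChain_verts t.1.toN)
          (hpV _) (hpU _) s.2 (hpV _) (hpU _) t.2 (fun h' => h.1 (Subtype.ext (hinj _ _ h'))) ?_ ?_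
        · rw [hcard, hcard, hd]
        · exact ha t.1 t.2 ▸ (le_iff _ _).1 h.2.le }
  exact P.anodyneExtensions

end NerveToggle

end

section
open Simplicial HomotopicalAlgebra SSet.modelCategoryQuillen MonoidalCategory

/-! ### Cylinders in nerves of marked categories -/

/-- A class of objects called points, and a set of vertices for every object. -/
structure Marking (C : Type u) (I : Type) where
  isPt : C → Prop
  verts : C → Set I

namespace Marking

variable {C D : Type u} {I I' : Type}

section

variable [Category.{v} C]

/-- The chains in which the vertices of the points belong to those of the other objects. -/
def cyl (μ : Marking C I) : (nerve C).Subcomplex where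
  obj _ := {c | ∀ a b, ¬ μ.isPt (c.obj a) → μ.isPt (c.obj b) →
    μ.verts (c.obj b) ⊆ μ.verts (c.obj a)}
  map θ _ hc a b := hc (θ.unop.toOrderHom a) (θ.unop.toOrderHom b)

/-- The chains without points. -/
def base (μ : Marking C I) : μ.cyl.toSSet.Subcomplex where
  obj _ := {c | ∀ a, ¬ μ.isPt (c.1.obj a)}
  map θ _ hc a := hc (θ.unop.toOrderHom a)

/-- The chains of points. -/
def pts (μ : Marking C I) : μ.cyl.toSSet.Subcomplex where
  obj _ := {c | ∀ a, μ.isPt (c.1.obj a)}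
  map θ _ hc a := hc (θ.unop.toOrderHom a)

/-- All vertices of the members of a chain. -/
def supp (μ : Marking C I) {n : SimplexCategoryᵒᵖ} (c : μ.cyl.toSSet.obj n) : Set I :=
  ⋃ a, μ.verts (c.1.obj a)

theorem supp_map_subset (μ : Marking C I) {m n : SimplexCategoryᵒᵖ} (θ : m ⟶ n)
    (c : μ.cyl.toSSet.obj m) : μ.supp (μ.cyl.toSSet.map θ c) ⊆ μ.supp c :=
  Set.iUnion_subset fun _ => Set.subset_iUnion (fun a => μ.verts (c.1.obj a)) _

/-- The chains with too few vertices. -/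
def bd (μ : Marking C I) : μ.cyl.toSSet.Subcomplex where
  obj _ := {c | μ.supp c ≠ Set.univ}
  map θ c hc h := hc (Set.eq_univ_of_univ_subset (h ▸ μ.supp_map_subset θ c))

end

variable [Category.{0} C] [Category.{0} D]

/-- The map of cylinders induced by a functor. -/
def cylMap (μ : Marking C I) (ν : Marking D I') (F : C ⥤ D)
    (hF : ∀ n (c : (nerve C).obj n), c ∈ μ.cyl.obj n → (c ⋙ F : ComposableArrows D n.unop.len) ∈ ν.cyl.obj n) :
    μ.cyl.toSSet ⟶ ν.cyl.toSSet :=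
  SSet.homMk (fun n c => ⟨(c.1 ⋙ F : ComposableArrows D n.unop.len), hF n c.1 c.2⟩) fun _ _ => rfl

/-- The chain whose members are those of `c ⋙ G₀` where `ε` is `0` and of `c ⋙ G₁` where `ε` is
`1`. -/
def deformChain {G₀ G₁ : C ⥤ D} (τ : G₀ ⟶ G₁) {n : ℕ} (c : ComposableArrows C n)
    (ε : Fin (n + 1) →o Fin 2) : ComposableArrows D n :=
  Functor.prod' ε.monotone.functor c ⋙ Functor.uncurry.obj (ComposableArrows.mk₁ τ)

section

variable {G₀ G₁ : C ⥤ D} (τ : G₀ ⟶ G₁) {n : ℕ} (c : ComposableArrows C n) (ε : Fin (n + 1) →o Fin 2)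

theorem deformChain_obj_zero (a : Fin (n + 1)) (ha : ε a = 0) :
    (deformChain τ c ε).obj a = G₀.obj (c.obj a) := by
  change ((ComposableArrows.mk₁ τ).obj (ε a)).obj (c.obj a) = _
  rw [ha]
  rfl

theorem deformChain_obj_one (a : Fin (n + 1)) (ha : ε a = 1) :
    (deformChain τ c ε).obj a = G₁.obj (c.obj a) := by
  change ((ComposableArrows.mk₁ τ).obj (ε a)).obj (c.obj a) = _
  rw [ha]
  rfl

theorem deformChain_const_zero : deformChain τ c (OrderHom.const _ 0) = c ⋙ G₀ := by
  refine CategoryTheory.Functor.hext (fun _ => rfl) fun a b f => heq_of_eq ?_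
  have : (ComposableArrows.mk₁ τ).map (𝟙 (0 : Fin 2)) = 𝟙 _ := CategoryTheory.Functor.map_id _ _
  change ((ComposableArrows.mk₁ τ).map (𝟙 (0 : Fin 2))).app _ ≫ G₀.map _ = _
  rw [this]
  exact Category.id_comp _

theorem deformChain_const_one : deformChain τ c (OrderHom.const _ 1) = c ⋙ G₁ := by
  refine CategoryTheory.Functor.hext (fun _ => rfl) fun a b f => heq_of_eq ?_
  have : (ComposableArrows.mk₁ τ).map (𝟙 (1 : Fin 2)) = 𝟙 _ := CategoryTheory.Functor.map_id _ _
  change ((ComposableArrows.mk₁ τ).map (𝟙 (1 : Fin 2))).app _ ≫ G₁.map _ = _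
  rw [this]
  exact Category.id_comp _

end

/-- The homotopy given by a natural transformation. -/
def deform (μ : Marking C I) {G₀ G₁ : C ⥤ C} (τ : G₀ ⟶ G₁)
    (h : ∀ n (c : ComposableArrows C n) ε, c ∈ μ.cyl.obj (op ⦋n⦌) →
      deformChain τ c ε ∈ μ.cyl.obj (op ⦋n⦌)) : μ.cyl.toSSet ⊗ Δ[1] ⟶ μ.cyl.toSSet :=
  SSet.homMk (fun n x => ⟨deformChain τ x.1.1 (SSet.stdSimplex.objEquiv x.2).toOrderHom,
    h n.unop.len _ _ x.1.2⟩) fun _ _ => rfl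

end Marking

end

/-! ### Faces and points of a simplex -/

/-- The category of maps `[l] → [k]`, in which the morphisms go to maps that factor. -/
structure FaceCat (k : SimplexCategory) : Type u where
  {dom : SimplexCategory}
  map : dom ⟶ k

namespace FaceCat

variable {k l : SimplexCategory}

instance : Category.{0} (FaceCat.{u} k) where
  Hom φ ψ := {θ : ψ.dom ⟶ φ.dom // θ ≫ φ.map = ψ.map}
  id φ := ⟨𝟙 _, Category.id_comp _⟩
  comp f g := ⟨g.1 ≫ f.1, by rw [Category.assoc, f.2, g.2]⟩
  id_comp _ := Subtype.ext (Category.comp_id _)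
  comp_id _ := Subtype.ext (Category.id_comp _)
  assoc _ _ _ := Subtype.ext (Category.assoc _ _ _).symm

@[ext] theorem hom_ext {φ ψ : FaceCat.{u} k} {f g : φ ⟶ ψ} (h : f.1 = g.1) : f = g := Subtype.ext h

/-- The first vertex. -/
def first (φ : FaceCat.{u} k) : Fin (k.len + 1) := φ.map.toOrderHom 0

theorem first_le {φ ψ : FaceCat.{u} k} (f : φ ⟶ ψ) : φ.first ≤ ψ.first := by
  have h : ψ.first = φ.map.toOrderHom (f.1.toOrderHom 0) :=
    (congrArg (fun θ => θ.toOrderHom 0) f.2).symm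
  rw [h]
  exact φ.map.toOrderHom.monotone (Fin.zero_le _)

/-- Composition with a map `[k] → [l]`. -/
def push (α : k ⟶ l) : FaceCat.{u} k ⥤ FaceCat.{u} l where
  obj φ := ⟨φ.map ≫ α⟩
  map f := ⟨f.1, by rw [← Category.assoc, f.2]⟩

end FaceCat

/-- The category of faces and vertices of a simplex, with morphisms from faces to vertices. -/
inductive Coll (k : SimplexCategory) : Type u
  | face (φ : FaceCat.{u} k)
  | pt (i : Fin (k.len + 1))

namespace Coll

variable {k l m : SimplexCategory}

/-- The morphisms of `Coll k`. -/
def Hom : Coll.{u} k → Coll.{u} k → Type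
  | face φ, face ψ => φ ⟶ ψ
  | face φ, pt i => PLift (φ.first ≤ i)
  | pt i, pt j => PLift (i ≤ j)
  | pt _, face _ => PEmpty

/-- The identities of `Coll k`. -/
def Hom.id : ∀ x : Coll.{u} k, Hom x x
  | face φ => 𝟙 φ
  | pt _ => ⟨le_rfl⟩

/-- The composition of `Coll k`. -/
def Hom.comp : ∀ {x y z : Coll.{u} k}, Hom x y → Hom y z → Hom x z
  | face _, face _, face _, f, g => CategoryStruct.comp (obj := FaceCat.{u} k) f g
  | face _, face _, pt _, f, g => ⟨(FaceCat.first_le f).trans g.down⟩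
  | face _, pt _, pt _, f, g => ⟨f.down.trans g.down⟩
  | pt _, pt _, pt _, f, g => ⟨f.down.trans g.down⟩
  | pt _, face _, _, f, _ => f.elim
  | face _, pt _, face _, _, g => g.elim
  | pt _, pt _, face _, _, g => g.elim

instance : Category.{0} (Coll.{u} k) where
  Hom := Hom
  id := Hom.id
  comp := Hom.comp
  id_comp {x y} f := by
    rcases x with φ | i <;> rcases y with ψ | j
    · exact Category.id_comp (obj := FaceCat.{u} k) f
    · rfl
    · exact f.elim
    · rfl
  comp_id {x y} f := by
    rcases x with φ | i <;> rcases y with ψ | j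
    · exact Category.comp_id (obj := FaceCat.{u} k) f
    · rfl
    · exact f.elim
    · rfl
  assoc {x y z w} f g h := by
    rcases x with φ | i <;> rcases y with ψ | j <;> rcases z with χ | p <;> rcases w with ω | q <;>
      first
      | exact Category.assoc (obj := FaceCat.{u} k) f g h
      | rfl
      | exact f.elim
      | exact g.elim
      | exact h.elim

instance (x : Coll.{u} k) (i : Fin (k.len + 1)) : Subsingleton (x ⟶ pt i) := by
  rcases x with φ | j <;> exact ⟨fun ⟨_⟩ ⟨_⟩ => rfl⟩

/-- The inclusion of the category of faces. -/
def inc (k : SimplexCategory) : FaceCat.{u} k ⥤ Coll.{u} k where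
  obj := face
  map f := f

/-- Points are marked, and the vertices of `φ` are its values. -/
def marking (k : SimplexCategory) : Marking (Coll.{u} k) (Fin (k.len + 1)) where
  isPt := fun x => match x with
    | face _ => False
    | pt _ => True
  verts := fun x => match x with
    | face φ => Set.range φ.map.toOrderHom
    | pt i => {i}

@[simp] theorem verts_face (φ : FaceCat.{u} k) :
    (marking k).verts (face φ) = Set.range φ.map.toOrderHom := rfl

/-- The functor induced by a map `[k] → [l]`. -/
def push (α : k ⟶ l) : Coll.{u} k ⥤ Coll.{u} l where
  obj x := match x with
    | face φ => face ((FaceCat.push α).obj φ)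
    | pt i => pt (α.toOrderHom i)
  map {x y} f := match x, y, f with
    | face φ, face ψ, f => (FaceCat.push α).map f
    | face _, pt _, f => ⟨α.toOrderHom.monotone f.down⟩
    | pt _, pt _, f => ⟨α.toOrderHom.monotone f.down⟩
    | pt _, face _, f => f.elim
  map_id x := by
    rcases x with φ | i <;> rfl
  map_comp {x y z} f g := by
    rcases x with φ | i <;> rcases y with ψ | j <;> rcases z with χ | p <;>
      first
      | rfl
      | exact f.elim
      | exact g.elim

/-- The functor which sends a face to its first vertex. -/
def firstVertex (k : SimplexCategory) : Coll.{u} k ⥤ Coll.{u} k where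
  obj x := match x with
    | face φ => pt φ.first
    | pt i => pt i
  map {x y} f := match x, y, f with
    | face _, face _, f => ⟨FaceCat.first_le f⟩
    | face _, pt _, f => ⟨f.down⟩
    | pt _, pt _, f => ⟨f.down⟩
    | pt _, face _, f => f.elim
  map_id x := by rcases x with φ | i <;> rfl
  map_comp {x y z} f g := by
    rcases x with φ | i <;> rcases y with ψ | j <;> rcases z with χ | p <;> rfl

/-- The canonical morphisms to the first vertices. -/
def toFirstVertex (k : SimplexCategory) : 𝟭 (Coll.{u} k) ⟶ firstVertex k where
  app x := match x with
    | face _ => ⟨le_rfl⟩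
    | pt _ => ⟨le_rfl⟩
  naturality x y f := by
    rcases x with φ | i <;> rcases y with ψ | j <;> rfl

end Coll

/-! ### The deformation of the cylinder to its points -/

namespace Coll

variable {k l m : SimplexCategory}

theorem verts_subset {x y : Coll.{u} k} (f : x ⟶ y) (hx : ¬ (marking k).isPt x)
    (hy : ¬ (marking k).isPt y) : (marking k).verts y ⊆ (marking k).verts x := by
  rcases x with φ | i <;> rcases y with ψ | j
  · rintro _ ⟨a, rfl⟩
    exact ⟨f.1.toOrderHom a, congrArg (fun θ => θ.toOrderHom a) f.2⟩
  · exact absurd trivial hy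
  · exact absurd trivial hx
  · exact absurd trivial hx

theorem isPt_firstVertex (x : Coll.{u} k) : (marking k).isPt ((firstVertex k).obj x) := by
  rcases x with φ | i <;> exact trivial

theorem verts_firstVertex_subset (x : Coll.{u} k) :
    (marking k).verts ((firstVertex k).obj x) ⊆ (marking k).verts x := by
  rcases x with φ | i
  · rintro _ rfl
    exact ⟨0, rfl⟩
  · exact subset_rfl

end Coll

section
open Simplicial HomotopicalAlgebra SSet.modelCategoryQuillen MonoidalCategory

namespace Coll

variable {k l m : SimplexCategory}

/-- The only new case is a face at `a` not yet replaced and a face at `b` already replaced by its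
first vertex. Then `a ≤ b` as `ε` is monotone, so the later face has its vertices among those of the
earlier one. -/
theorem deformChain_toFirstVertex_mem {n : ℕ} (c : ComposableArrows (Coll.{u} k) n)
    (ε : Fin (n + 1) →o Fin 2) (hc : c ∈ (marking k).cyl.obj (op ⦋n⦌)) :
    Marking.deformChain (toFirstVertex k) c ε ∈ (marking k).cyl.obj (op ⦋n⦌) := by
  intro a b ha hb
  change Fin (n + 1) at a b
  have h01 : ∀ a, ε a = 0 ∨ ε a = 1 := fun a => by omega
  rcases h01 a with h | h
  · rw [Marking.deformChain_obj_zero _ _ _ _ h] at ha ⊢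
    rcases h01 b with h' | h'
    · rw [Marking.deformChain_obj_zero _ _ _ _ h'] at hb ⊢
      exact hc a b ha hb
    · rw [Marking.deformChain_obj_one _ _ _ _ h'] at hb ⊢
      refine (verts_firstVertex_subset _).trans ?_
      by_cases hb' : (marking k).isPt (c.obj b)
      · exact hc a b ha hb'
      · have hab : a ≤ b := by
          by_contra hab
          have := ε.monotone (not_le.1 hab).le
          rw [h, h'] at this
          exact absurd this (by decide)
        exact verts_subset (c.map (homOfLE hab)) ha hb'
  · rw [Marking.deformChain_obj_one _ _ _ _ h] at ha
    exact absurd (isPt_firstVertex _) ha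

theorem _root_.SSet.anodyneExtensions_ι_of_eq_top {X : SSet.{u}} (A : X.Subcomplex)
    (h : A = ⊤) : SSet.anodyneExtensions A.ι := by
  subst h
  have : IsIso (⊤ : X.Subcomplex).ι :=
    ⟨SSet.homMk (fun n x => ⟨x, trivial⟩) fun _ _ => rfl, rfl, rfl⟩
  exact SSet.anodyneExtensions.of_isIso _

theorem firstVertex_comp_mem_cyl {n : SimplexCategoryᵒᵖ} (c : (nerve (Coll.{u} k)).obj n) :
    (c ⋙ firstVertex k : ComposableArrows _ n.unop.len) ∈ (marking k).cyl.obj n :=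
  fun _ _ ha => absurd (isPt_firstVertex _) ha

/-- The projection of the cylinder to its points. -/
def toPts (k : SimplexCategory) : (marking.{u} k).cyl.toSSet ⟶ (marking.{u} k).cyl.toSSet :=
  Marking.cylMap _ _ (firstVertex k) fun _ c _ => firstVertex_comp_mem_cyl c

theorem toPts_mem_pts {n : SimplexCategoryᵒᵖ} (c : (marking.{u} k).cyl.toSSet.obj n) :
    (toPts k).app n c ∈ (marking.{u} k).pts.obj n :=
  fun _ => isPt_firstVertex _

/-- Moving faces to their first vertices deforms the cylinder into its points. Supports never grow,
so `bd` is preserved, and the preimage of `pts ⊔ bd` in the points is everything. -/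
theorem anodyneExtensions_pts_sup_bd (k : SimplexCategory) :
    SSet.anodyneExtensions ((marking.{u} k).pts ⊔ (marking k).bd).ι := by
  refine SSet.anodyneExtensions_of_deformation _ (marking.{u} k).pts.ι
    (SSet.homMk (fun n c => ⟨(toPts k).app n c, toPts_mem_pts c⟩) fun _ _ => rfl) 1 0
    (Marking.deform _ (toFirstVertex k) fun n c ε hc => deformChain_toFirstVertex_mem c ε hc)
    (fun n x => Subtype.ext (Marking.deformChain_const_one _ _))
    (fun n x => Subtype.ext ((Marking.deformChain_const_zero _ _).trans rfl))
    (fun n x s hx => ?_) (SSet.anodyneExtensions_ι_of_eq_top _ ?_)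
  · have h01 : ∀ a : Fin (n.unop.len + 1), (SSet.stdSimplex.objEquiv s).toOrderHom a = (0 : Fin 2) ∨
        (SSet.stdSimplex.objEquiv s).toOrderHom a = (1 : Fin 2) := fun a => by
      generalize (SSet.stdSimplex.objEquiv s).toOrderHom a = q
      revert q; change ∀ q : Fin 2, _; decide
    rcases hx with hx | hx
    · refine Or.inl fun a => ?_
      rcases h01 a with h | h
      · have := Marking.deformChain_obj_zero (toFirstVertex k) x.1
          (SSet.stdSimplex.objEquiv s).toOrderHom a h
        exact this ▸ hx a
      · have := Marking.deformChain_obj_one (toFirstVertex k) x.1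
          (SSet.stdSimplex.objEquiv s).toOrderHom a h
        exact this ▸ isPt_firstVertex _
    · refine Or.inr fun h => hx (Set.eq_univ_of_univ_subset ?_)
      rw [← h]
      refine Set.iUnion_mono fun a => ?_
      rcases h01 a with h | h
      · exact (congrArg _ (Marking.deformChain_obj_zero (toFirstVertex k) x.1
          (SSet.stdSimplex.objEquiv s).toOrderHom a h)).le
      · refine (congrArg _ (Marking.deformChain_obj_one (toFirstVertex k) x.1
          (SSet.stdSimplex.objEquiv s).toOrderHom a h)).le.trans (verts_firstVertex_subset _)
  · ext n x
    exact ⟨fun _ => trivial, fun _ => Or.inl x.2⟩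

end Coll

end

/-! ### The poset of faces and points -/

namespace FaceCat

variable {k : SimplexCategory}

theorem subsingleton_hom (φ ψ : FaceCat.{u} k) (hφ : Function.Injective φ.map.toOrderHom) :
    Subsingleton (φ ⟶ ψ) := by
  refine ⟨fun f g => ?_⟩
  ext a : 4
  refine hφ ?_
  have hf := congrArg (fun θ => θ.toOrderHom a) f.2
  have hg := congrArg (fun θ => θ.toOrderHom a) g.2
  exact hf.trans hg.symm

theorem nonempty_hom (φ ψ : FaceCat.{u} k) (hφ : Function.Injective φ.map.toOrderHom)
    (h : Set.range ψ.map.toOrderHom ⊆ Set.range φ.map.toOrderHom) : Nonempty (φ ⟶ ψ) := by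
  have h' : ∀ a, ∃ b, φ.map.toOrderHom b = ψ.map.toOrderHom a := fun a => h ⟨a, rfl⟩
  choose f hf using h'
  refine ⟨⟨SimplexCategory.Hom.mk ⟨f, fun a b hab => ?_⟩, ?_⟩⟩
  · have hs : StrictMono φ.map.toOrderHom := φ.map.toOrderHom.monotone.strictMono_of_injective hφ
    rw [← hs.le_iff_le, hf, hf]
    exact ψ.map.toOrderHom.monotone hab
  · ext a : 3
    exact hf a

theorem first_le_of_mem_range (φ : FaceCat.{u} k) (i : Fin (k.len + 1))
    (hi : i ∈ Set.range φ.map.toOrderHom) : φ.first ≤ i := by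
  obtain ⟨a, rfl⟩ := hi
  exact φ.map.toOrderHom.monotone (Fin.zero_le _)

/-- The inclusion of a nonempty set of vertices. -/
def ofFinset (S : Finset (Fin (k.len + 1))) (hS : S.Nonempty) : FaceCat.{u} k where
  dom := SimplexCategory.mk (S.card - 1)
  map := SimplexCategory.Hom.mk
    (S.orderEmbOfFin (Nat.sub_add_cancel hS.card_pos).symm).toOrderHom

theorem ofFinset_injective (S : Finset (Fin (k.len + 1))) (hS : S.Nonempty) :
    Function.Injective (ofFinset.{u} S hS).map.toOrderHom :=
  (S.orderEmbOfFin (Nat.sub_add_cancel hS.card_pos).symm).injective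

theorem range_ofFinset (S : Finset (Fin (k.len + 1))) (hS : S.Nonempty) :
    Set.range (ofFinset.{u} S hS).map.toOrderHom = S :=
  S.range_orderEmbOfFin (Nat.sub_add_cancel hS.card_pos).symm

/-- The set of vertices of a face. -/
def image (φ : FaceCat.{u} k) : Finset (Fin (k.len + 1)) := Finset.univ.image φ.map.toOrderHom

theorem coe_image (φ : FaceCat.{u} k) : (φ.image : Set _) = Set.range φ.map.toOrderHom := by
  simp [image]

theorem image_nonempty (φ : FaceCat.{u} k) : φ.image.Nonempty :=
  Finset.univ_nonempty.image _

end FaceCat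

/-- Nonempty sets of vertices of a simplex, and vertices. -/
inductive Cell (k : SimplexCategory) : Type u
  | set (S : Finset (Fin (k.len + 1))) (hS : S.Nonempty)
  | pt (i : Fin (k.len + 1))

namespace Cell

variable {k : SimplexCategory}

/-- Sets are ordered by reverse inclusion, and they precede the vertices that are not smaller than
all of their elements. -/
def Le : Cell.{u} k → Cell.{u} k → Prop
  | set S _, set T _ => T ⊆ S
  | set S hS, pt i => S.min' hS ≤ i
  | pt i, pt j => i ≤ j
  | pt _, set _ _ => False

instance : PartialOrder (Cell.{u} k) where
  le := Le
  le_refl x := by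
    rcases x with ⟨S, hS⟩ | i
    · exact subset_rfl (a := S)
    · exact le_refl i
  le_trans x y z h h' := by
    rcases x with ⟨S, hS⟩ | i <;> rcases y with ⟨T, hT⟩ | j <;> rcases z with ⟨W, hW⟩ | m
    · exact subset_trans (show W ⊆ T from h') h
    · exact (Finset.min'_subset hT (show T ⊆ S from h)).trans h'
    · exact False.elim h'
    · exact le_trans (b := j) h h'
    · exact False.elim h
    · exact False.elim h
    · exact False.elim h'
    · exact le_trans (b := j) h h'
  le_antisymm x y h h' := by
    rcases x with ⟨S, hS⟩ | i <;> rcases y with ⟨T, hT⟩ | j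
    · obtain rfl : S = T := subset_antisymm h' h
      rfl
    · exact False.elim h'
    · exact False.elim h
    · exact congrArg pt (le_antisymm h h')

theorem set_le_set {S T : Finset (Fin (k.len + 1))} {hS : S.Nonempty} {hT : T.Nonempty} :
    set.{u} S hS ≤ set T hT ↔ T ⊆ S := Iff.rfl

theorem set_le_pt {S : Finset (Fin (k.len + 1))} {hS : S.Nonempty} {i : Fin (k.len + 1)} :
    set.{u} S hS ≤ pt i ↔ S.min' hS ≤ i := Iff.rfl

/-- The points are the vertices. -/
def marking (k : SimplexCategory) : Marking (Cell.{u} k) (Fin (k.len + 1)) where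
  isPt := fun x => match x with
    | set _ _ => False
    | pt _ => True
  verts := fun x => match x with
    | set S _ => S
    | pt i => {i}

/-- The face of a cell. -/
def collObj : Cell.{u} k → Coll.{u} k
  | set S hS => Coll.face (FaceCat.ofFinset S hS)
  | pt i => Coll.pt i

theorem isPt_collObj (x : Cell.{u} k) :
    (Coll.marking k).isPt (collObj x) ↔ (marking k).isPt x := by
  rcases x with ⟨S, hS⟩ | i <;> exact Iff.rfl

theorem verts_collObj (x : Cell.{u} k) :
    (Coll.marking k).verts (collObj x) = (marking k).verts x := by
  rcases x with ⟨S, hS⟩ | i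
  · exact FaceCat.range_ofFinset.{u} S hS
  · rfl

/-- As the face of a cell is injective, maps out of it are unique. This makes all functoriality and
naturality below automatic, in spite of the choices. -/
theorem subsingleton_hom (x : Cell.{u} k) (y : Coll.{u} k) : Subsingleton (collObj x ⟶ y) := by
  rcases y with ψ | j
  · rcases x with ⟨S, hS⟩ | i
    · exact FaceCat.subsingleton_hom _ _ (FaceCat.ofFinset_injective S hS)
    · exact ⟨fun f => PEmpty.elim f⟩
  · infer_instance

theorem nonempty_hom_collObj {x y : Cell.{u} k} (h : x ≤ y) : Nonempty (collObj x ⟶ collObj y) := by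
  rcases x with ⟨S, hS⟩ | i <;> rcases y with ⟨T, hT⟩ | j
  · refine FaceCat.nonempty_hom _ _ (FaceCat.ofFinset_injective S hS) ?_
    rw [FaceCat.range_ofFinset, FaceCat.range_ofFinset]
    exact h
  · refine ⟨⟨(FaceCat.first_le_of_mem_range _ (S.min' hS) ?_).trans h⟩⟩
    rw [FaceCat.range_ofFinset]
    exact S.min'_mem hS
  · exact False.elim h
  · exact ⟨⟨h⟩⟩

/-- The functor to faces and points. -/
noncomputable def toColl (k : SimplexCategory) : Cell.{u} k ⥤ Coll.{u} k where
  obj := collObj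
  map f := (nonempty_hom_collObj (leOfHom f)).some
  map_id _ := (subsingleton_hom _ _).elim _ _
  map_comp _ _ := (subsingleton_hom _ _).elim _ _

/-- The cell of a face or a point. -/
def ofCollObj : Coll.{u} k → Cell.{u} k
  | Coll.face φ => set φ.image φ.image_nonempty
  | Coll.pt i => pt i

theorem isPt_ofCollObj (x : Coll.{u} k) :
    (marking k).isPt (ofCollObj x) ↔ (Coll.marking k).isPt x := by
  rcases x with φ | i <;> exact Iff.rfl

theorem verts_ofCollObj (x : Coll.{u} k) :
    (marking k).verts (ofCollObj x) = (Coll.marking k).verts x := by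
  rcases x with φ | i
  · exact φ.coe_image
  · rfl

theorem ofCollObj_le {x y : Coll.{u} k} (f : x ⟶ y) : ofCollObj x ≤ ofCollObj y := by
  rcases x with φ | i <;> rcases y with ψ | j
  · have := Coll.verts_subset f id id
    rw [Coll.verts_face, Coll.verts_face, ← FaceCat.coe_image, ← FaceCat.coe_image] at this
    exact Finset.coe_subset.1 this
  · refine (Finset.min'_le _ φ.first ?_).trans (PLift.down f)
    exact Finset.mem_image.2 ⟨0, Finset.mem_univ _, rfl⟩
  · exact PEmpty.elim f
  · exact PLift.down f

/-- The functor from faces and points. -/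
def ofColl (k : SimplexCategory) : Coll.{u} k ⥤ Cell.{u} k where
  obj := ofCollObj
  map f := homOfLE (ofCollObj_le f)

theorem nonempty_hom_counit (x : Coll.{u} k) : Nonempty (collObj (ofCollObj x) ⟶ x) := by
  rcases x with φ | i
  · refine FaceCat.nonempty_hom _ _ (FaceCat.ofFinset_injective _ _) ?_
    rw [FaceCat.range_ofFinset, FaceCat.coe_image]
  · exact ⟨𝟙 _⟩

/-- The morphisms from the images of faces to the faces. -/
noncomputable def counit (k : SimplexCategory) : ofColl.{u} k ⋙ toColl k ⟶ 𝟭 _ where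
  app x := (nonempty_hom_counit x).some
  naturality _ _ _ := (subsingleton_hom _ _).elim _ _

end Cell

section
open Simplicial HomotopicalAlgebra SSet.modelCategoryQuillen MonoidalCategory

namespace Cell

variable {k : SimplexCategory}

/-- The map of cylinders from cells to faces and points. -/
noncomputable def cylToColl (k : SimplexCategory) :
    (marking.{u} k).cyl.toSSet ⟶ (Coll.marking.{u} k).cyl.toSSet :=
  SSet.homMk (fun n c => ⟨(c.1 ⋙ toColl k : ComposableArrows _ n.unop.len), fun a b ha hb =>
    (verts_collObj _).le.trans ((c.2 a b (fun h => ha ((isPt_collObj _).2 h))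
      ((isPt_collObj _).1 hb)).trans (verts_collObj _).ge)⟩) fun _ _ => rfl

/-- The map of cylinders from faces and points to cells. -/
def cylOfColl (k : SimplexCategory) :
    (Coll.marking.{u} k).cyl.toSSet ⟶ (marking.{u} k).cyl.toSSet :=
  SSet.homMk (fun n c => ⟨(c.1 ⋙ ofColl k : ComposableArrows _ n.unop.len), fun a b ha hb =>
    (verts_ofCollObj _).le.trans ((c.2 a b (fun h => ha ((isPt_ofCollObj _).2 h))
      ((isPt_ofCollObj _).1 hb)).trans (verts_ofCollObj _).ge)⟩) fun _ _ => rfl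

/-- A face and its image have the same vertices, so replacing one by the other affects neither the
cylinder condition nor the subcomplexes `base` and `bd`. -/
theorem deformChain_counit {n : ℕ} (c : ComposableArrows (Coll.{u} k) n)
    (ε : Fin (n + 1) →o Fin 2) (a : Fin (n + 1)) :
    ((Coll.marking k).isPt ((Marking.deformChain (counit k) c ε).obj a) ↔
      (Coll.marking k).isPt (c.obj a)) ∧
    (Coll.marking k).verts ((Marking.deformChain (counit k) c ε).obj a) =
      (Coll.marking k).verts (c.obj a) := by
  have h01 : ∀ a, ε a = 0 ∨ ε a = 1 := fun a => by omega
  rcases h01 a with h | h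
  · rw [Marking.deformChain_obj_zero _ _ _ _ h]
    exact ⟨(isPt_collObj _).trans (isPt_ofCollObj _),
      (verts_collObj _).trans (verts_ofCollObj _)⟩
  · rw [Marking.deformChain_obj_one _ _ _ _ h]
    exact ⟨Iff.rfl, rfl⟩

open Classical in
/-- The indices of the points of a chain. -/
noncomputable def ptSet (s : Set (Cell.{u} k)) : Finset (Fin (k.len + 1)) :=
  Finset.univ.filter fun i => pt i ∈ s

theorem mem_ptSet (s : Set (Cell.{u} k)) (i : Fin (k.len + 1)) : i ∈ ptSet s ↔ pt i ∈ s := by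
  simp [ptSet]

open Classical in
/-- The set of the points of a chain. -/
noncomputable def ptCell (s : Set (Cell.{u} k)) : Cell.{u} k :=
  if h : (ptSet s).Nonempty then set (ptSet s) h else pt 0

theorem ptCell_eq (s : Set (Cell.{u} k)) (h : (ptSet s).Nonempty) :
    ptCell s = set (ptSet s) h := dif_pos h

/-- The involution inserts or removes the set `ptCell s` of all points that occur in the chain `s`.
Its elements already belong to the support, so the support does not change. The rank is the number
of points. -/
theorem anodyneExtensions_preimage (k : SimplexCategory) :
    SSet.anodyneExtensions
      (((Coll.marking.{u} k).base ⊔ (Coll.marking k).bd).preimage (cylToColl k)).ι := by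
  -- Outside `base ⊔ bd` a chain has a point, so the default value `pt 0` of `ptCell` never occurs.
  have hne : ∀ s : Set (Cell.{u} k), ¬ ((∀ x ∈ s, ¬ (marking k).isPt x) ∨
      ⋃ x ∈ s, (marking k).verts x ≠ Set.univ) → (ptSet s).Nonempty := by
    intro s hs
    push Not at hs
    obtain ⟨⟨_ | i, hx, h⟩, -⟩ := hs
    · exact h.elim
    · exact ⟨i, (mem_ptSet _ _).2 hx⟩
  have hsub : ∀ s : Set (Cell.{u} k), (∀ x ∈ s, ∀ y ∈ s, ¬ (marking k).isPt x →
      (marking k).isPt y → (marking k).verts y ⊆ (marking k).verts x) →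
      ∀ S hS, set S hS ∈ s → ptSet s ⊆ S := fun s hs S hS hx i hi =>
    hs _ hx _ ((mem_ptSet _ _).1 hi) id trivial rfl
  have hins : ∀ (s : Set (Cell.{u} k)) S hS, ptSet (insert (set S hS) s) = ptSet s := by
    intro s S hS
    ext i
    simp [mem_ptSet]
  have hera : ∀ (s : Set (Cell.{u} k)) S hS, ptSet (s \ {set S hS}) = ptSet s := by
    intro s S hS
    ext i
    simp [mem_ptSet]
  refine NerveToggle.anodyneExtensions_ι _
    (fun s => ∀ x ∈ s, ∀ y ∈ s, ¬ (marking k).isPt x → (marking k).isPt y →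
      (marking k).verts y ⊆ (marking k).verts x)
    (fun s => (∀ x ∈ s, ¬ (marking k).isPt x) ∨ ⋃ x ∈ s, (marking k).verts x ≠ Set.univ)
    (fun n c => ?_) (fun n x => ?_) ptCell (fun s => (ptSet s).card) ?_ ?_ ?_
  · simp only [Set.forall_mem_range]
    rfl
  · simp only [Set.forall_mem_range, Set.biUnion_range]
    refine or_congr (forall_congr' fun a => not_congr (isPt_collObj _)) ?_
    change (⋃ a, (Coll.marking k).verts (collObj (x.1.obj a))) ≠ _ ↔ _
    simp only [verts_collObj]
  · intro s _ hc hV hU _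
    have h := hne s hU
    rw [ptCell_eq s h]
    -- The cylinder condition says that every set in the chain contains all points, hence precedes
    -- `ptCell s`; and `ptCell s` precedes every point, because its minimum is at most that point.
    refine ⟨hc.insert fun b hb _ => ?_, ?_, ?_, ?_⟩
    · rcases b with ⟨S, hS⟩ | i
      · exact Or.inr (set_le_set.2 (hsub s hV S hS hb))
      · exact Or.inl (set_le_pt.2 (Finset.min'_le _ _ ((mem_ptSet _ _).2 hb)))
    · rintro x hx y (rfl | hy) hxp hyp
      · exact hyp.elim
      · rcases hx with rfl | hx
        · rcases y with ⟨S, hS⟩ | i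
          · exact hyp.elim
          · rintro _ rfl
            exact (mem_ptSet _ _).2 hy
        · exact hV x hx y hy hxp hyp
    · push Not at hU ⊢
      obtain ⟨⟨x, hx, hxp⟩, hU⟩ := hU
      exact ⟨⟨x, Or.inr hx, hxp⟩, Set.eq_univ_of_univ_subset
        (hU ▸ Set.biUnion_subset_biUnion_left (Set.subset_insert _ _))⟩
    · rw [ptCell_eq _ (by rw [hins]; exact h)]
      simp only [hins]
  · intro s _ hc hV hU hmem
    have h := hne s hU
    rw [ptCell_eq s h] at hmem ⊢
    refine ⟨?_, fun x hx y hy => hV x hx.1 y hy.1, ?_, ?_⟩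
    · obtain ⟨i, hi⟩ := h
      exact ⟨pt i, (mem_ptSet _ _).1 hi, by simp⟩
    · push Not at hU ⊢
      obtain ⟨⟨x, hx, hxp⟩, hU⟩ := hU
      refine ⟨⟨x, ⟨hx, ?_⟩, hxp⟩, Set.eq_univ_of_univ_subset ?_⟩
      · rintro rfl
        exact hxp
      · rw [← hU]
        -- A vertex of the removed set is still in the support, through the corresponding point of
        -- the chain.
        refine Set.iUnion₂_subset fun y hy i hi => ?_
        by_cases hy' : y = set (ptSet s) h
        · subst hy'
          exact Set.mem_biUnion (x := pt i) ⟨(mem_ptSet _ _).1 hi, by simp⟩ rfl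
        · exact Set.mem_biUnion (x := y) ⟨hy, hy'⟩ hi
    · rw [ptCell_eq _ (by rw [hera]; exact h)]
      simp only [hera]
  · intro s t hsf htf _ _ hVs hUs hs hVt hUt ht hst hcard hsub'
    have h := hne s hUs
    have h' := hne t hUt
    -- The points of `s` are among those of `t`. If they were the same, `s` and `t` would have the
    -- same cell `e`, which `s` omits; then `s ⊆ t`, and `s = t` by cardinality.
    refine Finset.card_lt_card (Finset.ssubset_iff_subset_ne.2 ⟨fun i hi => ?_, fun heq => ?_⟩)
    · rw [mem_ptSet] at hi ⊢
      refine (hsub' hi).resolve_left ?_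
      rw [ptCell_eq t h']
      simp
    · have he : ptCell s = ptCell t := by
        rw [ptCell_eq s h, ptCell_eq t h']
        simp only [heq]
      have hle : s ⊆ t := fun x hx => (hsub' hx).resolve_left fun hx' => hs (he ▸ hx' ▸ hx)
      exact hst (Set.eq_of_subset_of_ncard_le hle hcard.ge htf)

end Cell

namespace Coll

/-- Replacing each face by its image, along `counit`, deforms the cylinder through the one of the
poset of cells, where the involution applies. -/
theorem anodyneExtensions_base_sup_bd (k : SimplexCategory) :
    SSet.anodyneExtensions ((marking.{u} k).base ⊔ (marking k).bd).ι := by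
  refine SSet.anodyneExtensions_of_deformation _ (Cell.cylToColl k) (Cell.cylOfColl k) 0 1
    (Marking.deform _ (Cell.counit k) fun n c ε hc a b ha hb => ?_)
    (fun n x => Subtype.ext (Marking.deformChain_const_zero _ _))
    (fun n x => Subtype.ext ((Marking.deformChain_const_one _ _).trans rfl))
    (fun n x s hx => ?_) (Cell.anodyneExtensions_preimage k)
  · have h1 := Cell.deformChain_counit c ε a
    have h2 := Cell.deformChain_counit c ε b
    rw [h1.1] at ha
    rw [h2.1] at hb
    rw [h1.2, h2.2]
    exact hc a b ha hb
  · have key := Cell.deformChain_counit x.1 (SSet.stdSimplex.objEquiv s).toOrderHom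
    refine hx.imp (fun hx a => ?_) fun hx h => hx ?_
    · exact fun h => hx a ((key a).1.1 h)
    · exact (Set.iUnion_congr fun a => (key a).2).symm.trans h

end Coll

end

/-! ### The cosimplicial cylinder -/

namespace Coll

variable {k l m : SimplexCategory}

theorem isPt_push (α : k ⟶ l) (x : Coll.{u} k) :
    (marking l).isPt ((push α).obj x) ↔ (marking k).isPt x := by
  rcases x with φ | i <;> rfl

theorem verts_push (α : k ⟶ l) (x : Coll.{u} k) :
    (marking l).verts ((push α).obj x) = α.toOrderHom '' (marking k).verts x := by
  rcases x with φ | i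
  · exact Set.range_comp α.toOrderHom φ.map.toOrderHom
  · exact (Set.image_singleton (f := α.toOrderHom)).symm

theorem verts_nonempty (x : Coll.{u} k) : ((marking k).verts x).Nonempty := by
  rcases x with φ | i
  · exact ⟨_, 0, rfl⟩
  · exact ⟨i, rfl⟩

theorem face_heq {φ ψ : FaceCat.{u} k} (f : φ ⟶ ψ) {a a' : φ.dom ⟶ l} {b b' : ψ.dom ⟶ l}
    (ha : a = a') (hb : b = b') (w : f.1 ≫ a = b) (w' : f.1 ≫ a' = b') :
    HEq (⟨f.1, w⟩ : FaceCat.mk.{u} a ⟶ FaceCat.mk.{u} b)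
      (⟨f.1, w'⟩ : FaceCat.mk.{u} a' ⟶ FaceCat.mk.{u} b') := by
  subst ha hb
  rfl

theorem hom_pt_heq {x y : Coll.{u} k} {i j : Fin (k.len + 1)} (f : x ⟶ pt i) (g : y ⟶ pt j)
    (h : x = y) (h' : i = j) : HEq f g := by
  subst h h'
  exact heq_of_eq (Subsingleton.elim _ _)

theorem push_obj_congr {α β : k ⟶ l} (x : Coll.{u} k)
    (h : ∀ i ∈ (marking k).verts x, α.toOrderHom i = β.toOrderHom i) :
    (push α).obj x = (push β).obj x := by
  rcases x with φ | i
  · refine congrArg face (congrArg FaceCat.mk ?_)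
    ext i : 3
    exact h _ ⟨i, rfl⟩
  · exact congrArg pt (h i rfl)

theorem push_map_congr {α β : k ⟶ l} {x y : Coll.{u} k} (f : x ⟶ y)
    (hx : ∀ i ∈ (marking k).verts x, α.toOrderHom i = β.toOrderHom i)
    (hy : ∀ i ∈ (marking k).verts y, α.toOrderHom i = β.toOrderHom i) :
    HEq ((push α).map f) ((push β).map f) := by
  rcases x with φ | i <;> rcases y with ψ | j
  · refine face_heq f ?_ ?_ _ _
    · ext i : 3
      exact hx _ ⟨i, rfl⟩
    · ext i : 3
      exact hy _ ⟨i, rfl⟩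
  · exact hom_pt_heq _ _ (push_obj_congr _ hx) (hy j rfl)
  · exact f.elim
  · exact hom_pt_heq _ _ (push_obj_congr _ hx) (hy j rfl)

/-- This gives the axiom `push_congr` of a supported cosimplicial object, by which a simplex is
recovered from its restriction to its support. -/
theorem comp_push_congr {α β : k ⟶ l} {n : ℕ} (c : ComposableArrows (Coll.{u} k) n)
    (h : ∀ a, ∀ i ∈ (marking k).verts (c.obj a), α.toOrderHom i = β.toOrderHom i) :
    c ⋙ push α = c ⋙ push β :=
  CategoryTheory.Functor.hext (fun a => push_obj_congr _ (h a))
    fun a b f => push_map_congr (c.map f) (h a) (h b)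

theorem push_id : push.{u} (𝟙 k) = 𝟭 _ := by
  refine CategoryTheory.Functor.hext (fun x => ?_) fun x y f => ?_
  · rcases x with φ | i
    · exact congrArg (fun a => face (FaceCat.mk a)) (Category.comp_id φ.map)
    · rfl
  · rcases x with φ | i <;> rcases y with ψ | j
    · exact face_heq f (Category.comp_id φ.map) (Category.comp_id ψ.map) _ _
    · exact hom_pt_heq _ _ (congrArg (fun a => face (FaceCat.mk a)) (Category.comp_id φ.map)) rfl
    · exact PEmpty.elim f
    · rfl

theorem push_comp (α : k ⟶ l) (β : l ⟶ m) : push.{u} (α ≫ β) = push α ⋙ push β := by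
  refine CategoryTheory.Functor.hext (fun x => ?_) fun x y f => ?_
  · rcases x with φ | i
    · exact congrArg (fun a => face (FaceCat.mk a)) (Category.assoc φ.map α β).symm
    · rfl
  · rcases x with φ | i <;> rcases y with ψ | j
    · exact face_heq f (Category.assoc φ.map α β).symm (Category.assoc ψ.map α β).symm _ _
    · exact hom_pt_heq _ _ (congrArg (fun a => face (FaceCat.mk a)) (Category.assoc φ.map α β).symm) rfl
    · exact PEmpty.elim f
    · rfl

theorem comp_push_mem_cyl (α : k ⟶ l) (n : SimplexCategoryᵒᵖ) (c : (nerve (Coll.{u} k)).obj n)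
    (hc : c ∈ (marking k).cyl.obj n) :
    (c ⋙ push α : ComposableArrows (Coll.{u} l) n.unop.len) ∈ (marking l).cyl.obj n := by
  intro a b ha hb
  change (marking l).verts ((push α).obj (c.obj b)) ⊆ (marking l).verts ((push α).obj (c.obj a))
  rw [verts_push, verts_push]
  exact Set.image_mono (hc a b (fun h => ha ((isPt_push α _).2 h)) ((isPt_push α _).1 hb))

end Coll

/-- A cosimplicial simplicial set whose simplices in degree `k` are supported on sets of vertices
of `[k]`, and depend only on the restriction of maps to the support. -/
structure SupportedCosimplicial where
  functor : SimplexCategory ⥤ SSet.{u}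
  supp : ∀ {k n}, (functor.obj k).obj n → Set (Fin (k.len + 1))
  supp_nonempty : ∀ {k n} (m : (functor.obj k).obj n), (supp m).Nonempty
  supp_map_subset : ∀ {k n n'} (θ : n ⟶ n') (m : (functor.obj k).obj n),
    supp ((functor.obj k).map θ m) ⊆ supp m
  supp_push : ∀ {k l : SimplexCategory} {n} (α : k ⟶ l) (m : (functor.obj k).obj n),
    supp ((functor.map α).app n m) = α.toOrderHom '' supp m
  push_congr : ∀ {k l : SimplexCategory} {n} (α β : k ⟶ l) (m : (functor.obj k).obj n),
    (∀ i ∈ supp m, α.toOrderHom i = β.toOrderHom i) →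
      (functor.map α).app n m = (functor.map β).app n m

/-- The cylinders of the simplices. -/
def Coll.cylinder : SupportedCosimplicial.{u} where
  functor :=
    { obj k := (marking k).cyl.toSSet
      map α := (marking _).cylMap (marking _) (push α) (comp_push_mem_cyl α)
      map_id k := by
        refine SSet.hom_ext_apply fun n c => Subtype.ext ?_
        exact congrArg (fun F => (c.1 ⋙ F : ComposableArrows _ _)) push_id
      map_comp α β := by
        refine SSet.hom_ext_apply fun n c => Subtype.ext ?_
        exact congrArg (fun F => (c.1 ⋙ F : ComposableArrows _ _)) (push_comp α β) }
  supp {k n} m := (marking k).supp m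
  supp_nonempty {k n} m := (verts_nonempty (m.1.obj 0)).mono
    (Set.subset_iUnion (fun a => (marking k).verts (m.1.obj a)) 0)
  supp_map_subset {k n n'} θ m := (marking k).supp_map_subset θ m
  supp_push {k l n} α m := by
    refine Eq.trans ?_ (Set.image_iUnion (f := α.toOrderHom)).symm
    exact Set.iUnion_congr fun a => verts_push α (m.1.obj a)
  push_congr {k l n} α β m h := Subtype.ext
    (comp_push_congr _ fun a i hi => h i (Set.mem_iUnion.2 ⟨a, hi⟩))

/-! ### Extension of natural families -/

/-- A family indexed by a set with a rank can be chosen recursively, each member subject to a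
condition which involves the members of smaller rank. -/
theorem exists_family_of_rank {ι : Type*} (rk : ι → ℕ) {T : ι → Type*}
    (R : ∀ n, (∀ l, rk l < rk n → T l) → T n → Prop)
    (step : ∀ n (f : ∀ l, rk l < rk n → T l),
      (∀ m (hm : rk m < rk n), R m (fun l hl => f l (hl.trans hm)) (f m hm)) → ∃ t, R n f t) :
    ∃ F : ∀ n, T n, ∀ n, R n (fun l _ => F l) (F n) := by
  classical
  -- These partial families only serve to show that every `T n` is inhabited, which supplies a
  -- default value for the well-founded recursion that defines `F`.
  have aux : ∀ N, ∃ f : ∀ l, rk l < N → T l,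
      ∀ m (hm : rk m < N), R m (fun l hl => f l (hl.trans hm)) (f m hm) := by
    intro N
    induction N with
    | zero => exact ⟨fun l h => absurd h (Nat.not_lt_zero _), fun m h => absurd h (Nat.not_lt_zero _)⟩
    | succ N ih =>
      obtain ⟨f, hf⟩ := ih
      have h : ∀ n, rk n = N → ∃ t, ∀ h' : ∀ l, rk l < rk n → rk l < N,
          R n (fun l hl => f l (h' l hl)) t := by
        rintro n rfl
        obtain ⟨t, ht⟩ := step n f hf
        exact ⟨t, fun _ => ht⟩
      choose t ht using h
      let g : ∀ l, rk l < N + 1 → T l := fun l hl =>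
        if h : rk l < N then f l h else t l (by omega)
      have hg : ∀ m (hm : rk m ≤ N), (fun l (hl : rk l < rk m) => g l (by omega)) =
          fun l hl => f l (hl.trans_le hm) := by
        intro m hm
        funext l hl
        exact dif_pos _
      refine ⟨g, fun m hm => ?_⟩
      by_cases h : rk m < N
      · have e : g m hm = f m h := dif_pos h
        rw [e]
        exact (hg m h.le).symm ▸ hf m h
      · have e : g m hm = t m (by omega) := dif_neg h
        rw [e]
        exact (hg m (by omega)).symm ▸ ht m (by omega) fun l hl => by omega
  have hne : ∀ n, Nonempty (T n) := fun n => by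
    obtain ⟨f, -⟩ := aux (rk n + 1)
    exact ⟨f n (Nat.lt_succ_self _)⟩
  let F : ∀ n, T n := (measure rk).wf.fix fun n ih =>
    if h : ∃ t, R n ih t then h.choose else Classical.choice (hne n)
  have hF : ∀ n, F n = if h : ∃ t, R n (fun l _ => F l) t then h.choose else Classical.choice (hne n) :=
    fun n => (measure rk).wf.fix_eq _ n
  refine ⟨F, fun n => ?_⟩
  induction n using (measure rk).wf.induction with
  | _ n ih =>
    have h := step n (fun l _ => F l) ih
    rw [hF n, dif_pos h]
    exact h.choose_spec

/-- Retraction of `[n]` to a nonempty subset. -/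
theorem SimplexCategory.exists_retraction {n : SimplexCategory} (S : Set (Fin (n.len + 1)))
    (hS : S.Nonempty) :
    ∃ (l : SimplexCategory) (i : l ⟶ n) (r : n ⟶ l), l.len ≤ n.len ∧ (S ≠ Set.univ → l.len < n.len) ∧
      (∀ a, i.toOrderHom a ∈ S) ∧ ∀ a ∈ S, i.toOrderHom (r.toOrderHom a) = a := by
  obtain ⟨f, hf, hf'⟩ := exists_orderHom_retraction S hS
  -- The object `l` is the image of the idempotent map `f`; a subset that is not everything has a
  -- strictly smaller image.
  let φ : n ⟶ n := SimplexCategory.mkHom f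
  have fac : Limits.factorThruImage φ ≫ Limits.image.ι φ = φ := Limits.image.fac φ
  have hfac : ∀ a, (Limits.image.ι φ).toOrderHom ((Limits.factorThruImage φ).toOrderHom a) = f a :=
    fun a => congrArg (fun θ => θ.toOrderHom a) fac
  have hmem : ∀ a, (Limits.image.ι φ).toOrderHom a ∈ S := by
    intro a
    obtain ⟨b, rfl⟩ := SimplexCategory.epi_iff_surjective.1
      (inferInstance : Epi (Limits.factorThruImage φ)) a
    rw [hfac]
    exact hf b
  have hle := SimplexCategory.len_le_of_mono (Limits.image.ι φ)
  refine ⟨Limits.image φ, Limits.image.ι φ, Limits.factorThruImage φ, hle, fun h => ?_, hmem,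
    fun a ha => (hfac a).trans (hf' a ha)⟩
  refine hle.lt_of_ne fun he => h (Set.eq_univ_of_forall fun b => ?_)
  have hinj := SimplexCategory.mono_iff_injective.1 (inferInstance : Mono (Limits.image.ι φ))
  have hsurj := ((Fintype.bijective_iff_injective_and_card _).2 ⟨hinj, by simp [he]⟩).2
  obtain ⟨a, rfl⟩ := hsurj b
  exact hmem a

/-- A quantity attached to presentations `λ^* y` of a degenerate simplex, and compatible with
simplicial operators, does not depend on the presentation. -/
theorem SSet.eq_of_map_eq (K : SSet.{u}) {n : SimplexCategory} {Z : Type*}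
    (v : ∀ l : SimplexCategory, l.len < n.len → (n ⟶ l) → K.obj (op l) → Z)
    (hv : ∀ l hl p hp (f : n ⟶ l) (π : l ⟶ p) (w : K.obj (op p)),
      v p hp (f ≫ π) w = v l hl f (K.map π.op w))
    {l l' : SimplexCategory} (hl : l.len < n.len) (hl' : l'.len < n.len) (f : n ⟶ l) (f' : n ⟶ l')
    (y : K.obj (op l)) (y' : K.obj (op l')) (h : K.map f.op y = K.map f'.op y') :
    v l hl f y = v l' hl' f' y' := by
  -- Every presentation can be reduced, without changing `v`, to one by a surjection and a
  -- nondegenerate simplex. By the Eilenberg–Zilber lemma that one is unique.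
  have key : ∀ (l : SimplexCategory) (hl : l.len < n.len) (f : n ⟶ l) (y : K.obj (op l)),
      ∃ (m : ℕ) (hm : m < n.len) (e : n ⟶ SimplexCategory.mk m) (_ : Epi e) (w : K.nonDegenerate m),
        K.map f.op y = K.map e.op w ∧ v l hl f y = v _ hm e w := by
    intro l hl f y
    have fac : Limits.factorThruImage f ≫ Limits.image.ι f = f := Limits.image.fac f
    have hq : (Limits.image f).len < n.len :=
      (SimplexCategory.len_le_of_mono (Limits.image.ι f)).trans_lt hl
    obtain ⟨m, g, hg, w, hw⟩ := K.exists_nonDegenerate (n := (Limits.image f).len)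
      (K.map (Limits.image.ι f).op y)
    have hm : m < n.len := (SimplexCategory.len_le_of_epi g).trans_lt hq
    have hg' : Epi (Y := SimplexCategory.mk m) (X := Limits.image f) g := hg
    refine ⟨m, hm, CategoryStruct.comp (Y := Limits.image f) (Limits.factorThruImage f) g,
      epi_comp _ _, w, ?_, ?_⟩
    · have h1 : K.map f.op y = K.map (Limits.factorThruImage f).op (K.map (Limits.image.ι f).op y) := by
        rw [← ConcreteCategory.comp_apply, ← K.map_comp, ← op_comp, fac]
      rw [h1, hw, ← ConcreteCategory.comp_apply, ← K.map_comp, ← op_comp]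
    · have h1 := hv _ hq l hl (Limits.factorThruImage f) (Limits.image.ι f) y
      rw [fac] at h1
      rw [h1, hw]
      exact (hv _ hq _ hm (Limits.factorThruImage f) g w).symm
  obtain ⟨m, hm, e, he, w, h1, h2⟩ := key l hl f y
  obtain ⟨m', hm', e', he', w', h1', h2'⟩ := key l' hl' f' y'
  have hx : K.map e.op w = K.map e'.op w' := h1.symm.trans (h.trans h1')
  obtain rfl := K.unique_nonDegenerate_dim (n := n.len) (K.map e.op w) e w rfl e' w' hx
  obtain rfl := K.unique_nonDegenerate_simplex (n := n.len) (K.map e.op w) e w rfl e' w' hx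
  obtain rfl := K.unique_nonDegenerate_map (n := n.len) (K.map e.op w) e w rfl e' w hx
  exact h2.trans h2'.symm

/-- The singular simplicial sets of the mapping spaces out of a simplicial space. -/
noncomputable def SimplicialSpace.sing (Y : SimplicialObject TopCat.{u}) (Z : Type u) [TopologicalSpace Z] :
    SimplexCategory ⥤ SSet.{u} where
  obj k := Sing (Y.obj (op k)) Z
  map α := Sing.restr Z (Y.map α.op).hom
  map_id k := SSet.hom_ext_apply fun n s => Sing.ext fun y t => by
    rw [Sing.val_restr]
    simp
  map_comp α β := SSet.hom_ext_apply fun n s => Sing.ext fun y t => by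
    rw [Sing.val_restr]
    simp

namespace SupportedCosimplicial

variable (Q : SupportedCosimplicial.{u})

/-- The simplices which are not supported everywhere. -/
def bd (k : SimplexCategory) : (Q.functor.obj k).Subcomplex where
  obj _ := {m | Q.supp m ≠ Set.univ}
  map θ m hm h := hm (Set.eq_univ_of_univ_subset (h ▸ Q.supp_map_subset θ m))

variable {Q}

/-- A map from a smaller simplex is not surjective on vertices. Conversely, retraction to the
support shows that `bd` consists of such images only, so it plays the role of the latching object.
-/
theorem push_mem_bd {k l : SimplexCategory} (h : k.len < l.len) (α : k ⟶ l) {n : SimplexCategoryᵒᵖ}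
    (m : (Q.functor.obj k).obj n) : (Q.functor.map α).app n m ∈ (Q.bd l).obj n := by
  change Q.supp _ ≠ Set.univ
  rw [Q.supp_push]
  intro he
  have hs : Function.Surjective α.toOrderHom := fun b => by
    obtain ⟨a, -, ha⟩ := he.symm ▸ Set.mem_univ b
    exact ⟨a, ha⟩
  have := Fintype.card_le_of_surjective _ hs
  simp at this
  omega

theorem push_push {k l p : SimplexCategory} (α : k ⟶ l) (β : l ⟶ p) {n : SimplexCategoryᵒᵖ}
    (m : (Q.functor.obj k).obj n) : (Q.functor.map β).app n ((Q.functor.map α).app n m) =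
      (Q.functor.map (α ≫ β)).app n m := by
  rw [Q.functor.map_comp]
  rfl

theorem push_id {k : SimplexCategory} {n : SimplexCategoryᵒᵖ} (m : (Q.functor.obj k).obj n) :
    (Q.functor.map (𝟙 k)).app n m = m := by
  rw [Q.functor.map_id]
  rfl

/-- A simplex comes from its support. -/
theorem push_retract {k l : SimplexCategory} (i : l ⟶ k) (r : k ⟶ l) {n : SimplexCategoryᵒᵖ}
    (m : (Q.functor.obj k).obj n) (h : ∀ a ∈ Q.supp m, i.toOrderHom (r.toOrderHom a) = a) :
    (Q.functor.map i).app n ((Q.functor.map r).app n m) = m := by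
  rw [push_push]
  exact (Q.push_congr (r ≫ i) (𝟙 k) m h).trans (push_id m)

end SupportedCosimplicial
section
variable {Q : SupportedCosimplicial.{u}} {S : SimplexCategory ⥤ SSet.{u}}

/-- Naturality of a map in degrees less than `n`. -/
def NatBelow (n : ℕ) (f : ∀ l : SimplexCategory, l.len < n → (Q.functor.obj l ⟶ S.obj l)) : Prop :=
  ∀ l l' (hl : l.len < n) (hl' : l'.len < n) (α : l ⟶ l'), Q.functor.map α ≫ f l' hl' = f l hl ≫ S.map α

theorem NatBelow.apply {n : ℕ} {f : ∀ l : SimplexCategory, l.len < n → (Q.functor.obj l ⟶ S.obj l)}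
    (hf : NatBelow n f) {l l' : SimplexCategory} (hl : l.len < n) (hl' : l'.len < n) (α : l ⟶ l')
    {d : SimplexCategoryᵒᵖ} (m : (Q.functor.obj l).obj d) :
    (f l' hl').app d ((Q.functor.map α).app d m) = (S.map α).app d ((f l hl).app d m) :=
  congrArg (fun q => q.app d m) (hf l l' hl hl' α)

/-- The object `p` may have any dimension, so naturality of `f` does not apply to `α` and `β`
themselves. But `m` comes from its support, of dimension less than `n`, where the two maps coincide.
-/
theorem NatBelow.congr {n : ℕ} {f : ∀ l : SimplexCategory, l.len < n → (Q.functor.obj l ⟶ S.obj l)}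
    (hf : NatBelow n f) {l p : SimplexCategory} (hl : l.len < n) (α β : l ⟶ p)
    {d : SimplexCategoryᵒᵖ} (m : (Q.functor.obj l).obj d)
    (h : ∀ i ∈ Q.supp m, α.toOrderHom i = β.toOrderHom i) :
    (S.map α).app d ((f l hl).app d m) = (S.map β).app d ((f l hl).app d m) := by
  obtain ⟨q, i, r, hq, -, hi, hr⟩ := SimplexCategory.exists_retraction (Q.supp m) (Q.supp_nonempty m)
  have h1 := hf.apply (hq.trans_lt hl) hl i ((Q.functor.map r).app d m)
  rw [SupportedCosimplicial.push_retract i r m hr] at h1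
  have h2 : i ≫ α = i ≫ β := by
    ext a : 3
    exact h _ (hi a)
  have h3 : ∀ γ : l ⟶ p, (S.map γ).app d ((f l hl).app d m) =
      (S.map (i ≫ γ)).app d ((f q (hq.trans_lt hl)).app d ((Q.functor.map r).app d m)) := by
    intro γ
    rw [h1, S.map_comp]
    rfl
  rw [h3, h3, h2]

/-- A natural map in degrees less than `n` extends to the boundary in degree `n`. -/
theorem NatBelow.exists_bd {n : SimplexCategory}
    {f : ∀ l : SimplexCategory, l.len < n.len → (Q.functor.obj l ⟶ S.obj l)} (hf : NatBelow n.len f) :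
    ∃ b : (Q.bd n).toSSet ⟶ S.obj n, ∀ l (hl : l.len < n.len) (α : l ⟶ n) d
      (m : (Q.functor.obj l).obj d) (h : (Q.functor.map α).app d m ∈ (Q.bd n).obj d),
      b.app d ⟨(Q.functor.map α).app d m, h⟩ = (S.map α).app d ((f l hl).app d m) := by
  have H : ∀ d (m : (Q.bd n).toSSet.obj d), ∃ v : (S.obj n).obj d, ∀ l (hl : l.len < n.len) (α : l ⟶ n)
      (x : (Q.functor.obj l).obj d), m.1 = (Q.functor.map α).app d x →
        v = (S.map α).app d ((f l hl).app d x) := by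
    rintro d ⟨m, hm⟩
    obtain ⟨q, i, r, hq, hq', hi, hr⟩ :=
      SimplexCategory.exists_retraction (Q.supp m) (Q.supp_nonempty m)
    -- The value on a boundary simplex is computed from its support; any other presentation `α x`
    -- gives the same value, as `α` and its composite with the retraction agree on the support of
    -- `x`.
    refine ⟨(S.map i).app d ((f q (hq' hm)).app d ((Q.functor.map r).app d m)), ?_⟩
    rintro l hl α x rfl
    rw [SupportedCosimplicial.push_push, hf.apply hl (hq' hm)]
    have : (S.map i).app d ((S.map (α ≫ r)).app d ((f l hl).app d x)) =
        (S.map ((α ≫ r) ≫ i)).app d ((f l hl).app d x) := by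
      rw [S.map_comp (α ≫ r) i]
      rfl
    rw [this]
    refine hf.congr hl _ _ x fun a ha => ?_
    exact hr _ (by rw [Q.supp_push]; exact ⟨a, ha, rfl⟩)
  choose b hb using H
  have hex : ∀ d (m : (Q.bd n).toSSet.obj d), ∃ l, ∃ (_ : l.len < n.len), ∃ (α : l ⟶ n),
      ∃ x : (Q.functor.obj l).obj d, m.1 = (Q.functor.map α).app d x := by
    rintro d ⟨m, hm⟩
    obtain ⟨q, i, r, hq, hq', hi, hr⟩ :=
      SimplexCategory.exists_retraction (Q.supp m) (Q.supp_nonempty m)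
    exact ⟨q, hq' hm, i, _, (SupportedCosimplicial.push_retract i r m hr).symm⟩
  refine ⟨SSet.homMk b ?_, fun l hl α d m h => hb d ⟨_, h⟩ l hl α m rfl⟩
  intro d d' θ m
  obtain ⟨l, hl, α, x, hx⟩ := hex d m
  rw [hb d m l hl α x hx]
  have h1 : ((Q.bd n).toSSet.map θ m).1 = (Q.functor.map α).app d' ((Q.functor.obj l).map θ x) := by
    refine Eq.trans ?_ (SSet.app_map (Q.functor.map α) θ x).symm
    exact congrArg ((Q.functor.obj n).map θ) hx
  rw [hb d' _ l hl α _ h1, SSet.app_map (f l hl) θ x, SSet.app_map (S.map α)]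
end

namespace SimplicialSpace

theorem val_sing_map (Y : SimplicialObject TopCat.{u}) (Z : Type u) [TopologicalSpace Z]
    {k l : SimplexCategory} (α : k ⟶ l) {d : SimplexCategoryᵒᵖ} (s : ((sing Y Z).obj k).obj d)
    (y : Y.obj (op l)) (t : stdSimplex ℝ (Fin (d.unop.len + 1))) :
    Sing.val (((sing Y Z).map α).app d s) (y, t) = Sing.val s (Y.map α.op y, t) := rfl

theorem map_map (Y : SimplicialObject TopCat.{u}) {k l p : SimplexCategory} (α : k ⟶ l) (β : l ⟶ p)
    (y : Y.obj (op p)) : Y.map α.op (Y.map β.op y) = Y.map (α ≫ β).op y := by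
  rw [op_comp, Y.map_comp]
  rfl

theorem map_id_apply (Y : SimplicialObject TopCat.{u}) {k : SimplexCategory} (y : Y.obj (op k)) :
    Y.map (𝟙 k).op y = y := by
  rw [op_id, Y.map_id]
  rfl

/-- The degenerate simplices. -/
def degenerate (Y : SimplicialObject TopCat.{u}) (n : SimplexCategory) : Set (Y.obj (op n)) :=
  {y | ∃ l : SimplexCategory, l.len < n.len ∧ ∃ (f : n ⟶ l) (x : Y.obj (op l)), Y.map f.op x = y}

/-- A simplicial space with closed sets of degenerate simplices. -/
def ClosedDegeneracies (Y : SimplicialObject TopCat.{u}) : Prop :=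
  ∀ (n : ℕ) (i : Fin (n + 1)), IsClosed (Set.range (Y.map (SimplexCategory.σ i).op))

/-- In positive dimension these are the elementary degeneracies with their face sections; in
dimension zero nothing is degenerate and the cover is empty. The sections make maps prescribed on
the images of the degeneracies continuous. -/
theorem ClosedDegeneracies.exists_cover {Y : SimplicialObject TopCat.{u}} (h : ClosedDegeneracies Y)
    (n : SimplexCategory) :
    ∃ (ι : Type) (_ : Finite ι) (l : ι → SimplexCategory) (_ : ∀ i, (l i).len < n.len)
      (r : ∀ i, n ⟶ l i) (s : ∀ i, l i ⟶ n), (∀ i, s i ≫ r i = 𝟙 _) ∧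
      (∀ i, IsClosed (Set.range (Y.map (r i).op))) ∧
      ∀ y ∈ degenerate Y n, ∃ i, y ∈ Set.range (Y.map (r i).op) := by
  induction n using SimplexCategory.rec with
  | _ n =>
    cases n with
    | zero =>
      refine ⟨Empty, inferInstance, Empty.elim, fun i => i.elim, fun i => i.elim, fun i => i.elim,
        fun i => i.elim, fun i => i.elim, ?_⟩
      rintro y ⟨l, hl, -⟩
      exact absurd hl (Nat.not_lt_zero _)
    | succ n =>
      refine ⟨Fin (n + 1), inferInstance, fun _ => SimplexCategory.mk n, fun _ => Nat.lt_succ_self n,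
        fun i => SimplexCategory.σ i, fun i => SimplexCategory.δ i.castSucc,
        fun i => SimplexCategory.δ_comp_σ_self, h n, ?_⟩
      rintro y ⟨l, hl, f, x, rfl⟩
      let K : SSet.{u} := Y ⋙ CategoryTheory.forget TopCat.{u}
      have h1 : (Y.map f.op x : K.obj _) ∈ K.degenerate (n + 1) := ⟨l.len, hl, f, x, rfl⟩
      rw [SSet.degenerate_eq_iUnion_range_σ] at h1
      exact Set.mem_iUnion.1 h1

end SimplicialSpace

section

open SimplicialSpace

variable {Q : SupportedCosimplicial.{u}} {Y : SimplicialObject TopCat.{u}} {Z : Type u}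
  [TopologicalSpace Z] {A : ∀ k, Set (Y.obj (op k))} {n : SimplexCategory}
  {f : ∀ l : SimplexCategory, l.len < n.len → (Q.functor.obj l ⟶ (sing Y Z).obj l)}

theorem NatBelow.val_apply (hf : NatBelow n.len f) {l l' : SimplexCategory} (hl : l.len < n.len)
    (hl' : l'.len < n.len) (α : l ⟶ l') {d : SimplexCategoryᵒᵖ} (m : (Q.functor.obj l).obj d)
    (y : Y.obj (op l')) (t : stdSimplex ℝ (Fin (d.unop.len + 1))) :
    Sing.val ((f l' hl').app d ((Q.functor.map α).app d m)) (y, t) =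
      Sing.val ((f l hl).app d m) (Y.map α.op y, t) :=
  congrArg (fun s => Sing.val s (y, t)) (hf.apply hl hl' α m)

/-- A natural map in degrees less than `n` determines the map in degree `n` on the degenerate
simplices. -/
theorem NatBelow.exists_degenerate (hf : NatBelow n.len f) (hY : ClosedDegeneracies Y)
    (hA : ∀ {k l : SimplexCategory} (α : k ⟶ l) y, y ∈ A l → Y.map α.op y ∈ A k)
    (hAc : ∀ k, IsClosed (A k))
    (fA : ∀ k, Q.functor.obj k ⟶ Sing (A k) Z)
    (hfA : ∀ {k l : SimplexCategory} (α : k ⟶ l) d (m : (Q.functor.obj k).obj d) y (hy : y ∈ A l) t,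
      Sing.val ((fA l).app d ((Q.functor.map α).app d m)) (⟨y, hy⟩, t) =
        Sing.val ((fA k).app d m) (⟨_, hA α y hy⟩, t))
    (hA' : ∀ l (hl : l.len < n.len) d (m : (Q.functor.obj l).obj d) y (hy : y ∈ A l) t,
      Sing.val ((f l hl).app d m) (y, t) = Sing.val ((fA l).app d m) (⟨y, hy⟩, t)) :
    ∃ c : Q.functor.obj n ⟶ Sing (A n ∪ degenerate Y n : Set _) Z,
      (∀ d (m : (Q.functor.obj n).obj d) y (hy : y ∈ A n) t,
        Sing.val (c.app d m) (⟨y, Or.inl hy⟩, t) = Sing.val ((fA n).app d m) (⟨y, hy⟩, t)) ∧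
      ∀ l (hl : l.len < n.len) (r : n ⟶ l) d (m : (Q.functor.obj n).obj d) y h t,
        Sing.val (c.app d m) (⟨Y.map r.op y, h⟩, t) =
          Sing.val ((f l hl).app d ((Q.functor.map r).app d m)) (y, t) := by
  obtain ⟨ι, hι, l, hl, r, s, hsr, hcl, hcov⟩ := hY.exists_cover n
  -- The prescribed value at a degenerate point does not depend on how the point is presented as a
  -- degeneracy.
  have key : ∀ {d} (m : (Q.functor.obj n).obj d) (t : stdSimplex ℝ (Fin (d.unop.len + 1)))
      {l l' : SimplexCategory} (hl : l.len < n.len) (hl' : l'.len < n.len) (g : n ⟶ l) (g' : n ⟶ l')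
      (y : Y.obj (op l)) (y' : Y.obj (op l')), Y.map g.op y = Y.map g'.op y' →
      Sing.val ((f l hl).app d ((Q.functor.map g).app d m)) (y, t) =
        Sing.val ((f l' hl').app d ((Q.functor.map g').app d m)) (y', t) := by
    intro d m t l l' hl hl' g g' y y' h
    refine SSet.eq_of_map_eq (Y ⋙ CategoryTheory.forget TopCat.{u} : SSet.{u})
      (fun l hl g y => Sing.val ((f l hl).app d ((Q.functor.map g).app d m)) (y, t)) ?_
      hl hl' g g' y y' h
    intro l hl p hp g π w
    refine Eq.trans ?_ (hf.val_apply hl hp π ((Q.functor.map g).app d m) w t)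
    rw [SupportedCosimplicial.push_push]
  have H : ∀ d (m : (Q.functor.obj n).obj d),
      ∃ c : C((A n ∪ degenerate Y n : Set _) × stdSimplex ℝ (Fin (d.unop.len + 1)), Z),
      (∀ y (hy : y ∈ A n) t,
        c (⟨y, Or.inl hy⟩, t) = Sing.val ((fA n).app d m) (⟨y, hy⟩, t)) ∧
      ∀ l (hl : l.len < n.len) (r : n ⟶ l) y h t, c (⟨Y.map r.op y, h⟩, t) =
          Sing.val ((f l hl).app d ((Q.functor.map r).app d m)) (y, t) := by
    intro d m
    let T := ((A n ∪ degenerate Y n : Set _) × stdSimplex ℝ (Fin (d.unop.len + 1)))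
    -- The domain is covered by `A` and the images of the degeneracies, all closed. On such an image
    -- the map is given by the section `s i` followed by the family in lower degree.
    let cov : Option ι → Set T := fun i => match i with
      | none => {p | p.1.1 ∈ A n}
      | some i => {p | p.1.1 ∈ Set.range (Y.map (r i).op)}
    have hcont : Continuous fun p : T => p.1.1 := continuous_subtype_val.comp continuous_fst
    have hsec : ∀ i y, y ∈ Set.range (Y.map (r i).op) → Y.map (r i).op (Y.map (s i).op y) = y := by
      rintro i _ ⟨y, rfl⟩
      rw [map_map Y (s i) (r i), hsr, map_id_apply]
    obtain ⟨c, hc⟩ := exists_continuousMap_of_isClosed_cover (Z := Z) cov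
      (by
        rintro (_ | i)
        · exact (hAc n).preimage hcont
        · exact (hcl i).preimage hcont)
      (by
        rintro ⟨⟨y, hy⟩, t⟩
        rcases hy with hy | hy
        · exact ⟨none, hy⟩
        · obtain ⟨i, hi⟩ := hcov y hy
          exact ⟨some i, hi⟩)
      (fun i => match i with
        | none => ⟨fun p => Sing.val ((fA n).app d m) (⟨p.1.1.1, p.2⟩, p.1.2),
            (Sing.val ((fA n).app d m)).continuous.comp
              (((hcont.comp continuous_subtype_val).subtype_mk fun p => p.2).prodMk
                (continuous_snd.comp continuous_subtype_val))⟩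
        | some i => ⟨fun p => Sing.val ((f _ (hl i)).app d ((Q.functor.map (r i)).app d m))
              (Y.map (s i).op p.1.1.1, p.1.2),
            (Sing.val ((f _ (hl i)).app d ((Q.functor.map (r i)).app d m))).continuous.comp
              (((Y.map (s i).op).hom.continuous.comp (hcont.comp continuous_subtype_val)).prodMk
                (continuous_snd.comp continuous_subtype_val))⟩)
      (by
        have h0 : ∀ i (p : T) (ha : p.1.1 ∈ A n) (hi : p.1.1 ∈ Set.range (Y.map (r i).op)),
            Sing.val ((fA n).app d m) (⟨p.1.1, ha⟩, p.2) =
            Sing.val ((f _ (hl i)).app d ((Q.functor.map (r i)).app d m)) (Y.map (s i).op p.1.1, p.2) := by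
          rintro i ⟨⟨y, hy⟩, t⟩ ha hi
          rw [hA' _ (hl i) d _ _ (hA (s i) y ha), hfA (r i)]
          simp only [hsec i y hi]
        rintro (_ | i) (_ | j) p hi hj
        · rfl
        · exact h0 j p hi hj
        · exact (h0 i p hj hi).symm
        · exact key m p.2 (hl i) (hl j) (r i) (r j) _ _ ((hsec i _ hi).trans (hsec j _ hj).symm))
    refine ⟨c, fun y hy t => hc none (⟨y, Or.inl hy⟩, t) hy, fun l' hl' r' y h t => ?_⟩
    obtain ⟨i, hi⟩ := hcov (Y.map r'.op y) ⟨l', hl', r', y, rfl⟩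
    rw [hc (some i) (⟨Y.map r'.op y, h⟩, t) hi]
    exact key m t (hl i) hl' (r i) r' _ _ (hsec i _ hi)
  choose c hc1 hc2 using H
  refine ⟨SSet.homMk (fun d m => Sing.mk (c d m)) ?_, hc1, fun l hl r d m y h t => hc2 d m l hl r y h t⟩
  intro d d' θ m
  refine Sing.ext ?_
  rintro ⟨y, hy⟩ t
  rw [Sing.val_map]
  change c d' _ _ = c d m _
  rcases hy with hy | hy
  · rw [hc1 _ _ y hy, hc1 _ _ y hy, Sing.val_app_map]
  · obtain ⟨l, hl, r, y, rfl⟩ := hy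
    refine (hc2 d' _ l hl r y _ t).trans (Eq.trans ?_ (hc2 d m l hl r y _ _).symm)
    rw [SSet.app_map (Q.functor.map r) θ m]
    exact Sing.val_app_map (f l hl) θ _ y t

/-- An endomorphism of `[l]` other than the identity factors through a smaller simplex, so
naturality for maps that strictly raise or lower the dimension suffices. -/
theorem natBelow_of_step {S : SimplexCategory ⥤ SSet.{u}} {n : ℕ}
    (f : ∀ l : SimplexCategory, l.len < n → (Q.functor.obj l ⟶ S.obj l))
    (h : ∀ m (hm : m.len < n) l (hl : l.len < m.len) (α : l ⟶ m),
      Q.functor.map α ≫ f m hm = f l (hl.trans hm) ≫ S.map α)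
    (h' : ∀ m (hm : m.len < n) l (hl : l.len < m.len) (α : m ⟶ l),
      Q.functor.map α ≫ f l (hl.trans hm) = f m hm ≫ S.map α) : NatBelow n f := by
  intro l l' hl hl' α
  rcases lt_trichotomy l.len l'.len with hlt | heq | hlt
  · exact h l' hl' l hlt α
  · obtain rfl : l = l' := SimplexCategory.ext heq
    by_cases hi : IsIso α
    · rw [SimplexCategory.eq_id_of_isIso α]
      simp
    · have fac : Limits.factorThruImage α ≫ Limits.image.ι α = α := Limits.image.fac α
      have hlt : (Limits.image α).len < l.len := by
        refine (SimplexCategory.len_le_of_mono (Limits.image.ι α)).lt_of_ne fun he => hi ?_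
        have : IsIso (Limits.image.ι α) := SimplexCategory.isIso_of_bijective
          ((Fintype.bijective_iff_injective_and_card _).2
            ⟨SimplexCategory.mono_iff_injective.1 inferInstance, by simp [he]⟩)
        have : IsIso (Limits.factorThruImage α) := SimplexCategory.isIso_of_bijective
          ((Fintype.bijective_iff_surjective_and_card _).2
            ⟨SimplexCategory.epi_iff_surjective.1 inferInstance, by simp [he]⟩)
        rw [← fac]
        infer_instance
      rw [← fac, Q.functor.map_comp, S.map_comp, Category.assoc, h l hl _ hlt, ← Category.assoc,
        h' l hl _ hlt, Category.assoc]
  · exact h' l hl l' hlt α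

/-- Extension of natural families of maps from `P` and from `A`. -/
theorem exists_extension {P : ∀ k, (Q.functor.obj k).Subcomplex}
    (hP : ∀ {k l : SimplexCategory} (α : k ⟶ l) d (m : (Q.functor.obj k).obj d),
      m ∈ (P k).obj d → (Q.functor.map α).app d m ∈ (P l).obj d)
    (hPbd : ∀ k, SSet.anodyneExtensions (P k ⊔ Q.bd k).ι) (hY : ClosedDegeneracies Y)
    (N : ∀ k, NDR (Y.obj (op k)) (A k ∪ degenerate Y k))
    (hA : ∀ {k l : SimplexCategory} (α : k ⟶ l) y, y ∈ A l → Y.map α.op y ∈ A k)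
    (hAc : ∀ k, IsClosed (A k))
    (fP : ∀ k, (P k).toSSet ⟶ (sing Y Z).obj k)
    (hfP : ∀ {k l : SimplexCategory} (α : k ⟶ l) d (m : (Q.functor.obj k).obj d)
      (hm : m ∈ (P k).obj d), (fP l).app d ⟨_, hP α d m hm⟩ =
        ((sing Y Z).map α).app d ((fP k).app d ⟨m, hm⟩))
    (fA : ∀ k, Q.functor.obj k ⟶ Sing (A k) Z)
    (hfA : ∀ {k l : SimplexCategory} (α : k ⟶ l) d (m : (Q.functor.obj k).obj d) y (hy : y ∈ A l) t,
      Sing.val ((fA l).app d ((Q.functor.map α).app d m)) (⟨y, hy⟩, t) =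
        Sing.val ((fA k).app d m) (⟨_, hA α y hy⟩, t))
    (hPA : ∀ k d m (hm : m ∈ (P k).obj d) y (hy : y ∈ A k) t,
      Sing.val ((fP k).app d ⟨m, hm⟩) (y, t) = Sing.val ((fA k).app d m) (⟨y, hy⟩, t)) :
    ∃ F : Q.functor ⟶ sing Y Z,
      (∀ k d m (hm : m ∈ (P k).obj d), (F.app k).app d m = (fP k).app d ⟨m, hm⟩) ∧
      ∀ k d m y (hy : y ∈ A k) t,
        Sing.val ((F.app k).app d m) (y, t) = Sing.val ((fA k).app d m) (⟨y, hy⟩, t) := by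
  -- The recursive condition on the member of degree `n` is naturality with respect to maps from and
  -- to smaller simplices, together with the prescribed values on `P` and over `A`.
  obtain ⟨F, hF⟩ := exists_family_of_rank SimplexCategory.len
    (T := fun k => Q.functor.obj k ⟶ (sing Y Z).obj k)
    (fun n f g => (∀ (l : SimplexCategory) (hl : l.len < n.len) (α : l ⟶ n),
        Q.functor.map α ≫ g = f l hl ≫ (sing Y Z).map α) ∧
      (∀ (l : SimplexCategory) (hl : l.len < n.len) (α : n ⟶ l), Q.functor.map α ≫ f l hl = g ≫ (sing Y Z).map α) ∧
      (∀ d m (hm : m ∈ (P n).obj d), g.app d m = (fP n).app d ⟨m, hm⟩) ∧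
      ∀ d m y (hy : y ∈ A n) t,
        Sing.val (g.app d m) (y, t) = Sing.val ((fA n).app d m) (⟨y, hy⟩, t)) (by
    intro n f h
    have hf : NatBelow n.len f := natBelow_of_step f (fun m hm => (h m hm).1) fun m hm => (h m hm).2.1
    have hP' : ∀ l (hl : l.len < n.len) d m (hm : m ∈ (P l).obj d),
        (f l hl).app d m = (fP l).app d ⟨m, hm⟩ := fun l hl => (h l hl).2.2.1
    have hA' : ∀ l (hl : l.len < n.len) d (m : (Q.functor.obj l).obj d) y (hy : y ∈ A l) t,
      Sing.val ((f l hl).app d m) (y, t) = Sing.val ((fA l).app d m) (⟨y, hy⟩, t) :=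
      fun l hl => (h l hl).2.2.2
    obtain ⟨b, hb⟩ := hf.exists_bd
    obtain ⟨c, hc1, hc2⟩ := hf.exists_degenerate hY hA hAc fA hfA hA'
    have hbd : ∀ d m (hm : m ∈ (Q.bd n).obj d), ∃ l, ∃ hl : l.len < n.len, ∃ (i : l ⟶ n) (r : n ⟶ l),
        (Q.functor.map i).app d ((Q.functor.map r).app d m) = m ∧
        b.app d ⟨m, hm⟩ = ((sing Y Z).map i).app d ((f l hl).app d ((Q.functor.map r).app d m)) := by
      intro d m hm
      obtain ⟨l, i, r, hl, hl', hi, hr⟩ :=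
        SimplexCategory.exists_retraction (Q.supp m) (Q.supp_nonempty m)
      have h1 := SupportedCosimplicial.push_retract i r m hr
      refine ⟨l, hl' hm, i, r, h1, ?_⟩
      refine Eq.trans ?_ (hb l (hl' hm) i d ((Q.functor.map r).app d m) (by rw [h1]; exact hm))
      exact congrArg (b.app d) (Subtype.ext h1.symm)
    obtain ⟨top, htop1, htop2⟩ := SSet.Subcomplex.exists_glue (P n) (Q.bd n) (fP n) b (by
      intro d m hm hm'
      obtain ⟨l, hl, i, r, h1, h2⟩ := hbd d m hm'
      rw [h2, hP' l hl d _ (hP r d m hm)]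
      refine Eq.trans ?_ (hfP i d _ (hP r d m hm))
      exact congrArg ((fP n).app d) (Subtype.ext h1.symm))
    have := (N n).fibration Z
    -- The data on `P ∪ bd` and the data over `A ∪ degenerate` form a square. Its commutativity has
    -- four cases; in the last one, boundary against degenerate, the composite `i ≫ e` runs between
    -- smaller simplices, where naturality is known.
    obtain ⟨g, hg1, hg2⟩ := (hPbd n).exists_lift
      (Sing.restr Z (⟨Subtype.val, continuous_subtype_val⟩ :
        C((A n ∪ degenerate Y n : Set (Y.obj (op n))), Y.obj (op n)))) top c (by
        refine SSet.hom_ext_apply ?_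
        rintro d ⟨m, hm | hm⟩
        · refine (congrArg ((Sing.restr Z _).app d) (htop1 d m hm)).trans (Sing.ext ?_)
          rintro ⟨y, hy⟩ t
          change Sing.val ((fP n).app d ⟨m, hm⟩) (y, t) = Sing.val (c.app d m) (⟨y, hy⟩, t)
          rcases hy with hy | ⟨l, hl, r, x, rfl⟩
          · exact (hPA n d m hm y hy t).trans (hc1 d m y hy t).symm
          · refine Eq.trans ?_ (hc2 l hl r d m x _ t).symm
            rw [hP' l hl d _ (hP r d m hm), hfP r d m hm]
            rfl
        · refine (congrArg ((Sing.restr Z _).app d) (htop2 d m hm)).trans (Sing.ext ?_)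
          rintro ⟨y, hy⟩ t
          change Sing.val (b.app d ⟨m, hm⟩) (y, t) = Sing.val (c.app d m) (⟨y, hy⟩, t)
          obtain ⟨l, hl, i, r, h1, h2⟩ := hbd d m hm
          rw [h2, val_sing_map]
          rcases hy with hy | ⟨p, hp, e, x, rfl⟩
          · rw [hA' l hl d _ _ (hA i y hy)]
            refine Eq.trans ?_ (hc1 d m y hy t).symm
            refine (hfA i d ((Q.functor.map r).app d m) y hy t).symm.trans ?_
            rw [h1]
          · refine Eq.trans ?_ (hc2 p hp e d m x _ t).symm
            rw [map_map]
            refine (hf.val_apply hl hp (i ≫ e) ((Q.functor.map r).app d m) x t).symm.trans ?_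
            rw [← SupportedCosimplicial.push_push, h1])
    have hg1' : ∀ d m (hm : m ∈ (P n ⊔ Q.bd n).obj d), g.app d m = top.app d ⟨m, hm⟩ :=
      fun d m hm => congrArg (fun q => q.app d ⟨m, hm⟩) hg1
    have hg2' : ∀ d m y hy t, Sing.val (g.app d m) (y, t) = Sing.val (c.app d m) (⟨y, hy⟩, t) :=
      fun d m y hy t => congrArg (fun q => Sing.val (q.app d m) (⟨y, hy⟩, t)) hg2
    refine ⟨g, ?_, ?_, ?_, ?_⟩
    · intro l hl α
      refine SSet.hom_ext_apply fun d m => ?_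
      have hm := SupportedCosimplicial.push_mem_bd hl α m
      exact (hg1' d _ (Or.inr hm)).trans ((htop2 d _ hm).trans (hb l hl α d m hm))
    · intro l hl α
      refine SSet.hom_ext_apply fun d m => Sing.ext fun y t => ?_
      exact ((hg2' d m _ (Or.inr ⟨l, hl, α, y, rfl⟩) t).trans (hc2 l hl α d m y _ t)).symm
    · intro d m hm
      exact (hg1' d m (Or.inl hm)).trans (htop1 d m hm)
    · intro d m y hy t
      exact (hg2' d m y (Or.inl hy) t).trans (hc1 d m y hy t))
  refine ⟨⟨F, fun k l α => ?_⟩, fun k => (hF k).2.2.1, fun k => (hF k).2.2.2⟩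
  exact natBelow_of_step (n := max k.len l.len + 1) (fun l _ => F l)
    (fun m hm => (hF m).1) (fun m hm => (hF m).2.1)
    k l (by omega) (by omega) α

end

/-! ### NDR pairs of bar constructions -/

/-- The identities, as a set of morphisms. -/
def Mor.identities (C : Type u) [Category.{v} C] : Set (Mor C) := Set.range fun a : C => Mor.mk (𝟙 a)

theorem Mor.mk_mem_identities {C : Type u} [Category.{v} C] {a b : C} (f : a ⟶ b) :
    Mor.mk f ∈ Mor.identities C ↔ ∃ h : a = b, f = eqToHom h := by
  constructor
  · rintro ⟨c, hc⟩
    obtain ⟨rfl, h⟩ := Mor.mk.inj hc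
    obtain ⟨rfl, h⟩ := h
    exact ⟨rfl, (eq_of_heq h).symm⟩
  · rintro ⟨rfl, rfl⟩
    exact ⟨a, rfl⟩

theorem Mor.mk_eq_of_comp_eq {C : Type u} [Category.{v} C] {a b c d : C} {f : a ⟶ b} {g : b ⟶ d}
    {f' : a ⟶ c} {g' : c ⟶ d} (h : f ≫ g = f' ≫ g') (hg : Mor.mk g ∈ Mor.identities C)
    (hf' : Mor.mk f' ∈ Mor.identities C) : Mor.mk f = Mor.mk g' := by
  obtain ⟨rfl, rfl⟩ := (Mor.mk_mem_identities _).1 hg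
  obtain ⟨rfl, rfl⟩ := (Mor.mk_mem_identities _).1 hf'
  simpa using h

theorem Mor.mk_eqToHom_comp {C : Type u} [Category.{v} C] (f : Mor C) {a b : C} (ha : a = f.source)
    (hb : f.target = b) : Mor.mk (eqToHom ha ≫ f.hom ≫ eqToHom hb) = f := by
  subst ha hb
  simp

theorem Mor.eq_eqToHom_comp {C : Type u} [Category.{v} C] {a b c d : C} {f : a ⟶ b} {g : c ⟶ d}
    (h : Mor.mk f = Mor.mk g) (ha : a = c) (hb : d = b) : f = eqToHom ha ≫ g ≫ eqToHom hb := by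
  subst ha hb
  simpa using h

/-- The morphisms of a topological category whose identities are a cofibration: a deformation to
the identities which preserves sources and targets. -/
theorem TopologicalCategory.IdentityIsCofibration.exists_ndr {A : TopologicalCategory.{u, u}}
    (hA : A.IdentityIsCofibration) : ∃ N : NDR A.mor (Mor.identities A.ob),
      (∀ f s, (N.h (f, s)).source = f.source) ∧ (∀ f s, (N.h (f, s)).target = f.target) ∧
        ∀ f s, s ≤ 0 → N.h (f, s) = f := by
  -- Homotopy extension into `mor × 0 ∪ ob × I` yields a retraction `(ρ₁, ρ₂)` of `mor × I` over `ob
  -- × ob`, so `ρ₁` preserves sources and targets.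
  let Z : Type u := {p : A.mor × unitInterval // p.2 = 0 ∨ p.1 ∈ Mor.identities A.ob}
  have hst : Continuous fun f : A.mor => (f.source, f.target) :=
    A.continuous_source.prodMk A.continuous_target
  obtain ⟨H, hH, hH0, hH1⟩ := hA.extension Z
    ⟨fun p => (p.1.1.source, p.1.1.target), hst.comp (continuous_fst.comp continuous_subtype_val)⟩
    ⟨fun f => ⟨(f, 0), Or.inl rfl⟩, (_root_.continuous_id.prodMk continuous_const).subtype_mk _⟩
    ⟨fun p => ⟨(Mor.mk (𝟙 p.1), p.2), Or.inr ⟨p.1, rfl⟩⟩,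
      ((A.continuous_id.comp continuous_fst).prodMk continuous_snd).subtype_mk _⟩
    (fun _ => rfl) (fun _ _ => rfl) (fun _ => rfl)
  let ρ₁ : A.mor × unitInterval → A.mor := fun p => (H p).1.1
  let ρ₂ : A.mor × unitInterval → unitInterval := fun p => (H p).1.2
  have hρ₁ : Continuous ρ₁ := continuous_fst.comp (continuous_subtype_val.comp H.continuous)
  have hρ₂ : Continuous ρ₂ := continuous_snd.comp (continuous_subtype_val.comp H.continuous)
  have h10 : ∀ f, ρ₁ (f, 0) = f := fun f => by simp [ρ₁, hH0]
  have h1i : ∀ f ∈ Mor.identities A.ob, ∀ s, ρ₁ (f, s) = f := by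
    rintro _ ⟨a, rfl⟩ s
    simp [ρ₁, hH1]
  have h2i : ∀ f ∈ Mor.identities A.ob, ∀ s, ρ₂ (f, s) = s := by
    rintro _ ⟨a, rfl⟩ s
    simp [ρ₂, hH1]
  have hρ : ∀ f s, (ρ₂ (f, s) : ℝ) ≠ 0 → ρ₁ (f, s) ∈ Mor.identities A.ob := fun f s h =>
    (H (f, s)).2.resolve_left fun h' => h (congrArg Subtype.val h')
  let w : A.mor → unitInterval → ℝ := fun f s => (s : ℝ) - ρ₂ (f, s)
  have hw : Continuous ↿w := by
    change Continuous fun p : A.mor × unitInterval => (p.2 : ℝ) - (ρ₂ p : ℝ)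
    fun_prop
  -- Strøm's function, the supremum of `s - ρ₂ (f, s)`; it is continuous because the interval is
  -- compact.
  let u₀ : A.mor → ℝ := fun f => sSup (w f '' Set.univ)
  have hu₀ : Continuous u₀ := isCompact_univ.continuous_sSup hw
  have hle : ∀ f s, w f s ≤ u₀ f := fun f s => le_csSup
    (isCompact_univ.image (hw.comp (Continuous.prodMk_right f))).bddAbove ⟨s, Set.mem_univ s, rfl⟩
  have hnn : ∀ f, 0 ≤ u₀ f := fun f => by
    refine le_trans ?_ (hle f 0)
    simp [w, ρ₂, hH0]
  have hid : ∀ f ∈ Mor.identities A.ob, u₀ f = 0 := fun f hf => by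
    refine le_antisymm (csSup_le (Set.univ_nonempty.image _) ?_) (hnn f)
    rintro _ ⟨s, -, rfl⟩
    simp [w, h2i f hf]
  have hid' : ∀ f, u₀ f = 0 → f ∈ Mor.identities A.ob := by
    intro f hf
    have hcl : IsClosed (Mor.identities A.ob) := hA.isClosed_range
    have hc : Continuous fun s : ℝ => ρ₁ (f, Set.projIcc 0 1 zero_le_one s) :=
      hρ₁.comp (continuous_const.prodMk continuous_projIcc)
    have h0 : ρ₁ (f, Set.projIcc 0 1 zero_le_one 0) = f := by
      rw [Set.projIcc_left]
      exact h10 f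
    rw [← h0]
    have hmem : (0 : ℝ) ∈ closure (Set.Ioo 0 1) := by
      rw [closure_Ioo zero_ne_one]
      exact ⟨le_rfl, zero_le_one⟩
    refine hcl.closure_subset_iff.2 ?_ (image_closure_subset_closure_image hc ⟨0, hmem, rfl⟩)
    rintro _ ⟨s, hs, rfl⟩
    -- If `u₀ f = 0` then `ρ₂ (f, s) ≥ s > 0`, so `ρ₁ (f, s)` is an identity for `s > 0`; as
    -- identities are closed, so is the limit `f`.
    refine hρ _ _ (ne_of_gt ?_)
    have h1 := hle f (Set.projIcc 0 1 zero_le_one s)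
    rw [hf] at h1
    have h2 : ((Set.projIcc (0 : ℝ) 1 zero_le_one s : unitInterval) : ℝ) = s := by
      rw [Set.projIcc_of_mem _ ⟨hs.1.le, hs.2.le⟩]
    simp only [w, h2] at h1
    linarith [hs.1]
  -- The factor `2` makes the inequality strict: at times `s ≥ 2 u₀ f > u₀ f`, cut off at `1`, one
  -- has `ρ₂ > 0`, so `ρ₁` is an identity.
  refine ⟨⟨⟨fun f => 2 * u₀ f, by fun_prop⟩,
    ⟨fun p => ρ₁ (p.1, Set.projIcc 0 1 zero_le_one p.2),
      hρ₁.comp (continuous_fst.prodMk (continuous_projIcc.comp continuous_snd))⟩,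
    fun f => by simpa using hnn f, fun f => ⟨fun h => by simp [hid f h], fun h => hid' f ?_⟩, ?_, ?_, ?_⟩,
    ?_, ?_, ?_⟩
  · simpa using h
  · intro f
    simp only [ContinuousMap.coe_mk, Set.projIcc_left]
    exact h10 f
  · intro f hf s
    exact h1i f hf _
  · intro f s h1 h2
    simp only [ContinuousMap.coe_mk] at h1 h2
    rcases (hnn f).eq_or_lt with h0 | h0
    · have := hid' f h0.symm
      simp only [ContinuousMap.coe_mk]
      rwa [h1i f this]
    · refine hρ _ _ (ne_of_gt ?_)
      have h3 := hle f (Set.projIcc 0 1 zero_le_one s)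
      have h4 : 2 * u₀ f ≤ ((Set.projIcc (0 : ℝ) 1 zero_le_one s : unitInterval) : ℝ) := by
        rw [Set.coe_projIcc]
        exact le_max_of_le_right (le_min h1.le h2)
      simp only [w] at h3
      linarith
  · intro f s
    exact congrArg Prod.fst (hH f (Set.projIcc 0 1 zero_le_one s))
  · intro f s
    exact congrArg Prod.snd (hH f (Set.projIcc 0 1 zero_le_one s))
  · intro f s hs
    simp only [ContinuousMap.coe_mk, Set.projIcc_of_le_left _ hs]
    exact h10 f

namespace CatWithModule.BarSimplex

variable {P : CatWithModule.{v, u}} {n : ℕ}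

theorem ext_toProd {z w : BarSimplex P n} (h : z.toProd = w.toProd) : z = w := by
  have hpt : z.pt = w.pt := congrArg Prod.snd h
  have harr : ∀ i : Fin n, z.arrow i.castSucc i.succ i.castSucc_le_succ =
      w.arrow i.castSucc i.succ i.castSucc_le_succ := fun i => congrFun (congrArg Prod.fst h) i
  have hobj : ∀ i, z.chain.obj i = w.chain.obj i := by
    intro i
    induction i using Fin.cases with
    | zero => rw [z.eq, w.eq, hpt]
    | succ i => exact congrArg Mor.target (harr i)
  refine ext' (ComposableArrows.ext hobj fun i hi => ?_) hpt
  exact Mor.eq_eqToHom_comp (harr ⟨i, hi⟩) _ _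

/-- Replacing members of the chain by earlier ones along identities changes no arrow: each square
has identities on two opposite sides. -/
theorem pull_eq_self (z : BarSimplex P n) (e : Fin (n + 1) →o Fin (n + 1)) (he : ∀ j, e j ≤ j)
    (h : ∀ j, z.arrow (e j) j (he j) ∈ Mor.identities _) : pull e z = z := by
  refine ext_toProd (Prod.ext (funext fun i => ?_) ?_)
  · refine Mor.mk_eq_of_comp_eq (f := z.chain.map (homOfLE (e.monotone i.castSucc_le_succ))) ?_
      (h i.succ) (h i.castSucc)
    rw [← Functor.map_comp, ← Functor.map_comp]
    rfl
  · exact act_map_self z _ (le_antisymm (he 0) (Fin.zero_le _)) _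

theorem arrow_self_mem (z : BarSimplex P n) (i : Fin (n + 1)) :
    z.arrow i i le_rfl ∈ Mor.identities _ :=
  ⟨z.chain.obj i, congrArg Mor.mk (z.chain.map_id i).symm⟩

/-- A simplex whose `i`-th arrow is an identity is recovered from its face that omits the target of
this arrow. Degenerate simplices are thus described by a condition on arrows, which is closed if the
identities are. -/
theorem range_pull_σ (i : Fin (n + 1)) :
    Set.range (pull (P := P) (SimplexCategory.σ i).toOrderHom) =
      {z : BarSimplex P (n + 1) | z.arrow i.castSucc i.succ i.castSucc_le_succ ∈ Mor.identities _} := by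
  ext z
  constructor
  · rintro ⟨y, rfl⟩
    have h1 : (SimplexCategory.σ i).toOrderHom i.castSucc = i := Fin.predAbove_castSucc_self i
    have h2 : (SimplexCategory.σ i).toOrderHom i.succ = i := Fin.predAbove_succ_self i
    have : ∀ a b (h : a ≤ b), a = i → b = i → y.arrow a b h ∈ Mor.identities _ := by
      rintro a b h rfl rfl
      exact y.arrow_self_mem _
    exact this _ _ ((SimplexCategory.σ i).toOrderHom.monotone i.castSucc_le_succ) h1 h2
  · intro h
    refine ⟨pull (SimplexCategory.δ i.succ).toOrderHom z, ?_⟩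
    rw [← pull_comp]
    have he : ∀ j, ((SimplexCategory.δ i.succ).toOrderHom.comp (SimplexCategory.σ i).toOrderHom) j =
        if j = i.succ then i.castSucc else j := by
      intro j
      change i.succ.succAbove (i.predAbove j) = _
      split_ifs with hj
      · rw [hj, Fin.predAbove_succ_self, Fin.succAbove_succ_self]
      · exact Fin.succ_succAbove_predAbove hj
    refine pull_eq_self z _ ?_ ?_
    · intro j
      rw [he]
      split_ifs with hj
      · rw [hj]
        exact i.castSucc_le_succ
      · exact le_rfl
    · intro j
      have : ∀ a (ha : a ≤ j), (a = if j = i.succ then i.castSucc else j) →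
          z.arrow a j ha ∈ Mor.identities _ := by
        intro a ha h'
        split_ifs at h' with hj
        · subst h' hj
          exact h
        · subst h'
          exact arrow_self_mem _ _
      exact this _ _ (he j)

end CatWithModule.BarSimplex

namespace CatWithModule.BarSimplex

variable {P : CatWithModule.{u, u}} {n : ℕ}

/-- Replacement of the arrows of a chain by arrows with the same sources and targets. -/
noncomputable def replace (g : Mor P.A.ob → Mor P.A.ob) (hs : ∀ f, (g f).source = f.source)
    (ht : ∀ f, (g f).target = f.target) (z : BarSimplex P n) : BarSimplex P n where
  chain := ComposableArrows.mkOfObjOfMapSucc z.chain.obj fun i =>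
    eqToHom (hs (z.arrow i.castSucc i.succ i.castSucc_le_succ)).symm ≫
      (g (z.arrow i.castSucc i.succ i.castSucc_le_succ)).hom ≫
        eqToHom (ht (z.arrow i.castSucc i.succ i.castSucc_le_succ))
  pt := z.pt
  eq := z.eq

theorem arrow_replace (g : Mor P.A.ob → Mor P.A.ob) (hs : ∀ f, (g f).source = f.source)
    (ht : ∀ f, (g f).target = f.target) (z : BarSimplex P n) (i : Fin n) :
    (replace g hs ht z).arrow i.castSucc i.succ i.castSucc_le_succ =
      g (z.arrow i.castSucc i.succ i.castSucc_le_succ) :=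
  (congrArg Mor.mk (ComposableArrows.mkOfObjOfMapSucc_map_succ z.chain.obj (fun i =>
    eqToHom (hs (z.arrow i.castSucc i.succ i.castSucc_le_succ)).symm ≫
      (g (z.arrow i.castSucc i.succ i.castSucc_le_succ)).hom ≫
        eqToHom (ht (z.arrow i.castSucc i.succ i.castSucc_le_succ))) i.1 i.2)).trans
    (Mor.mk_eqToHom_comp _ _ _)

theorem toProd_replace (g : Mor P.A.ob → Mor P.A.ob) (hs : ∀ f, (g f).source = f.source)
    (ht : ∀ f, (g f).target = f.target) (z : BarSimplex P n) :
    (replace g hs ht z).toProd =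
      (fun i => g (z.arrow i.castSucc i.succ i.castSucc_le_succ), z.pt) :=
  Prod.ext (funext fun i => arrow_replace g hs ht z i) rfl

/-- The simplices with an identity form an NDR of the space of simplices. -/
theorem exists_ndr (hA : P.A.IdentityIsCofibration) (n : ℕ) :
    Nonempty (NDR (BarSimplex P n)
      {z | ∃ i : Fin n, z.arrow i.castSucc i.succ i.castSucc_le_succ ∈ Mor.identities _}) := by
  obtain ⟨N, hs, ht, h0⟩ := hA.exists_ndr
  -- The extra value `1` bounds the minimum when there are no arrows; for `n = 0` nothing is
  -- degenerate and `w = 1`.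
  let a : BarSimplex P n → Option (Fin n) → ℝ := fun z i => match i with
    | none => 1
    | some i => N.u (z.arrow i.castSucc i.succ i.castSucc_le_succ)
  have ha : ∀ i, Continuous fun z => a z i := by
    rintro (_ | i)
    · exact continuous_const
    · exact N.u.continuous.comp (continuous_spine i)
  have hne : (Finset.univ : Finset (Option (Fin n))).Nonempty := ⟨none, Finset.mem_univ _⟩
  let w : BarSimplex P n → ℝ := fun z => Finset.univ.inf' hne (a z)
  have hw : Continuous w := Continuous.finset_inf'_apply hne fun i _ => ha i
  have hnn : ∀ z, 0 ≤ w z := by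
    refine fun z => Finset.le_inf' _ _ ?_
    rintro (_ | i) -
    · exact zero_le_one
    · exact N.u_nonneg _
  have hle : ∀ z i, w z ≤ a z i := fun z i => Finset.inf'_le _ (Finset.mem_univ i)
  have hex : ∀ z, w z < 1 → ∃ i : Fin n, N.u (z.arrow i.castSucc i.succ i.castSucc_le_succ) = w z := by
    intro z hz
    obtain ⟨i, -, hi⟩ := Finset.exists_mem_eq_inf' hne (a z)
    rcases i with _ | i
    · exact absurd hi hz.ne
    · exact ⟨i, hi.symm⟩
  -- All arrows are deformed for the time `min s w`. The arrow at which the minimum `w < 1` is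
  -- attained becomes an identity at time `w`, and nothing moves if there is an identity already,
  -- since then `w = 0`.
  let h : BarSimplex P n × ℝ → BarSimplex P n := fun p =>
    replace (fun f => N.h (f, min p.2 (w p.1))) (fun f => hs f _) (fun f => ht f _) p.1
  have hh : Continuous h := by
    refine continuous_induced_rng.2 ?_
    have : (toProd ∘ h) = fun p : BarSimplex P n × ℝ =>
        (fun i => N.h (p.1.arrow i.castSucc i.succ i.castSucc_le_succ, min p.2 (w p.1)), p.1.pt) :=
      funext fun p => toProd_replace _ _ _ _
    rw [this]
    refine Continuous.prodMk (continuous_pi fun i => N.h.continuous.comp ?_)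
      (continuous_pt.comp continuous_fst)
    exact ((continuous_spine i).comp continuous_fst).prodMk
      (continuous_snd.min (hw.comp continuous_fst))
  have hfix : ∀ z s, min s (w z) ≤ 0 → h (z, s) = z := by
    intro z s hsz
    refine ext_toProd ((toProd_replace _ _ _ _).trans (Prod.ext (funext fun i => ?_) rfl))
    exact h0 _ _ hsz
  have hmem : ∀ z, (∃ i : Fin n, z.arrow i.castSucc i.succ i.castSucc_le_succ ∈ Mor.identities _) ↔
      w z = 0 := by
    intro z
    constructor
    · rintro ⟨i, hi⟩
      exact le_antisymm ((hle z (some i)).trans ((N.mem_iff _).1 hi).le) (hnn z)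
    · intro hz
      obtain ⟨i, hi⟩ := hex z (by rw [hz]; exact zero_lt_one)
      exact ⟨i, (N.mem_iff _).2 (hi.trans hz)⟩
  refine ⟨⟨⟨w, hw⟩, ⟨h, hh⟩, hnn, hmem, fun z => hfix z 0 (min_le_left _ _), ?_, ?_⟩⟩
  · intro z hz s
    exact hfix z s ((min_le_right _ _).trans ((hmem z).1 hz).le)
  · intro z s h1 h2
    obtain ⟨i, hi⟩ := hex z h1
    refine ⟨i, ?_⟩
    change (replace _ _ _ z).arrow _ _ _ ∈ _
    rw [arrow_replace]
    refine N.h_mem _ _ (hi.trans_lt h1) ?_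
    rw [hi]
    exact le_min h2 le_rfl

end CatWithModule.BarSimplex

namespace SimplicialSpace

open CatWithModule

theorem closedDegeneracies_bar {P : CatWithModule.{u, u}} (hA : P.A.IdentityIsCofibration) :
    ClosedDegeneracies (bar.obj P) := by
  intro n i
  have hcl : IsClosed (Mor.identities P.A.ob) := hA.isClosed_range
  have h := hcl.preimage (BarSimplex.continuous_spine (P := P) (n := n + 1) i)
  exact (BarSimplex.range_pull_σ (P := P) i).symm ▸ h

theorem degenerate_bar (P : CatWithModule.{u, u}) (n : SimplexCategory) :
    degenerate (bar.obj P) n = {z : BarSimplex P n.len |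
      ∃ i : Fin n.len, z.arrow i.castSucc i.succ i.castSucc_le_succ ∈ Mor.identities _} := by
  induction n using SimplexCategory.rec with
  | _ n =>
    cases n with
    | zero =>
      ext z
      constructor
      · rintro ⟨l, hl, -⟩
        exact absurd hl (Nat.not_lt_zero _)
      · rintro ⟨i, -⟩
        exact i.elim0
    | succ n =>
      ext z
      constructor
      · rintro ⟨l, hl, f, x, rfl⟩
        let K : SSet.{u} := bar.obj P ⋙ CategoryTheory.forget TopCat.{u}
        have h1 : ((bar.obj P).map f.op x : K.obj _) ∈ K.degenerate (n + 1) := ⟨l.len, hl, f, x, rfl⟩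
        rw [SSet.degenerate_eq_iUnion_range_σ] at h1
        obtain ⟨i, hi⟩ := Set.mem_iUnion.1 h1
        exact ⟨i, (Set.ext_iff.1 (BarSimplex.range_pull_σ (P := P) i) _).1 hi⟩
      · rintro ⟨i, hi⟩
        obtain ⟨y, hy⟩ := (Set.ext_iff.1 (BarSimplex.range_pull_σ (P := P) i) _).2 hi
        exact ⟨SimplexCategory.mk n, Nat.lt_succ_self n, SimplexCategory.σ i, y, hy⟩

theorem exists_ndr_bar {P : CatWithModule.{u, u}} (hA : P.A.IdentityIsCofibration)
    (n : SimplexCategory) : Nonempty (NDR ((bar.obj P).obj (op n)) (degenerate (bar.obj P) n)) := by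
  rw [degenerate_bar]
  exact BarSimplex.exists_ndr hA n.len

/-- The product of a simplicial space with a space. -/
def prodConst (Y : SimplicialObject TopCat.{u}) (J : Type) [TopologicalSpace J] :
    SimplicialObject TopCat.{u} where
  obj n := TopCat.of (Y.obj n × J)
  map θ := TopCat.ofHom ⟨fun p => (Y.map θ p.1, p.2),
    ((Y.map θ).hom.continuous.comp continuous_fst).prodMk continuous_snd⟩
  map_id n := by
    refine TopCat.hom_ext (ContinuousMap.ext fun p => Prod.ext ?_ rfl)
    change Y.map (𝟙 n) p.1 = p.1
    simp
  map_comp f g := by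
    refine TopCat.hom_ext (ContinuousMap.ext fun p => Prod.ext ?_ rfl)
    change Y.map (f ≫ g) p.1 = Y.map g (Y.map f p.1)
    simp

theorem degenerate_prodConst (Y : SimplicialObject TopCat.{u}) (J : Type) [TopologicalSpace J]
    (n : SimplexCategory) (p : Y.obj (op n) × J) :
    p ∈ degenerate (prodConst Y J) n ↔ p.1 ∈ degenerate Y n := by
  constructor
  · rintro ⟨l, hl, f, x, rfl⟩
    exact ⟨l, hl, f, x.1, rfl⟩
  · rintro ⟨l, hl, f, x, hx⟩
    exact ⟨l, hl, f, (x, p.2), Prod.ext hx rfl⟩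

theorem ClosedDegeneracies.prodConst {Y : SimplicialObject TopCat.{u}} (hY : ClosedDegeneracies Y)
    (J : Type) [TopologicalSpace J] : ClosedDegeneracies (prodConst Y J) := by
  intro n i
  have h : IsClosed {p : Y.obj _ × J | p.1 ∈ Set.range (Y.map (SimplexCategory.σ i).op)} :=
    (hY n i).preimage continuous_fst
  refine Eq.mpr (congrArg IsClosed (Set.ext fun p => ?_)) h
  constructor
  · rintro ⟨x, rfl⟩
    exact ⟨x.1, rfl⟩
  · rintro ⟨x, hx⟩
    exact ⟨(x, p.2), Prod.ext hx rfl⟩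

end SimplicialSpace

/-! ### Products of NDR pairs, and the end points of the interval. -/

/-- The product of NDR pairs. -/
theorem NDR.exists_prod {X : Type u} {J : Type} [TopologicalSpace X] [TopologicalSpace J] {L : Set X}
    {J₀ : Set J} (N : NDR X L) (M : NDR J J₀) : Nonempty (NDR (X × J) {p | p.2 ∈ J₀ ∨ p.1 ∈ L}) := by
  let w : X × J → ℝ := fun p => min (N.u p.1) (M.u p.2)
  have hw : Continuous w := (N.u.continuous.comp continuous_fst).min (M.u.continuous.comp continuous_snd)
  have hnn : ∀ p, 0 ≤ w p := fun p => le_min (N.u_nonneg _) (M.u_nonneg _)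
  -- Stopping at time `w` keeps both factors fixed if either of them is in its subset. The maximum
  -- with `0` is needed because nothing is known about negative times.
  let τ : (X × J) × ℝ → ℝ := fun q => max 0 (min q.2 (w q.1))
  have hτ : Continuous τ := continuous_const.max (continuous_snd.min (hw.comp continuous_fst))
  have hτ0 : ∀ p s, min s (w p) ≤ 0 → τ (p, s) = 0 := fun p s h => max_eq_left h
  have hmem : ∀ p : X × J, (p.2 ∈ J₀ ∨ p.1 ∈ L) ↔ w p = 0 := by
    intro p
    rw [M.mem_iff, N.mem_iff]
    have h1 := N.u_nonneg p.1
    have h2 := M.u_nonneg p.2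
    constructor
    · rintro (h | h)
      · exact (congrArg _ h).trans (min_eq_right h1)
      · exact (congrArg (min · _) h).trans (min_eq_left h2)
    · intro h
      rcases min_choice (N.u p.1) (M.u p.2) with h' | h'
      · exact Or.inr (h'.symm.trans h)
      · exact Or.inl (h'.symm.trans h)
  have hfix : ∀ p s, min s (w p) ≤ 0 → (N.h (p.1, τ (p, s)), M.h (p.2, τ (p, s))) = p := by
    intro p s h
    rw [hτ0 p s h, N.h_zero, M.h_zero]
  refine ⟨⟨⟨w, hw⟩, ⟨fun q => (N.h (q.1.1, τ q), M.h (q.1.2, τ q)), by fun_prop⟩, hnn, hmem,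
    fun p => hfix p 0 (min_le_left _ _), fun p hp s => hfix p s ((min_le_right _ _).trans ((hmem p).1 hp).le),
    ?_⟩⟩
  intro p s h1 h2
  have ht : τ (p, s) = w p := by
    change max 0 (min s (w p)) = w p
    rw [min_eq_right (show w p ≤ s from h2), max_eq_right (hnn p)]
  change M.h (p.2, τ (p, s)) ∈ J₀ ∨ N.h (p.1, τ (p, s)) ∈ L
  rw [ht]
  rcases min_choice (N.u p.1) (M.u p.2) with h' | h'
  · exact Or.inr (N.h_mem _ _ (h'.symm.trans_lt h1) h'.ge)
  · exact Or.inl (M.h_mem _ _ (h'.symm.trans_lt h1) h'.ge)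

/-- The end points of the unit interval. -/
noncomputable def NDR.unitInterval : NDR unitInterval ({0, 1} : Set unitInterval) where
  -- The deformation stretches the interval about its midpoint by `1 + 2s` and truncates. For `r <
  -- 1/3` and `s ≥ 3r` the point arrives at `0`, since `(1/2 - r)(1 + 6r) = 1/2 + 2r(1 - 3r) ≥ 1/2`.
  u := ⟨fun r => 3 * min (r : ℝ) (1 - r), by fun_prop⟩
  h := ⟨fun p => Set.projIcc 0 1 zero_le_one (1 / 2 + ((p.1 : ℝ) - 1 / 2) * (1 + 2 * max p.2 0)),
    continuous_projIcc.comp (by fun_prop)⟩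
  u_nonneg r := mul_nonneg (by norm_num) (le_min r.2.1 (sub_nonneg.2 r.2.2))
  mem_iff r := by
    have h1 := r.2.1
    have h2 := r.2.2
    simp only [Set.mem_insert_iff, Set.mem_singleton_iff, ContinuousMap.coe_mk]
    constructor
    · rintro (rfl | rfl) <;> simp
    · intro h
      rcases min_choice (r : ℝ) (1 - r) with h' | h' <;> rw [h'] at h
      · exact Or.inl (Subtype.ext (by simpa using h))
      · exact Or.inr (Subtype.ext (by
          change (r : ℝ) = 1
          linarith))
  h_zero r := by
    simp only [ContinuousMap.coe_mk, max_self, mul_zero, add_zero, mul_one, add_sub_cancel]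
    exact Set.projIcc_val zero_le_one r
  h_of_mem r hr s := by
    have hs : 0 ≤ max s 0 := le_max_right _ _
    simp only [ContinuousMap.coe_mk]
    rcases hr with rfl | rfl
    · refine (Set.projIcc_of_le_left _ ?_).trans rfl
      change 1 / 2 + ((0 : ℝ) - 1 / 2) * (1 + 2 * max s 0) ≤ 0
      linarith
    · refine (Set.projIcc_of_right_le _ ?_).trans rfl
      change 1 ≤ 1 / 2 + ((1 : ℝ) - 1 / 2) * (1 + 2 * max s 0)
      linarith
  h_mem r s h1 h2 := by
    have hr1 := r.2.1
    have hr2 := r.2.2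
    have hs : s ≤ max s 0 := le_max_left _ _
    simp only [ContinuousMap.coe_mk] at h1 h2 ⊢
    rcases le_total (r : ℝ) (1 - r) with h | h
    · rw [min_eq_left h] at h1 h2
      refine Or.inl ((Set.projIcc_of_le_left _ ?_).trans rfl)
      nlinarith
    · rw [min_eq_right h] at h1 h2
      refine Or.inr ((Set.projIcc_of_right_le _ ?_).trans rfl)
      nlinarith

/-! ### The comparison map -/

theorem CategoryTheory.ComposableArrows.ext_mor {C : Type u} [Category.{v} C] {n : ℕ}
    {F G : ComposableArrows C n} (h₀ : F.obj 0 = G.obj 0)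
    (h : ∀ i : Fin n, Mor.mk (F.map (homOfLE i.castSucc_le_succ)) =
      Mor.mk (G.map (homOfLE i.castSucc_le_succ))) : F = G := by
  have hobj : ∀ i, F.obj i = G.obj i := by
    intro i
    induction i using Fin.cases with
    | zero => exact h₀
    | succ i => exact congrArg Mor.target (h i)
  exact ComposableArrows.ext hobj fun i hi => Mor.eq_eqToHom_comp (h ⟨i, hi⟩) _ _

namespace CatWithModule.BarSimplex

section

variable {D : Type u} [Category.{v} D] {F : D ⥤ TopCat.{u}} {n : ℕ}

/-- A functor to spaces as a discrete topological category with a module. -/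
def discreteModule (F : D ⥤ TopCat.{u}) : CatWithModule.{v, u} :=
  ⟨TopologicalCategory.discrete D, LeftModule.ofFunctor F⟩

/-- The simplex given by a chain in a discrete category and a point over its first member. -/
def ofChain (c : ComposableArrows D n) (y : F.obj (c.obj 0)) :
    BarSimplex (discreteModule F) n :=
  ⟨c, ⟨c.obj 0, y⟩, rfl⟩

theorem exists_ofChain (z : BarSimplex (discreteModule F) n) :
    ∃ (c : ComposableArrows D n) (y : F.obj (c.obj 0)), z = ofChain c y := by
  obtain ⟨c, ⟨d, y⟩, h⟩ := z
  change c.obj 0 = d at h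
  subst h
  exact ⟨c, y, rfl⟩

theorem continuous_ofChain (c : ComposableArrows D n) : Continuous (ofChain (F := F) c) := by
  have h1 : Continuous fun _ : F.obj (c.obj 0) => fun i : Fin n =>
      (Mor.mk (c.map (homOfLE i.castSucc_le_succ)) : (discreteModule F).A.mor) := continuous_const
  have h2 : Continuous fun y : F.obj (c.obj 0) => (⟨c.obj 0, y⟩ : (discreteModule F).X.space) :=
    continuous_sigmaMk (σ := fun d => F.obj d)
  exact continuous_induced_rng.2 (h1.prodMk h2)

/-- Over a discrete category the chain is locally constant, so the space of simplices is the
disjoint union of the values `F (c.obj 0)` over all chains `c`. -/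
theorem isOpenEmbedding_ofChain (c : ComposableArrows D n) :
    Topology.IsOpenEmbedding (ofChain (F := F) c) := by
  have hs : Topology.IsEmbedding ((fun z => z.pt) ∘ ofChain (F := F) c) :=
    Topology.IsEmbedding.sigmaMk (σ := fun d => F.obj d)
  refine ⟨.of_comp (continuous_ofChain c) continuous_pt hs, ?_⟩
  have : Set.range (ofChain (F := F) c) = toProd ⁻¹' (({fun i : Fin n =>
      (Mor.mk (c.map (homOfLE i.castSucc_le_succ)))} : Set (Fin n → (discreteModule F).A.mor)) ×ˢ
        (Sigma.fst ⁻¹' {c.obj 0} : Set (Σ d, F.obj d))) := by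
    ext z
    constructor
    · rintro ⟨y, rfl⟩
      exact ⟨rfl, rfl⟩
    · rintro ⟨h1, h2⟩
      obtain ⟨c', y, rfl⟩ := exists_ofChain z
      obtain rfl : c' = c := ComposableArrows.ext_mor h2 fun i => congrFun h1 i
      exact ⟨y, rfl⟩
  rw [this]
  refine IsOpen.preimage continuous_toProd (IsOpen.prod ?_ ?_)
  · have : DiscreteTopology (discreteModule F).A.mor := ⟨rfl⟩
    exact isOpen_discrete _
  · let _ : TopologicalSpace D := ⊥
    have : DiscreteTopology D := ⟨rfl⟩
    exact (isOpen_discrete (α := D) _).preimage (LeftModule.continuous_fst_discrete F)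

/-- Continuity can be tested chain by chain. The factor `T` makes room for the coordinates in `Δⁿ`.
-/
theorem continuous_of_ofChain {T W : Type*} [TopologicalSpace T] [TopologicalSpace W]
    {g : BarSimplex (discreteModule F) n × T → W}
    (h : ∀ c : ComposableArrows D n,
      Continuous fun p : F.obj (c.obj 0) × T => g (ofChain c p.1, p.2)) : Continuous g := by
  rw [continuous_iff_continuousAt]
  rintro ⟨z, t⟩
  obtain ⟨c, y, rfl⟩ := exists_ofChain z
  have := (isOpenEmbedding_ofChain (F := F) c).prodMap (.id (X := T))
  exact (this.continuousAt_iff (x := (y, t))).1 (h c).continuousAt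

end

end CatWithModule.BarSimplex

namespace ModuleOverDiscrete

open CatWithModule

section

variable {C : Type u} [SmallCategory C] {n : ℕ}

/-- The map `[kᵢ] → [k₀]` underlying a morphism of simplices. -/
def face {σ τ : SimplexOver C} (f : σ ⟶ τ) : τ.1.unop ⟶ σ.1.unop := f.1.unop

theorem face_comp {σ τ υ : SimplexOver C} (f : σ ⟶ τ) (g : τ ⟶ υ) :
    face (f ≫ g) = face g ≫ face f := rfl

/-- The first vertices of the members of a chain of simplices. -/
def lead (c : ComposableArrows (SimplexOver C) n) :
    Fin (n + 1) →o Fin ((c.obj 0).1.unop.len + 1) where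
  toFun i := (face (c.map (homOfLE (Fin.zero_le i)))).toOrderHom 0
  monotone' i j h := by
    have : c.map (homOfLE (Fin.zero_le j)) = c.map (homOfLE (Fin.zero_le i)) ≫ c.map (homOfLE h) := by
      rw [← Functor.map_comp]
      rfl
    change _ ≤ (face (c.map (homOfLE (Fin.zero_le j)))).toOrderHom 0
    rw [this, face_comp]
    exact (face (c.map (homOfLE (Fin.zero_le i)))).toOrderHom.monotone (Fin.zero_le _)

end

variable (D : ModuleOverDiscrete.{u})

/-- The point of the first member of a chain. -/
def fibrePt {n : ℕ} (z : BarSimplex (simplexModule.obj D) n) : D.Fibre (z.chain.obj 0) :=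
  cast (congrArg D.Fibre z.eq.symm) z.pt.2

/-- The map of bar constructions in a single degree. -/
def compareApp {n : ℕ} (z : BarSimplex (simplexModule.obj D) n) : BarSimplex D.toCatWithModule n :=
  BarSimplex.pull (lead z.chain) (D.fibrePt z).1

theorem compareApp_ofChain {n : ℕ} (c : ComposableArrows (SimplexOver D.C) n)
    (y : D.Fibre (c.obj 0)) :
    D.compareApp (BarSimplex.ofChain (F := D.pushforward) c y) = BarSimplex.pull (lead c) y.1 := rfl

theorem continuous_compareApp (n : ℕ) : Continuous (D.compareApp (n := n)) := by
  have : Continuous fun p : BarSimplex (simplexModule.obj D) n × Unit => D.compareApp p.1 :=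
    BarSimplex.continuous_of_ofChain (F := D.pushforward) fun c =>
      (BarSimplex.continuous_pull (lead c)).comp
        ((continuous_subtype_val (p := fun z : BarSimplex D.toCatWithModule _ => z.chain ⋙ D.ρ.functor = (c.obj 0).2)).comp
          (continuous_fst (X := D.Fibre (c.obj 0)) (Y := Unit)))
  exact this.comp (continuous_id.prodMk (continuous_const (y := ())))

theorem pull_ofChain {m n : ℕ} (θ : Fin (m + 1) →o Fin (n + 1))
    (c : ComposableArrows (SimplexOver D.C) n) (y : D.Fibre (c.obj 0)) :
    BarSimplex.pull θ (BarSimplex.ofChain (F := D.pushforward) c y) =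
      BarSimplex.ofChain (F := D.pushforward) (θ.monotone.functor ⋙ c : ComposableArrows _ m)
        (D.pushforward.map (c.map (homOfLE (Fin.zero_le (θ 0)))) y) := by
  refine BarSimplex.ext' rfl ?_
  change (⟨_, D.pushforward.map (eqToHom rfl ≫ c.map _) y⟩ : Σ d, D.pushforward.obj d) = ⟨_, _⟩
  rw [eqToHom_refl, Category.id_comp]
  rfl

theorem compareApp_pull {m n : ℕ} (θ : Fin (m + 1) →o Fin (n + 1))
    (z : BarSimplex (simplexModule.obj D) n) :
    D.compareApp (BarSimplex.pull θ z) = BarSimplex.pull θ (D.compareApp z) := by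
  obtain ⟨c, y, rfl⟩ := BarSimplex.exists_ofChain (F := D.pushforward) z
  refine (congrArg D.compareApp (D.pull_ofChain θ c y)).trans ?_
  rw [compareApp_ofChain D c y, ← BarSimplex.pull_comp]
  refine (BarSimplex.pull_comp _ _ _).symm.trans (congrArg (fun e => BarSimplex.pull e y.1) ?_)
  -- The first vertex of the member `θ i`, viewed in the member `0`, can be computed through the
  -- member `θ 0`.
  refine OrderHom.ext _ _ (funext fun i => ?_)
  have : c.map (homOfLE (Fin.zero_le (θ i))) = c.map (homOfLE (Fin.zero_le (θ 0))) ≫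
      c.map (homOfLE (θ.monotone (Fin.zero_le i))) := by
    rw [← Functor.map_comp]
    rfl
  change _ = (face (c.map (homOfLE (Fin.zero_le (θ i))))).toOrderHom 0
  rw [this, face_comp]
  rfl

/-- The map of bar constructions `B(*, Δ ↓ C, ρ_* X) → B(*, A, X)`. -/
def compare : simplexModule.{u} ⋙ bar.{0, u} ⟶ forget.{u} ⋙ bar.{u, u} where
  app D :=
    { app n := TopCat.ofHom ⟨D.compareApp, D.continuous_compareApp n.unop.len⟩
      naturality m n θ := by
        ext z
        exact D.compareApp_pull θ.unop.toOrderHom z }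
  naturality D E f := by
    ext n z
    obtain ⟨c, y, rfl⟩ := BarSimplex.exists_ofChain (F := D.pushforward) z
    exact (BarSimplex.push_pull f.hom (lead c) y.1).symm

end ModuleOverDiscrete

/-! ### Maps out of realizations -/

namespace SimplicialSpace

/-- The map `Y_k × Δ^k → |Y|`. -/
def incl (Y : SimplicialObject TopCat.{u}) (k : SimplexCategory) :
    C(Y.obj (op k) × stdSimplex ℝ (Fin (k.len + 1)), realization.obj Y) :=
  ⟨fun p => Quot.mk _ ⟨k, p⟩, continuous_quot_mk.comp continuous_sigmaMk⟩

theorem incl_map (Y : SimplicialObject TopCat.{u}) {k l : SimplexCategory} (θ : k ⟶ l)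
    (y : Y.obj (op l)) (t : stdSimplex ℝ (Fin (k.len + 1))) :
    incl Y k (Y.map θ.op y, t) = incl Y l (y, affineMap θ t) :=
  Quot.sound (Rel.intro θ y t)

/-- A map out of the realization, from its restrictions. -/
def desc (Y : SimplicialObject TopCat.{u}) {Z : Type u} [TopologicalSpace Z]
    (g : ∀ k : SimplexCategory, C(Y.obj (op k) × stdSimplex ℝ (Fin (k.len + 1)), Z))
    (hg : ∀ {k l : SimplexCategory} (θ : k ⟶ l) y t,
      g k (Y.map θ.op y, t) = g l (y, affineMap θ t)) : C(realization.obj Y, Z) :=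
  ⟨Quot.lift (fun w => g w.1 w.2) (by rintro _ _ ⟨θ, y, t⟩; exact hg θ y t),
    continuous_quot_lift _ (continuous_sigma fun k => (g k).continuous)⟩

theorem exists_incl (Y : SimplicialObject TopCat.{u}) (x : realization.obj Y) :
    ∃ k p, x = incl Y k p := by
  obtain ⟨⟨k, p⟩, rfl⟩ := Quot.exists_rep x
  exact ⟨k, p, rfl⟩

end SimplicialSpace

/-! ### Families on the cylinder and maps out of the realization of `Y`. -/

namespace Coll

variable {k l d : SimplexCategory}

/-- The first vertex of a face, and the index of a point. -/
def index : Coll.{u} k → Fin (k.len + 1)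
  | face φ => φ.first
  | pt i => i

theorem index_le {x y : Coll.{u} k} (f : x ⟶ y) : index x ≤ index y := by
  rcases x with φ | i <;> rcases y with ψ | j
  · exact FaceCat.first_le f
  · exact f.down
  · exact PEmpty.elim f
  · exact f.down

theorem index_push (α : k ⟶ l) (x : Coll.{u} k) : index ((push α).obj x) = α.toOrderHom (index x) := by
  rcases x with φ | i <;> rfl

/-- The indices of the members of a chain. -/
def indexHom {d : SimplexCategoryᵒᵖ} (m : (cylinder.{u}.functor.obj k).obj d) : d.unop ⟶ k :=
  SimplexCategory.Hom.mk
    ⟨fun i => index (m.1.obj i), fun _ _ h => index_le (m.1.map (homOfLE h))⟩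

theorem indexHom_map {d d' : SimplexCategoryᵒᵖ} (θ : d ⟶ d')
    (m : (cylinder.{u}.functor.obj k).obj d) :
    indexHom ((cylinder.functor.obj k).map θ m) = θ.unop ≫ indexHom m := rfl

theorem indexHom_push (α : k ⟶ l) {d : SimplexCategoryᵒᵖ}
    (m : (cylinder.{u}.functor.obj k).obj d) :
    indexHom ((cylinder.functor.map α).app d m) = indexHom m ≫ α := by
  ext i : 3
  exact index_push α _

/-- The chain of points given by a map `[d] → [k]`. -/
def ptChain (a : d ⟶ k) : (cylinder.{u}.functor.obj k).obj (op d) :=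
  ⟨{ obj i := pt (a.toOrderHom i)
     map f := ⟨a.toOrderHom.monotone (leOfHom f)⟩
     map_id _ := Subsingleton.elim _ _
     map_comp _ _ := Subsingleton.elim _ _ }, fun _ _ h _ => absurd trivial h⟩

/-- This identifies `pts` with the standard simplex: morphisms to points are unique, so a chain of
points is the sequence of its indices. -/
theorem eq_ptChain {d : SimplexCategoryᵒᵖ} (m : (cylinder.{u}.functor.obj k).obj d)
    (hm : m ∈ (marking k).pts.obj d) : m = ptChain (indexHom m) := by
  have hobj : ∀ i, m.1.obj i = pt (index (m.1.obj i)) := by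
    intro i
    have key : ∀ x : Coll.{u} k, (marking k).isPt x → x = pt (index x) := by
      rintro (φ | j) h
      · exact False.elim h
      · rfl
    exact key _ (hm i)
  refine Subtype.ext (CategoryTheory.Functor.hext hobj fun i j f => ?_)
  have : ∀ {x y : Coll.{u} k} (g : x ⟶ y) (i j) (g' : (pt i : Coll.{u} k) ⟶ pt j), x = pt i → y = pt j →
      HEq g g' := by
    rintro _ _ g i j g' rfl rfl
    exact heq_of_eq (Subsingleton.elim _ _)
  exact this _ _ _ _ (hobj i) (hobj j)

theorem map_ptChain {d' : SimplexCategory} (θ : d' ⟶ d) (a : d ⟶ k) :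
    (cylinder.functor.obj k).map θ.op (ptChain.{u} a) = ptChain (θ ≫ a) :=
  eq_ptChain _ fun _ => trivial

theorem push_ptChain (α : k ⟶ l) (a : d ⟶ k) :
    (cylinder.functor.map α).app (op d) (ptChain.{u} a) = ptChain (a ≫ α) :=
  eq_ptChain _ fun _ => trivial

open SimplicialSpace

variable {Y : SimplicialObject TopCat.{u}} {Z : Type u} [TopologicalSpace Z]

/-- The map out of the realization given by the restriction of a natural family to points. -/
noncomputable def descPts (G : cylinder.functor ⟶ sing Y Z) : C(realization.obj Y, Z) :=
  desc Y (fun k => Sing.val ((G.app k).app (op k) (ptChain (𝟙 k)))) fun {k l} θ y t => by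
    have h1 : (G.app l).app (op k) ((cylinder.functor.map θ).app (op k) (ptChain (𝟙 k))) =
      ((sing Y Z).map θ).app (op k) ((G.app k).app (op k) (ptChain (𝟙 k))) :=
      congrArg (fun q => q.app (op k) (ptChain (𝟙 k))) (G.naturality θ)
    have h2 := Sing.val_app_map (G.app l) θ.op (ptChain (𝟙 l)) y t
    rw [push_ptChain, Category.id_comp] at h1
    rw [map_ptChain, Category.comp_id] at h2
    exact (congrArg (fun s => Sing.val s (y, t)) h1).symm.trans h2

theorem descPts_incl (G : cylinder.functor ⟶ sing Y Z) (k : SimplexCategory) (p) :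
    descPts G (incl Y k p) = Sing.val ((G.app k).app (op k) (ptChain (𝟙 k))) p := rfl

/-- By the Yoneda lemma, a family on the points is determined by the tautological simplices `ptChain
(𝟙 k)`. Thus `G` agrees on `pts` with `familyOfMap (descPts G)`. -/
theorem val_of_mem_pts (G : cylinder.functor ⟶ sing Y Z) {d : SimplexCategoryᵒᵖ}
    (m : (cylinder.functor.obj k).obj d) (hm : m ∈ (marking k).pts.obj d) (y) (t) :
    Sing.val ((G.app k).app d m) (y, t) =
      descPts G (incl Y k (y, affineMap (indexHom m) t)) := by
  rw [descPts_incl]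
  refine Eq.trans ?_ (Sing.val_app_map (G.app k) (indexHom m).op (ptChain (𝟙 k)) y t)
  rw [map_ptChain, Category.comp_id, ← eq_ptChain m hm]
  rfl

/-- The natural family given by a map out of the realization. -/
noncomputable def familyOfMap (g : C(realization.obj Y, Z)) : cylinder.functor ⟶ sing Y Z where
  app k := SSet.homMk (fun d m => Sing.mk (g.comp ((incl Y k).comp
      ((ContinuousMap.id _).prodMap (affineMap (indexHom m)))))) (by
    intro d d' θ m
    refine Sing.ext fun y t => ?_
    change g (incl Y k (y, affineMap (indexHom _) t)) =
      g (incl Y k (y, affineMap (indexHom m) (affineMap θ.unop t)))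
    rw [indexHom_map, affineMap_comp]
    rfl)
  naturality k l α := by
    refine SSet.hom_ext_apply fun d m => Sing.ext fun y t => ?_
    change g (incl Y l (y, affineMap (indexHom ((cylinder.functor.map α).app d m)) t)) =
      g (incl Y k (Y.map α.op y, affineMap (indexHom m) t))
    rw [indexHom_push, affineMap_comp, incl_map]
    rfl

theorem val_familyOfMap (g : C(realization.obj Y, Z)) {d : SimplexCategoryᵒᵖ}
    (m : (cylinder.functor.obj k).obj d) (y) (t) :
    Sing.val (((familyOfMap g).app k).app d m) (y, t) =
      g (incl Y k (y, affineMap (indexHom m) t)) := rfl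

end Coll

namespace Coll

variable {k l : SimplexCategory}

/-- The face underlying an object which is not a point. -/
def faceOf : ∀ x : Coll.{u} k, ¬ (marking k).isPt x → FaceCat.{u} k
  | face φ, _ => φ
  | pt _, h => absurd trivial h

/-- The morphism of faces underlying a morphism. -/
def faceHom : ∀ {x y : Coll.{u} k} (hx : ¬ (marking k).isPt x) (hy : ¬ (marking k).isPt y),
    (x ⟶ y) → (faceOf x hx ⟶ faceOf y hy)
  | face _, face _, _, _, f => f
  | pt _, _, h, _, _ => absurd trivial h
  | face _, pt _, _, h, _ => absurd trivial h

theorem faceHom_id {x : Coll.{u} k} (hx : ¬ (marking k).isPt x) : faceHom hx hx (𝟙 x) = 𝟙 _ := by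
  rcases x with φ | i
  · rfl
  · exact absurd trivial hx

theorem faceHom_comp {x y z : Coll.{u} k} (hx : ¬ (marking k).isPt x) (hy : ¬ (marking k).isPt y)
    (hz : ¬ (marking k).isPt z) (f : x ⟶ y) (g : y ⟶ z) :
    faceHom hx hz (f ≫ g) = faceHom hx hy f ≫ faceHom hy hz g := by
  rcases x with φ | i
  · rcases y with ψ | i
    · rcases z with χ | i
      · rfl
      · exact absurd trivial hz
    · exact absurd trivial hy
  · exact absurd trivial hx

/-- The chain of faces underlying a chain without points. -/
def lower {n : ℕ} (c : ComposableArrows (Coll.{u} k) n) (h : ∀ a, ¬ (marking k).isPt (c.obj a)) :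
    ComposableArrows (FaceCat.{u} k) n where
  obj a := faceOf (c.obj a) (h a)
  map f := faceHom (h _) (h _) (c.map f)
  map_id a := by rw [c.map_id, faceHom_id]
  map_comp f g := by rw [c.map_comp, faceHom_comp]

theorem faceOf_push (α : k ⟶ l) (x : Coll.{u} k) (hx : ¬ (marking k).isPt x)
    (hx' : ¬ (marking l).isPt ((push α).obj x)) :
    faceOf ((push α).obj x) hx' = (FaceCat.push α).obj (faceOf x hx) := by
  rcases x with φ | i
  · rfl
  · exact absurd trivial hx

theorem faceHom_push (α : k ⟶ l) {x y : Coll.{u} k} (f : x ⟶ y) (hx : ¬ (marking k).isPt x)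
    (hy : ¬ (marking k).isPt y) (hx' : ¬ (marking l).isPt ((push α).obj x))
    (hy' : ¬ (marking l).isPt ((push α).obj y)) :
    HEq (faceHom hx' hy' ((push α).map f)) ((FaceCat.push α).map (faceHom hx hy f)) := by
  rcases x with φ | i
  · rcases y with ψ | i
    · rfl
    · exact absurd trivial hy
  · exact absurd trivial hx

theorem lower_push (α : k ⟶ l) {n : ℕ} (c : ComposableArrows (Coll.{u} k) n)
    (h : ∀ a, ¬ (marking k).isPt (c.obj a))
    (h' : ∀ a, ¬ (marking l).isPt ((push α).obj (c.obj a))) :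
    lower (c ⋙ push α : ComposableArrows _ n) h' = lower c h ⋙ FaceCat.push α :=
  CategoryTheory.Functor.hext (fun _ => faceOf_push α _ _ _) fun _ _ _ => faceHom_push α _ _ _ _ _

theorem index_eq_first (x : Coll.{u} k) (hx : ¬ (marking k).isPt x) :
    index x = (faceOf x hx).first := by
  rcases x with φ | i
  · rfl
  · exact absurd trivial hx

/-- A chain of faces as a simplex of the cylinder. -/
def incChain {n : ℕ} (c : ComposableArrows (FaceCat.{u} k) n) :
    (cylinder.{u}.functor.obj k).obj (op (SimplexCategory.mk n)) :=
  ⟨(c ⋙ inc k : ComposableArrows _ n), fun _ _ _ h => False.elim h⟩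

theorem incChain_mem {n : ℕ} (c : ComposableArrows (FaceCat.{u} k) n) :
    incChain c ∈ (marking k).base.obj (op (SimplexCategory.mk n)) := fun _ h => False.elim h

end Coll

/-! ### Families on chains of faces and maps out of the homotopy colimit over simplices. -/

namespace ModuleOverDiscrete

open CatWithModule SimplicialSpace

section

variable {C : Type u} [SmallCategory C] {n : ℕ}

theorem hom_heq {K L : SimplexCategoryᵒᵖ} {s s' : (nerve C).obj K} {t t' : (nerve C).obj L}
    (f : K ⟶ L) (hs : s = s') (ht : t = t') (h : (nerve C).map f s = t)
    (h' : (nerve C).map f s' = t') :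
    HEq (CategoryOfElements.homMk (F := nerve C) ⟨K, s⟩ ⟨L, t⟩ f h)
      (CategoryOfElements.homMk (F := nerve C) ⟨K, s'⟩ ⟨L, t'⟩ f h') := by
  subst hs ht
  rfl

/-- The maps `[kᵢ] → [k₀]` underlying a chain of simplices. -/
def toFaceChain (c : ComposableArrows (SimplexOver C) n) :
    ComposableArrows (FaceCat.{u} (c.obj 0).1.unop) n where
  obj i := ⟨face (c.map (homOfLE (Fin.zero_le i)))⟩
  map {i j} f := ⟨face (c.map f), by
    rw [← face_comp, ← Functor.map_comp]
    rfl⟩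
  map_id i := Subtype.ext (by
    change face (c.map (𝟙 i)) = 𝟙 _
    rw [c.map_id]
    rfl)
  map_comp f g := Subtype.ext (by
    change face (c.map (f ≫ g)) = face (c.map g) ≫ face (c.map f)
    rw [c.map_comp, face_comp])

theorem nerve_map_map {k l p : SimplexCategory} (α : k ⟶ l) (β : l ⟶ p) (σ : (nerve C).obj (op p)) :
    (nerve C).map α.op ((nerve C).map β.op σ) = (nerve C).map (α ≫ β).op σ := by
  rw [op_comp, (nerve C).map_comp]
  rfl

/-- The faces of a simplex. -/
def faces {k : SimplexCategory} (σ : (nerve C).obj (op k)) : FaceCat.{u} k ⥤ SimplexOver C where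
  obj φ := ⟨op φ.dom, (nerve C).map φ.map.op σ⟩
  map {φ ψ} f := ⟨f.1.op, by
    rw [nerve_map_map, f.2]⟩

/-- A chain of simplices over `C` carries the same data as its first member together with a chain of
maps into that member. -/
theorem faces_toFaceChain (c : ComposableArrows (SimplexOver C) n) :
    toFaceChain c ⋙ faces (c.obj 0).2 = c := by
  have h : ∀ i, (nerve C).map (face (c.map (homOfLE (Fin.zero_le i)))).op (c.obj 0).2 = (c.obj i).2 :=
    fun i => (c.map (homOfLE (Fin.zero_le i))).2
  refine CategoryTheory.Functor.hext (fun i => Sigma.ext rfl (heq_of_eq (h i))) fun i j f => ?_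
  exact hom_heq (c.map f).1 (h i) (h j) _ (c.map f).2

theorem push_faces {k l : SimplexCategory} (α : k ⟶ l) (σ : (nerve C).obj (op l)) :
    FaceCat.push α ⋙ faces σ = faces ((nerve C).map α.op σ) := by
  have h : ∀ φ : FaceCat.{u} k, (nerve C).map (φ.map ≫ α).op σ =
      (nerve C).map φ.map.op ((nerve C).map α.op σ) := fun φ => (nerve_map_map _ _ _).symm
  refine CategoryTheory.Functor.hext (fun φ => Sigma.ext rfl (heq_of_eq (h φ))) fun φ ψ f => ?_
  exact hom_heq f.1.op (h φ) (h ψ) _ _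

/-- An operator that omits the first member changes the simplex in which the faces are taken.
Pushing the new chain of faces back to the old simplex gives the operator on the old chain, so
restriction to faces respects the relation of the realization. -/
theorem push_incChain {m n : SimplexCategory} (θ : m ⟶ n) (c : ComposableArrows (SimplexOver C) n.len) :
    (Coll.cylinder.functor.map (face (c.map (homOfLE (Fin.zero_le (θ.toOrderHom 0)))))).app (op m)
        (Coll.incChain (toFaceChain (θ.toOrderHom.monotone.functor ⋙ c : ComposableArrows _ m.len))) =
      (Coll.cylinder.functor.obj _).map θ.op (Coll.incChain (toFaceChain c)) := by
  have h : ∀ i, face (c.map (homOfLE (θ.toOrderHom.monotone (Fin.zero_le i)))) ≫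
      face (c.map (homOfLE (Fin.zero_le (θ.toOrderHom 0)))) =
        face (c.map (homOfLE (Fin.zero_le (θ.toOrderHom i)))) := by
    intro i
    rw [← face_comp, ← Functor.map_comp]
    rfl
  refine Subtype.ext (CategoryTheory.Functor.hext
    (fun i => congrArg (fun a => Coll.face (FaceCat.mk a)) (h i)) fun i j f => ?_)
  exact Coll.face_heq ((toFaceChain (θ.toOrderHom.monotone.functor ⋙ c : ComposableArrows _ m.len)).map f)
    (h i) (h j) _ _

end

variable (D : ModuleOverDiscrete.{u})

/-- The image of the chain of a simplex in `C`. -/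
def baseChain {k : SimplexCategory} (y : (bar.obj D.toCatWithModule).obj (op k)) :
    (nerve D.C).obj (op k) :=
  (BarSimplex.chain y ⋙ D.ρ.functor : ComposableArrows D.C k.len)

theorem isOpen_baseChain {k : SimplexCategory} (σ : (nerve D.C).obj (op k)) :
    IsOpen {y | D.baseChain y = σ} := by
  have hσ : {y | D.baseChain y = σ} =
      {y | D.ρ.functor.obj (BarSimplex.chain y |>.obj 0) = σ.obj 0} ∩
      ⋂ i : Fin k.len, {y | D.ρ.functor.mapMor (BarSimplex.arrow y i.castSucc i.succ i.castSucc_le_succ)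
        = Mor.mk (σ.map (homOfLE i.castSucc_le_succ))} := by
    ext y
    constructor
    · rintro rfl
      exact ⟨rfl, Set.mem_iInter.2 fun _ => rfl⟩
    · rintro ⟨h1, h2⟩
      exact ComposableArrows.ext_mor h1 fun i => Set.mem_iInter.1 h2 i
  rw [hσ]
  refine IsOpen.inter ?_ (isOpen_iInter_of_finite fun i => ?_)
  · let _ : TopologicalSpace D.C := ⊥
    have : DiscreteTopology D.C := ⟨rfl⟩
    exact (isOpen_discrete {σ.obj 0}).preimage
      (D.ρ.continuous_obj.comp (BarSimplex.continuous_obj (P := D.toCatWithModule) 0))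
  · let _ : TopologicalSpace (Mor D.C) := ⊥
    have : DiscreteTopology (Mor D.C) := ⟨rfl⟩
    exact (isOpen_discrete {Mor.mk (σ.map (homOfLE i.castSucc_le_succ))}).preimage
      (D.ρ.continuous_map.comp (BarSimplex.continuous_spine (P := D.toCatWithModule) i))

/-- The simplex of `B(*, Δ ↓ C, ρ_* X)` given by a simplex of `B(*, A, X)` and a chain of faces. -/
def faceSimplex {k : SimplexCategory} {n : ℕ} (c : ComposableArrows (FaceCat.{u} k) n)
    (y : (bar.obj D.toCatWithModule).obj (op k)) : BarSimplex (simplexModule.obj D) n :=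
  BarSimplex.ofChain (F := D.pushforward) (c ⋙ faces (D.baseChain y) : ComposableArrows _ n)
    (⟨BarSimplex.pull (c.obj 0).map.toOrderHom y, rfl⟩ : D.Fibre _)

/-- The chain below `y` in `C` is locally constant, so near each point the chain of simplices is
fixed and only the point of the fibre varies. -/
theorem continuous_faceSimplex {k : SimplexCategory} {n : ℕ} (c : ComposableArrows (FaceCat.{u} k) n) :
    Continuous (D.faceSimplex c) := by
  rw [continuous_iff_continuousAt]
  intro y₀
  have ho : IsOpen {y | D.baseChain y = D.baseChain y₀} := D.isOpen_baseChain _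
  refine ContinuousOn.continuousAt (s := {y | D.baseChain y = D.baseChain y₀}) ?_ (ho.mem_nhds rfl)
  rw [continuousOn_iff_continuous_domRestrict]
  let g : {y | D.baseChain y = D.baseChain y₀} →
      D.Fibre ((c ⋙ faces (D.baseChain y₀)).obj 0) := fun y =>
    ⟨BarSimplex.pull (c.obj 0).map.toOrderHom y.1,
      congrArg (fun σ => (nerve D.C).map (c.obj 0).map.op σ) y.2⟩
  have hg : Continuous g := ((BarSimplex.continuous_pull (P := D.toCatWithModule) _).comp
    continuous_subtype_val).subtype_mk _
  have : ∀ y, Set.domRestrict _ (D.faceSimplex c) y = BarSimplex.ofChain (F := D.pushforward)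
      (c ⋙ faces (D.baseChain y₀) : ComposableArrows _ n) (g y) := by
    rintro ⟨y, hy⟩
    have : ∀ (σ) (h : D.baseChain y = σ), D.faceSimplex c y = BarSimplex.ofChain (F := D.pushforward)
      (c ⋙ faces σ : ComposableArrows _ n) (⟨BarSimplex.pull (c.obj 0).map.toOrderHom y,
      congrArg (fun σ => (nerve D.C).map (c.obj 0).map.op σ) h⟩ : D.Fibre ((c ⋙ faces σ).obj 0)) := by
      rintro _ rfl
      rfl
    exact this _ hy
  exact (((BarSimplex.continuous_ofChain _).comp hg).congr fun y => (this y).symm)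

end ModuleOverDiscrete

namespace ModuleOverDiscrete

open CatWithModule SimplicialSpace

variable (D : ModuleOverDiscrete.{u}) {Z : Type u} [TopologicalSpace Z]

theorem pull_congr {P : CatWithModule.{v, u}} {m n : ℕ} {θ θ' : Fin (m + 1) →o Fin (n + 1)}
    (h : θ = θ') (z : BarSimplex P n) : BarSimplex.pull θ z = BarSimplex.pull θ' z := by
  rw [h]

theorem faceSimplex_comp {k : SimplexCategory} {m n : ℕ} (θ : Fin (m + 1) →o Fin (n + 1))
    (c : ComposableArrows (FaceCat.{u} k) n) (y : (bar.obj D.toCatWithModule).obj (op k)) :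
    D.faceSimplex (θ.monotone.functor ⋙ c : ComposableArrows _ m) y =
      BarSimplex.pull θ (D.faceSimplex c y) := by
  refine Eq.trans ?_ (D.pull_ofChain θ _ _).symm
  refine congrArg (BarSimplex.ofChain (F := D.pushforward)
    (θ.monotone.functor ⋙ c ⋙ faces (D.baseChain y) : ComposableArrows _ m)) (Subtype.ext ?_)
  refine Eq.trans ?_ (BarSimplex.pull_comp _ _ y)
  exact pull_congr (congrArg SimplexCategory.Hom.toOrderHom
    (c.map (homOfLE (Fin.zero_le (θ 0)))).2.symm) y

theorem faceSimplex_push {k l : SimplexCategory} {n : ℕ} (α : k ⟶ l)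
    (c : ComposableArrows (FaceCat.{u} k) n) (y : (bar.obj D.toCatWithModule).obj (op l)) :
    D.faceSimplex (c ⋙ FaceCat.push α : ComposableArrows _ n) y =
      D.faceSimplex c ((bar.obj D.toCatWithModule).map α.op y) := by
  -- The two sides have points in fibres over equal but not syntactically equal simplices; the
  -- functor is made a variable so that the equality can be eliminated.
  have key : ∀ (T : FaceCat.{u} k ⥤ SimplexOver D.C) (hT : T = FaceCat.push α ⋙ faces (D.baseChain y))
      (w : D.Fibre (T.obj (c.obj 0))), w.1 ≍ BarSimplex.pull (c.obj 0).map.toOrderHom (BarSimplex.pull α.toOrderHom y) →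
      D.faceSimplex (c ⋙ FaceCat.push α : ComposableArrows _ n) y =
        BarSimplex.ofChain (F := D.pushforward) (c ⋙ T : ComposableArrows _ n) w := by
    rintro _ rfl w hw
    refine congrArg (BarSimplex.ofChain (F := D.pushforward)
      (c ⋙ FaceCat.push α ⋙ faces (D.baseChain y) : ComposableArrows _ n)) (Subtype.ext ?_)
    refine Eq.trans ?_ (eq_of_heq hw).symm
    exact BarSimplex.pull_comp _ _ y
  exact key _ (push_faces α (D.baseChain y)).symm _ HEq.rfl

/-- The natural family on chains of faces given by a map out of the realization. -/
noncomputable def baseFamily (Φ : C(realization.obj (bar.obj (simplexModule.obj D)), Z))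
    (k : SimplexCategory) :
    (Coll.marking.{u} k).base.toSSet ⟶ (sing (bar.obj D.toCatWithModule) Z).obj k :=
  SSet.homMk (fun d m => Sing.mk (Φ.comp ((incl (bar.obj (simplexModule.obj D)) d.unop).comp
    (ContinuousMap.prodMap ⟨D.faceSimplex (Coll.lower m.1.1 m.2), D.continuous_faceSimplex _⟩
      (.id _))))) (by
    intro d d' θ m
    refine Sing.ext fun y t => congrArg Φ ?_
    refine Eq.trans ?_ (incl_map (bar.obj (simplexModule.obj D)) θ.unop
      (D.faceSimplex (Coll.lower m.1.1 m.2) y) t)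
    exact congrArg (fun z => incl (bar.obj (simplexModule.obj D)) d'.unop (z, t))
      (D.faceSimplex_comp θ.unop.toOrderHom (Coll.lower m.1.1 m.2) y))

theorem val_baseFamily (Φ : C(realization.obj (bar.obj (simplexModule.obj D)), Z))
    {k : SimplexCategory} {d : SimplexCategoryᵒᵖ} (m : (Coll.marking.{u} k).base.toSSet.obj d) (y) (t) :
    Sing.val ((D.baseFamily Φ k).app d m) (y, t) =
      Φ (incl (bar.obj (simplexModule.obj D)) d.unop (D.faceSimplex (Coll.lower m.1.1 m.2) y, t)) := rfl

theorem push_mem_base {k l : SimplexCategory} (α : k ⟶ l) (d : SimplexCategoryᵒᵖ)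
    (m : (Coll.cylinder.{u}.functor.obj k).obj d) (hm : m ∈ (Coll.marking k).base.obj d) :
    (Coll.cylinder.functor.map α).app d m ∈ (Coll.marking l).base.obj d :=
  fun a h => hm a ((Coll.isPt_push α _).1 h)

theorem baseFamily_push (Φ : C(realization.obj (bar.obj (simplexModule.obj D)), Z))
    {k l : SimplexCategory} (α : k ⟶ l) (d : SimplexCategoryᵒᵖ)
    (m : (Coll.cylinder.{u}.functor.obj k).obj d) (hm : m ∈ (Coll.marking k).base.obj d) :
    (D.baseFamily Φ l).app d ⟨_, push_mem_base α d m hm⟩ =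
      ((sing (bar.obj D.toCatWithModule) Z).map α).app d ((D.baseFamily Φ k).app d ⟨m, hm⟩) := by
  refine Sing.ext fun y t => congrArg Φ ?_
  refine congrArg (fun z => incl (bar.obj (simplexModule.obj D)) d.unop (z, t)) ?_
  refine Eq.trans ?_ (D.faceSimplex_push α (Coll.lower m.1 hm) y)
  exact congrArg (fun c => D.faceSimplex c y) (Coll.lower_push α m.1 hm _)

/-- The map out of the realization given by the restriction of a natural family to faces. -/
noncomputable def descBase (G : Coll.cylinder.functor ⟶ sing (bar.obj D.toCatWithModule) Z) :
    C(realization.obj (bar.obj (simplexModule.obj D)), Z) :=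
  desc (bar.obj (simplexModule.obj D))
    (fun n => ⟨fun p => Sing.val ((G.app _).app _ (Coll.incChain (toFaceChain (BarSimplex.chain p.1))))
      ((D.fibrePt p.1).1, p.2), BarSimplex.continuous_of_ofChain (F := D.pushforward) fun c =>
        (Sing.val ((G.app _).app _ (Coll.incChain (toFaceChain c)))).continuous.comp
          (Continuous.prodMap (f := fun y : D.Fibre (c.obj 0) => y.1)
            continuous_subtype_val continuous_id)⟩) (by
    intro m n θ z t
    obtain ⟨c, y, rfl⟩ := BarSimplex.exists_ofChain (F := D.pushforward) z
    have h0 := D.pull_ofChain θ.toOrderHom c y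
    let c' : ComposableArrows (SimplexOver D.C) m.len := θ.toOrderHom.monotone.functor ⋙ c
    let α := face (c.map (homOfLE (Fin.zero_le (θ.toOrderHom 0))))
    refine (congrArg (fun w : BarSimplex (simplexModule.obj D) m.len =>
      Sing.val ((G.app _).app _ (Coll.incChain (toFaceChain w.chain))) ((D.fibrePt w).1, t)) h0).trans ?_
    have h1 := congrArg (fun q => Sing.val (q.app (op m) (Coll.incChain (toFaceChain c'))) (y.1, t))
      (G.naturality α)
    refine h1.symm.trans ?_
    have h2 : (Coll.cylinder.functor.map α).app (op m) (Coll.incChain (toFaceChain c')) = _ :=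
      push_incChain θ c
    refine (congrArg (fun w => Sing.val ((G.app _).app (op m) w) (y.1, t)) h2).trans ?_
    exact Sing.val_app_map (G.app _) θ.op (Coll.incChain (toFaceChain c)) y.1 t)

theorem descBase_incl (G : Coll.cylinder.functor ⟶ sing (bar.obj D.toCatWithModule) Z)
    {n : SimplexCategory} (c : ComposableArrows (SimplexOver D.C) n.len) (y : D.Fibre (c.obj 0)) (t) :
    D.descBase G (incl (bar.obj (simplexModule.obj D)) n (BarSimplex.ofChain (F := D.pushforward) c y, t)) =
      Sing.val ((G.app _).app (op n) (Coll.incChain (toFaceChain c))) (y.1, t) := rfl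

theorem exists_incl_ofChain (x : realization.obj (bar.obj (simplexModule.obj D))) :
    ∃ (n : SimplexCategory) (c : ComposableArrows (SimplexOver D.C) n.len) (y : D.Fibre (c.obj 0)) (t : _),
      x = incl (bar.obj (simplexModule.obj D)) n (BarSimplex.ofChain (F := D.pushforward) c y, t) := by
  obtain ⟨n, ⟨z, t⟩, rfl⟩ := exists_incl _ x
  obtain ⟨c, y, rfl⟩ := BarSimplex.exists_ofChain (F := D.pushforward) z
  exact ⟨n, c, y, t, rfl⟩

/-- The chain of faces starts with the identity, so the point is not changed. Hence every simplex is
of the form `faceSimplex`, and a map out of the homotopy colimit is determined by its family on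
`base`. -/
theorem faceSimplex_toFaceChain {n : ℕ} (c : ComposableArrows (SimplexOver D.C) n)
    (y : D.Fibre (c.obj 0)) :
    D.faceSimplex (toFaceChain c) y.1 = BarSimplex.ofChain (F := D.pushforward) c y := by
  have hσ : D.baseChain (k := (c.obj 0).1.unop) y.1 = (c.obj 0).2 := y.2
  have key : ∀ (c' : ComposableArrows (SimplexOver D.C) n)
      (hc : toFaceChain c ⋙ faces (D.baseChain (k := (c.obj 0).1.unop) y.1) = c')
      (w : D.Fibre (c'.obj 0)), w.1 ≍ y.1 → D.faceSimplex (toFaceChain c) y.1 =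
        BarSimplex.ofChain (F := D.pushforward) c' w := by
    rintro _ rfl w hw
    refine congrArg (BarSimplex.ofChain (F := D.pushforward) _) (Subtype.ext ?_)
    have hid : ((toFaceChain c).obj 0).map = 𝟙 _ := by
      change face (c.map (𝟙 0)) = _
      rw [c.map_id]
      rfl
    have h2 : ∀ (l : SimplexCategory) (f : l ⟶ (c.obj 0).1.unop) (hl : l = (c.obj 0).1.unop)
        (hf : f = eqToHom hl), BarSimplex.pull f.toOrderHom y.1 ≍ y.1 := by
      rintro l f rfl rfl
      exact heq_of_eq (BarSimplex.pull_id y.1)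
    exact eq_of_heq ((h2 _ _ rfl hid).trans hw.symm)
  exact key c ((congrArg (fun σ => toFaceChain c ⋙ faces σ) hσ).trans (faces_toFaceChain c)) y HEq.rfl

theorem descBase_eq_of_base {Φ : C(realization.obj (bar.obj (simplexModule.obj D)), Z)}
    {G : Coll.cylinder.functor ⟶ sing (bar.obj D.toCatWithModule) Z}
    (h : ∀ k d m (hm : m ∈ (Coll.marking.{u} k).base.obj d),
      (G.app k).app d m = (D.baseFamily Φ k).app d ⟨m, hm⟩) : D.descBase G = Φ := by
  ext x
  obtain ⟨n, c, y, t, rfl⟩ := D.exists_incl_ofChain x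
  rw [descBase_incl, h _ _ _ (Coll.incChain_mem _)]
  refine (D.val_baseFamily Φ _ _ _).trans (congrArg (fun z => Φ (incl _ n (z, t))) ?_)
  exact D.faceSimplex_toFaceChain c y

/-- The comparison map. -/
noncomputable def compareMap : C(realization.obj (bar.obj (simplexModule.obj D)),
    realization.obj (bar.obj D.toCatWithModule)) :=
  (realization.map (compare.app D)).hom

theorem compareMap_incl {n : SimplexCategory} (z : BarSimplex (simplexModule.obj D) n.len) (t) :
    D.compareMap (incl (bar.obj (simplexModule.obj D)) n (z, t)) =
      incl (bar.obj D.toCatWithModule) n (D.compareApp z, t) := rfl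

/-- On faces the comparison is the projection of the cylinder to indices: both operators pick out
the first vertices of the faces in `[k]`. -/
theorem compareMap_faceSimplex {k n : SimplexCategory} (c : ComposableArrows (FaceCat.{u} k) n.len)
    (y : (bar.obj D.toCatWithModule).obj (op k)) (t) (a : n ⟶ k)
    (ha : ∀ i, a.toOrderHom i = (c.obj i).first) :
    D.compareMap (incl (bar.obj (simplexModule.obj D)) n (D.faceSimplex c y, t)) =
      incl (bar.obj D.toCatWithModule) k (y, affineMap a t) := by
  rw [compareMap_incl]
  refine Eq.trans ?_ (incl_map (bar.obj D.toCatWithModule) a y t)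
  refine congrArg (fun z => incl (bar.obj D.toCatWithModule) n (z, t)) ?_
  refine (BarSimplex.pull_comp _ _ y).symm.trans (pull_congr (OrderHom.ext _ _ (funext fun i => ?_)) y)
  refine Eq.trans ?_ (ha i).symm
  exact congrArg (fun θ => θ.toOrderHom 0) (c.map (homOfLE (Fin.zero_le i))).2

theorem descBase_familyOfMap (g : C(realization.obj (bar.obj D.toCatWithModule), Z)) :
    D.descBase (Coll.familyOfMap g) = g.comp D.compareMap := by
  ext x
  obtain ⟨n, c, y, t, rfl⟩ := D.exists_incl_ofChain x
  rw [descBase_incl, ContinuousMap.comp_apply, ← D.faceSimplex_toFaceChain c y]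
  exact (Coll.val_familyOfMap g _ _ _).trans
    (congrArg g (D.compareMap_faceSimplex _ _ _ _ fun _ => rfl).symm)

theorem compareMap_baseFamily {k : SimplexCategory} {d : SimplexCategoryᵒᵖ}
    (m : (Coll.cylinder.{u}.functor.obj k).obj d) (hm : m ∈ (Coll.marking k).base.obj d) (y) (t) :
    D.compareMap (Sing.val ((D.baseFamily (.id _) k).app d ⟨m, hm⟩) (y, t)) =
      incl (bar.obj D.toCatWithModule) k (y, affineMap (Coll.indexHom m) t) :=
  D.compareMap_faceSimplex _ _ _ _ fun i => Coll.index_eq_first _ (hm i)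

end ModuleOverDiscrete

/-! ### The homotopy equivalence -/

namespace SimplicialSpace

variable {Y : SimplicialObject TopCat.{u}} {Z : Type u} [TopologicalSpace Z]

/-- Natural families of maps which agree on `P` are homotopic. -/
theorem exists_homotopy {Q : SupportedCosimplicial.{u}} {P : ∀ k, (Q.functor.obj k).Subcomplex}
    (hP : ∀ {k l : SimplexCategory} (α : k ⟶ l) d (m : (Q.functor.obj k).obj d),
      m ∈ (P k).obj d → (Q.functor.map α).app d m ∈ (P l).obj d)
    (hPbd : ∀ k, SSet.anodyneExtensions (P k ⊔ Q.bd k).ι) (hY : ClosedDegeneracies Y)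
    (N : ∀ k, Nonempty (NDR (Y.obj (op k)) (degenerate Y k))) (G₀ G₁ : Q.functor ⟶ sing Y Z)
    (h : ∀ k d m, m ∈ (P k).obj d → (G₀.app k).app d m = (G₁.app k).app d m) :
    ∃ K : Q.functor ⟶ sing Y C(unitInterval, Z), ∀ k d m y t,
      Sing.val ((K.app k).app d m) (y, t) 0 = Sing.val ((G₀.app k).app d m) (y, t) ∧
      Sing.val ((K.app k).app d m) (y, t) 1 = Sing.val ((G₁.app k).app d m) (y, t) := by
  -- The homotopy is an extension problem for `Y × I`: the family is given over `Y × {0, 1}` by `G₀`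
  -- and `G₁`, and on `P` it is constant in the interval.
  let A : ∀ k, Set ((prodConst Y unitInterval).obj (op k)) := fun k =>
    {p : Y.obj (op k) × unitInterval | p.2 ∈ ({0, 1} : Set unitInterval)}
  have hN : ∀ k, Nonempty (NDR ((prodConst Y unitInterval).obj (op k))
      (A k ∪ degenerate (prodConst Y unitInterval) k)) := by
    intro k
    obtain ⟨M⟩ := (N k).some.exists_prod NDR.unitInterval
    have he : A k ∪ degenerate (prodConst Y unitInterval) k =
        {p : Y.obj (op k) × unitInterval | p.2 ∈ ({0, 1} : Set unitInterval) ∨ p.1 ∈ degenerate Y k} :=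
      Set.ext fun p => or_congr Iff.rfl (degenerate_prodConst Y unitInterval k p)
    rw [he]
    exact ⟨M⟩
  have hglue : ∀ k d (m : (Q.functor.obj k).obj d),
      ∃ c : C(A k × stdSimplex ℝ (Fin (d.unop.len + 1)), Z),
        (∀ y hy t, c (⟨(y, 0), hy⟩, t) = Sing.val ((G₀.app k).app d m) (y, t)) ∧
        ∀ y hy t, c (⟨(y, 1), hy⟩, t) = Sing.val ((G₁.app k).app d m) (y, t) := by
    intro k d m
    have hcont : Continuous fun p : A k × stdSimplex ℝ (Fin (d.unop.len + 1)) =>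
        ((p.1.1 : Y.obj (op k) × unitInterval), p.2) :=
      (continuous_subtype_val.comp continuous_fst).prodMk continuous_snd
    have hcont' : ∀ s : Set (A k × stdSimplex ℝ (Fin (d.unop.len + 1))), Continuous fun p : s =>
        (((p.1.1.1 : Y.obj (op k) × unitInterval).1, p.1.2) :
          Y.obj (op k) × stdSimplex ℝ (Fin (d.unop.len + 1))) := fun s =>
      ((continuous_fst.comp (continuous_fst.comp hcont)).prodMk continuous_snd).comp
        continuous_subtype_val
    obtain ⟨c, hc⟩ := exists_continuousMap_of_isClosed_cover (Z := Z)
      (fun b : Bool => {p : A k × stdSimplex ℝ (Fin (d.unop.len + 1)) |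
        (p.1.1 : Y.obj (op k) × unitInterval).2 = cond b 1 0})
      (fun b => isClosed_eq (continuous_snd.comp (continuous_fst.comp hcont)) continuous_const)
      (by
        rintro ⟨⟨p, hp | hp⟩, t⟩
        · exact ⟨false, hp⟩
        · exact ⟨true, hp⟩)
      (fun b => match b with
        | false => ⟨fun p => Sing.val ((G₀.app k).app d m) (p.1.1.1.1, p.1.2),
            (Sing.val ((G₀.app k).app d m)).continuous.comp (hcont' _)⟩
        | true => ⟨fun p => Sing.val ((G₁.app k).app d m) (p.1.1.1.1, p.1.2),
            (Sing.val ((G₁.app k).app d m)).continuous.comp (hcont' _)⟩)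
      (by
        rintro (_ | _) (_ | _) p hi hj
        · rfl
        · exact absurd (hi.symm.trans hj) zero_ne_one
        · exact absurd (hj.symm.trans hi) zero_ne_one
        · rfl)
    exact ⟨c, fun y hy t => hc false _ rfl, fun y hy t => hc true _ rfl⟩
  choose c hc0 hc1 using hglue
  obtain ⟨F, -, hF⟩ := exists_extension (Q := Q) (Y := prodConst Y unitInterval) (Z := Z) (A := A)
    hP hPbd (hY.prodConst unitInterval) (fun k => (hN k).some) (fun α y hy => hy)
    (fun k => (Set.toFinite ({0, 1} : Set unitInterval)).isClosed.preimage continuous_snd)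
    (fun k => (P k).ι ≫ G₀.app k ≫ Sing.restr Z
      (⟨Prod.fst, continuous_fst⟩ : C(Y.obj (op k) × unitInterval, Y.obj (op k))))
    (fun {k l} α d m hm => Sing.ext fun p t =>
      congrArg (fun q => Sing.val (q.app d m) (p.1, t)) (G₀.naturality α))
    (fun k => SSet.homMk (fun d m => Sing.mk (c k d m)) (by
      intro d d' θ m
      refine Sing.ext ?_
      rintro ⟨⟨y, r⟩, hr⟩ t
      change c k d' _ _ = c k d m (_, affineMap θ.unop t)
      obtain rfl | rfl : r = 0 ∨ r = 1 := hr
      · exact (hc0 _ _ _ _ _ _).trans ((Sing.val_app_map (G₀.app k) θ m y t).trans (hc0 _ _ _ _ _ _).symm)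
      · exact (hc1 _ _ _ _ _ _).trans ((Sing.val_app_map (G₁.app k) θ m y t).trans (hc1 _ _ _ _ _ _).symm)))
    (by
      rintro k l α d m ⟨y, r⟩ hr t
      change c l d _ _ = c k d m _
      obtain rfl | rfl : r = 0 ∨ r = 1 := hr
      · exact (hc0 _ _ _ _ _ _).trans ((congrArg (fun q => Sing.val (q.app d m) (y, t))
          (G₀.naturality α)).trans (hc0 _ _ _ (Y.map α.op y) _ _).symm)
      · exact (hc1 _ _ _ _ _ _).trans ((congrArg (fun q => Sing.val (q.app d m) (y, t))
          (G₁.naturality α)).trans (hc1 _ _ _ (Y.map α.op y) _ _).symm))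
    (by
      rintro k d m hm ⟨y, r⟩ hr t
      change Sing.val ((G₀.app k).app d m) (y, t) = c k d m _
      obtain rfl | rfl : r = 0 ∨ r = 1 := hr
      · exact (hc0 _ _ _ _ _ _).symm
      · exact (congrArg (fun s => Sing.val s (y, t)) (h k d m hm)).trans (hc1 _ _ _ _ _ _).symm)
  -- The homotopy is curried to take values in paths, so that it descends to realizations without
  -- any need to compare the quotient topology with products by the interval.
  let K : ∀ k, Q.functor.obj k ⟶ (sing Y C(unitInterval, Z)).obj k := fun k =>
    SSet.homMk (fun d m => Sing.mk (ContinuousMap.curry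
      ⟨fun p : (Y.obj (op k) × stdSimplex ℝ (Fin (d.unop.len + 1))) × unitInterval =>
        Sing.val ((F.app k).app d m) ((p.1.1, p.2), p.1.2),
        (Sing.val ((F.app k).app d m)).continuous.comp
          (((continuous_fst.comp continuous_fst).prodMk continuous_snd).prodMk
            (continuous_snd.comp continuous_fst))⟩)) (by
      intro d d' θ m
      refine Sing.ext fun y t => ContinuousMap.ext fun r => ?_
      exact Sing.val_app_map (F.app k) θ m (y, r) t)
  refine ⟨⟨K, fun k l α => ?_⟩, fun k d m y t => ⟨?_, ?_⟩⟩
  · refine SSet.hom_ext_apply fun d m => Sing.ext fun y t => ContinuousMap.ext fun r => ?_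
    exact congrArg (fun q => Sing.val (q.app d m) ((y, r), t)) (F.naturality α)
  · exact (hF k d m (y, 0) (Or.inl rfl) t).trans (hc0 _ _ _ _ _ _)
  · exact (hF k d m (y, 1) (Or.inr rfl) t).trans (hc1 _ _ _ _ _ _)

/-- Composition of a natural family with a map. -/
noncomputable def singMap (Y : SimplicialObject TopCat.{u}) {Z Z' : Type u} [TopologicalSpace Z]
    [TopologicalSpace Z'] (g : C(Z, Z')) : sing Y Z ⟶ sing Y Z' where
  app k := Sing.postcomp (Y.obj (op k)) g
  naturality _ _ _ := rfl

end SimplicialSpace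

/-- A homotopy from a map to a space of paths. -/
theorem ContinuousMap.homotopic_of_paths {X Z : Type u} [TopologicalSpace X] [TopologicalSpace Z]
    {f₀ f₁ : C(X, Z)} (L : C(X, C(unitInterval, Z))) (h₀ : ∀ x, L x 0 = f₀ x)
    (h₁ : ∀ x, L x 1 = f₁ x) : f₀.Homotopic f₁ :=
  ⟨⟨L.uncurry.comp ⟨Prod.swap, continuous_swap⟩, h₀, h₁⟩⟩

namespace ModuleOverDiscrete

open CatWithModule SimplicialSpace

variable (D : ModuleOverDiscrete.{u})

/-- Extend the identity from the faces to a family `Φ` on the cylinder; its restriction `g` to the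
points is the homotopy inverse. -/
theorem exists_homotopyEquiv (hD : D.A.IdentityIsCofibration) :
    ∃ e : ContinuousMap.HomotopyEquiv (realization.obj (bar.obj (simplexModule.obj D)))
      (realization.obj (bar.obj D.toCatWithModule)), e.toFun = D.compareMap := by
  let Y := bar.obj D.toCatWithModule
  let E : Type u := realization.obj (bar.obj (simplexModule.obj D))
  have hY : ClosedDegeneracies Y := closedDegeneracies_bar hD
  have N : ∀ k, Nonempty (NDR (Y.obj (op k)) (degenerate Y k)) := exists_ndr_bar hD
  have hpts : ∀ {k l : SimplexCategory} (α : k ⟶ l) d (m : (Coll.cylinder.{u}.functor.obj k).obj d),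
      m ∈ (Coll.marking k).pts.obj d →
        (Coll.cylinder.functor.map α).app d m ∈ (Coll.marking l).pts.obj d :=
    fun α d m hm a => (Coll.isPt_push α _).2 (hm a)
  obtain ⟨Φ, hΦ, -⟩ := exists_extension (Q := Coll.cylinder) (Y := Y) (Z := E) (A := fun _ => ∅)
    (P := fun k => (Coll.marking k).base) push_mem_base Coll.anodyneExtensions_base_sup_bd hY
    (fun k => by rw [Set.empty_union]; exact (N k).some) (fun _ _ h => h) (fun _ => isClosed_empty)
    (D.baseFamily (.id _)) (D.baseFamily_push (.id _))
    (fun k => SSet.homMk (fun d _ => Sing.mk ⟨fun p => p.1.2.elim, by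
      rw [continuous_iff_continuousAt]
      exact fun p => p.1.2.elim⟩) fun θ m => Sing.ext fun y => y.2.elim)
    (fun _ _ _ _ h => h.elim) (fun _ _ _ _ _ h => h.elim)
  have hE : D.descBase Φ = .id _ := D.descBase_eq_of_base hΦ
  let g : C(realization.obj Y, E) := Coll.descPts Φ
  -- The projection to indices followed by `g` agrees with `Φ` on points. On faces the homotopy runs
  -- from `g ∘ compareMap` to the identity.
  obtain ⟨K, hK⟩ := exists_homotopy (Q := Coll.cylinder) (P := fun k => (Coll.marking k).pts) hpts
    Coll.anodyneExtensions_pts_sup_bd hY N (Coll.familyOfMap g) Φ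
    fun k d m hm => Sing.ext fun y t => (Coll.val_of_mem_pts Φ m hm y t).symm
  -- The family `compareMap ∘ Φ` agrees on faces with the projection to indices. On points the
  -- homotopy runs from `compareMap ∘ g` to the identity.
  obtain ⟨K', hK'⟩ := exists_homotopy (Q := Coll.cylinder) (P := fun k => (Coll.marking k).base)
    push_mem_base Coll.anodyneExtensions_base_sup_bd hY N (Φ ≫ singMap Y D.compareMap)
    (Coll.familyOfMap (.id _)) fun k d m hm => Sing.ext fun y t =>
      (congrArg (fun s => D.compareMap (Sing.val s (y, t))) (hΦ k d m hm)).trans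
        (D.compareMap_baseFamily m hm y t)
  refine ⟨⟨D.compareMap, g, ?_, ?_⟩, rfl⟩
  · refine ContinuousMap.homotopic_of_paths (D.descBase K) (fun x => ?_) fun x => ?_
    · rw [← D.descBase_familyOfMap]
      obtain ⟨n, c, y, t, rfl⟩ := D.exists_incl_ofChain x
      exact (hK _ _ _ _ _).1
    · rw [← hE]
      obtain ⟨n, c, y, t, rfl⟩ := D.exists_incl_ofChain x
      exact (hK _ _ _ _ _).2
  · refine ContinuousMap.homotopic_of_paths (Coll.descPts K') (fun x => ?_) fun x => ?_
    · obtain ⟨k, ⟨y, t⟩, rfl⟩ := exists_incl _ x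
      exact (hK' _ _ _ _ _).1
    · obtain ⟨k, ⟨y, t⟩, rfl⟩ := exists_incl _ x
      refine (hK' _ _ _ _ _).2.trans ?_
      have : Coll.indexHom (Coll.ptChain.{u} (𝟙 k)) = 𝟙 k := rfl
      rw [Coll.val_familyOfMap, this, affineMap_id]
      rfl

end ModuleOverDiscrete

theorem theorem3p2 :
    ∃ η : ModuleOverDiscrete.simplexModule.{u} ⋙ hocolim.{0, u} ⟶
        ModuleOverDiscrete.forget.{u} ⋙ hocolim.{u, u},
      ∀ D : ModuleOverDiscrete.{u}, D.A.IdentityIsCofibration →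
        ∃ e : ContinuousMap.HomotopyEquiv
            (hocolim.obj (ModuleOverDiscrete.simplexModule.obj D))
            (hocolim.obj D.toCatWithModule),
          e.toFun = (η.app D).hom := by
  refine ⟨Functor.whiskerRight ModuleOverDiscrete.compare.{u} SimplicialSpace.realization.{u},
    fun D hD => ?_⟩
  exact D.exists_homotopyEquiv hD
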